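/- **Theorem.** Conventions: for a one-form $\alpha$ put $d\alpha(X,Y)=\tfrac12\big(X(\alpha(Y))-Y(\alpha(X))-\alpha([X,Y])\big)$, and for one-forms $\beta,\gamma$ put $(\beta\wedge\gamma)(X,Y)=\beta(X)\gamma(Y)-\beta(Y)\gamma(X)$. The Ricci tensor of an affine connection with curvature $R_{X,Y}Z=\nabla_X\nabla_YZ-\nabla_Y\nabla_XZ-\nabla_{[X,Y]}Z$ is $\mathsf{Ric}(Y,Z)=\mathrm{trace}(X\mapsto R_{X,Y}Z)$. Let $M$ be a smooth manifold of dimension $2n+1$ with a contact form $\alpha$, let $(N,\nu)$ be a symplectic manifold of dimension $2n$, let $\pi:M\to N$ be a smooth map with $d\alpha=\pi^*\nu$, and let $\nabla$ be a symplectic connection on $N$, i.e. a smooth torsion-free affine connection with $\nabla\nu=0$. Let $E$ be the Reeb vector field of $\alpha$ ($\alpha(E)=1$, $d\alpha(E,\cdot)=0$), let $q$ be the coordinate along $\mathbb R$ on $\mathbb R\times M$ and $Q=\partial/\partial q$. For a vector field $X$ on $N$ let $\overline X$ be its horizontal lift to $\mathbb R\times M$, i.e. the vector field with $dq(\overline X)=0$,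 $\alpha(\overline X)=0$ that projects to $X$. Then $\omega=e^{2q}(d\alpha+dq\wedge\alpha)$ is a symplectic form on $\mathbb R\times M$, and there is a smooth affine connection $\overrightarrow\nabla$ on $\mathbb R\times M$ that is torsion-free and Ricci-flat, preserves $\omega$ ($\overrightarrow\nabla\omega=0$), and is a cone connection: $\overrightarrow\nabla Q=\mathrm{Id}$, $\overrightarrow\nabla_QY=Y$ for vector fields $Y$ on $M$, and $\overrightarrow\nabla$ is invariant under translations in $q$. Explicitly, $\overrightarrow\nabla$ can be chosen so that, for vector fields $X,Y$ on $N$, $$\overrightarrow\nabla_{\overline X}\overline Y=\overline{\nabla_XY}-\nu(X,Y)E-\nu(X,\sigma Y)Q,\qquad \overrightarrow\nabla_E\overline X=\overrightarrow\nabla_{\overline X}E=\overline{\sigma X}+\nu(X,U)Q,$$ $$\overrightarrow\nabla_EE=(\pi^*f)Q-\overline U,\qquad \overrightarrow\nabla_Q\overline X=\overline X,\qquad \overrightarrow\nabla_QE=E,\qquad \overrightarrow\nabla Q=\mathrm{Id},$$ where the endomorphism field $\sigma$, the vector field $U$ and the function $f$ on $N$ satisfy $$\nu(X,\sigma Y)=\tfrac1{2n+2}\mathsf{Ric}^{\nabla}(X,Y),\qquad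 (2n+1)\,\nu(X,U)=-\mathrm{trace}\big(Y\mapsto(\nabla_Y\sigma)X\big),\qquad 2n\,f=\mathrm{trace}(\nabla U)+\mathrm{trace}(\sigma^2).$$ -/

import Mathlib

open Bundle VectorField
open scoped Manifold ContDiff

noncomputable section

set_option linter.unusedSectionVars false

namespace SymplecticCone

section General

variable {E : Type*} [NormedAddCommGroup E] [NormedSpace ℝ E] [FiniteDimensional ℝ E]
  [CompleteSpace E] {H : Type*} [TopologicalSpace H] {I : ModelWithCorners ℝ E H}
  {M : Type*} [TopologicalSpace M] [ChartedSpace H M] [IsManifold I ∞ M]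

variable (I M) in
/-- Smooth differential one-forms on a manifold. -/
structure OneForm where
  /-- The covector at each point. -/
  toFun : Π x : M, TangentSpace I x →L[ℝ] ℝ
  smooth : ContMDiff I (I.prod 𝓘(ℝ, E →L[ℝ] ℝ)) ∞
    (fun x ↦ TotalSpace.mk' (E →L[ℝ] ℝ) x (toFun x))

instance : CoeFun (OneForm I M) fun _ ↦ Π x : M, TangentSpace I x →L[ℝ] ℝ := ⟨OneForm.toFun⟩

/-- The expression `½ (X(α(Y)) - Y(α(X)) - α([X, Y]))` at the point `x`. -/
def OneForm.dAux (α : OneForm I M) (X Y : Π x : M, TangentSpace I x) (x : M) : ℝ :=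
  (1 / 2 : ℝ) * (mvfderiv I (fun y ↦ α y (Y y)) x (X x) - mvfderiv I (fun y ↦ α y (X y)) x (Y x)
    - α x (mlieBracket I X Y x))

theorem OneForm.mdifferentiableAt_apply (α : OneForm I M) {X : Π x : M, TangentSpace I x} {x : M}
    (hX : MDiffAt (T% X) x) : MDiffAt (fun y ↦ α y (X y)) x := by
  have h : MDifferentiableAt I (I.prod 𝓘(ℝ, ℝ))
      (fun m ↦ TotalSpace.mk' ℝ (E := Bundle.Trivial M ℝ) m (α m (X m))) x := by
    apply MDifferentiableAt.clm_bundle_apply (F₁ := E)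
    · exact α.smooth.mdifferentiable (by simp) x
    · exact hX
  exact ((mdifferentiableAt_totalSpace _ _).1 h).2

theorem OneForm.dAux_swap (α : OneForm I M) (X Y : Π x : M, TangentSpace I x) (x : M) :
    α.dAux X Y x = -α.dAux Y X x := by
  unfold dAux
  rw [mlieBracket_swap_apply, map_neg]
  ring

theorem OneForm.dAux_tensorial_left (α : OneForm I M) (x : M) (Y : Π x : M, TangentSpace I x)
    (_hY : MDiffAt (T% Y) x) : TensorialAt I E (α.dAux · Y x) x where
  smul {f X} hf hX := by
    have h : mvfderiv I (fun y ↦ α y ((f • X) y)) x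
        = f x • mvfderiv I (fun y ↦ α y (X y)) x + (α x (X x)) • mvfderiv I f x := by
      rw [← mvfderiv_mul hf (α.mdifferentiableAt_apply hX)]
      congr 1
      ext y
      simp
    simp only [dAux, h, mlieBracket_smul_left hf hX]
    simp
    ring
  add {X X'} hX hX' := by
    have h : mvfderiv I (fun y ↦ α y ((X + X') y)) x
        = mvfderiv I (fun y ↦ α y (X y)) x + mvfderiv I (fun y ↦ α y (X' y)) x := by
      rw [← mvfderiv_add (α.mdifferentiableAt_apply hX) (α.mdifferentiableAt_apply hX')]
      congr 1
      ext y
      simp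
    simp only [dAux, h, mlieBracket_add_left hX hX']
    simp
    ring

theorem OneForm.dAux_tensorial_right (α : OneForm I M) (x : M) (X : Π x : M, TangentSpace I x)
    (hX : MDiffAt (T% X) x) : TensorialAt I E (α.dAux X · x) x := by
  have h := α.dAux_tensorial_left x X hX
  constructor
  · intro f Y hf hY
    simp only [α.dAux_swap X, h.smul hf hY, smul_neg]
  · intro Y Y' hY hY'
    simp only [α.dAux_swap X, h.add hY hY', neg_add]

/-- The exterior derivative of a one-form, normalised by
`dα(X, Y) = ½ (X(α(Y)) - Y(α(X)) - α([X, Y]))`; see `OneForm.d_apply`. -/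
def OneForm.d (α : OneForm I M) (x : M) :
    TangentSpace I x →L[ℝ] TangentSpace I x →L[ℝ] ℝ :=
  TensorialAt.mkHom₂ (α.dAux · · x) x (α.dAux_tensorial_left x) (α.dAux_tensorial_right x)

theorem OneForm.d_apply (α : OneForm I M) {X Y : Π x : M, TangentSpace I x} {x : M}
    (hX : MDiffAt (T% X) x) (hY : MDiffAt (T% Y) x) :
    α.d x (X x) (Y x) =
      (1 / 2 : ℝ) * (mvfderiv I (fun y ↦ α y (Y y)) x (X x)
        - mvfderiv I (fun y ↦ α y (X y)) x (Y x) - α x (mlieBracket I X Y x)) :=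
  TensorialAt.mkHom₂_apply _ _ hX hY

/-- `α` is a contact form: it vanishes nowhere and `dα` is nondegenerate on the hyperplanes
`ker α`. (It is used on manifolds of odd dimension `2n + 1` only.) -/
structure IsContactForm (α : OneForm I M) : Prop where
  ne_zero : ∀ x, α x ≠ 0
  nondegenerate : ∀ x (u : TangentSpace I x), α x u = 0 →
    (∀ v : TangentSpace I x, α x v = 0 → α.d x u v = 0) → u = 0

/-- `R` is the Reeb vector field of `α`. -/
structure IsReebField (α : OneForm I M) (R : Π x : M, TangentSpace I x) : Prop where
  apply_eq_one : ∀ x, α x (R x) = 1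
  d_apply_eq_zero : ∀ x (v : TangentSpace I x), α.d x (R x) v = 0

/-- `Ω` is a symplectic form: a smooth, alternating, nondegenerate, closed two-form. -/
structure IsSymplecticForm (Ω : Π x : M, TangentSpace I x →L[ℝ] TangentSpace I x →L[ℝ] ℝ) :
    Prop where
  smooth : ContMDiff I (I.prod 𝓘(ℝ, E →L[ℝ] E →L[ℝ] ℝ)) ∞
    (fun x ↦ TotalSpace.mk' (E →L[ℝ] E →L[ℝ] ℝ) x (Ω x))
  alternating : ∀ x u, Ω x u u = 0
  nondegenerate : ∀ x u, (∀ v, Ω x u v = 0) → u = 0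
  closed : ∀ (x : M) (X Y Z : Π x : M, TangentSpace I x),
    MDiffAt (T% X) x → MDiffAt (T% Y) x → MDiffAt (T% Z) x →
      mvfderiv I (fun y ↦ Ω y (Y y) (Z y)) x (X x)
        - mvfderiv I (fun y ↦ Ω y (X y) (Z y)) x (Y x)
        + mvfderiv I (fun y ↦ Ω y (X y) (Y y)) x (Z x)
        - Ω x (mlieBracket I X Y x) (Z x) + Ω x (mlieBracket I X Z x) (Y x)
        - Ω x (mlieBracket I Y Z x) (X x) = 0

variable (I M) in
/-- Affine connections on `M`, i.e. covariant derivatives on the tangent bundle. Mind the order of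
the arguments: `D Y x v` is `(∇_v Y)(x)`. -/
abbrev AffineConnection := CovariantDerivative I E (TangentSpace I : M → Type _)

/-- `D` preserves the two-form `Ω`, i.e. `DΩ = 0`. -/
def Preserves (D : AffineConnection I M)
    (Ω : Π x : M, TangentSpace I x →L[ℝ] TangentSpace I x →L[ℝ] ℝ) : Prop :=
  ∀ (x : M) (X Y : Π x : M, TangentSpace I x), MDiffAt (T% X) x → MDiffAt (T% Y) x →
    ∀ v : TangentSpace I x,
      mvfderiv I (fun y ↦ Ω y (X y) (Y y)) x v = Ω x (D X x v) (Y x) + Ω x (X x) (D Y x v)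

/-- The curvature `R(u, v) w = ∇_U ∇_V W - ∇_V ∇_U W - ∇_[U, V] W` at `x`, where `U, V, W` are
vector fields extending `u, v, w` that are smooth near `x`; for a smooth connection it does not
depend on their choice. -/
def curvature (D : AffineConnection I M) (x : M) (u v w : TangentSpace I x) : TangentSpace I x :=
  let U := FiberBundle.extend E u
  let V := FiberBundle.extend E v
  let W := FiberBundle.extend E w
  D (fun y ↦ D W y (V y)) x u - D (fun y ↦ D W y (U y)) x v - D W x (mlieBracket I U V x)

/-- The Ricci curvature `Ric(v, w) = trace (u ↦ R(u, v) w)`, the trace being computed in a basis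
of the tangent space. -/
def ricci (D : AffineConnection I M) (x : M) (v w : TangentSpace I x) : ℝ :=
  haveI : FiniteDimensional ℝ (TangentSpace I x) := inferInstanceAs (FiniteDimensional ℝ E)
  let b := Module.finBasis ℝ (TangentSpace I x)
  ∑ i, b.coord i (curvature D x (b i) v w)

/-- The covariant derivative `u ↦ (∇_u σ) v` of a field of endomorphisms `σ`, where `(∇_u σ) v` is
`∇_u (σ V) - σ (∇_u V)` for a vector field `V` extending `v`. -/
def covEndo (D : AffineConnection I M) (σ : Π x : M, TangentSpace I x →L[ℝ] TangentSpace I x)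
    (x : M) (v : TangentSpace I x) : TangentSpace I x →L[ℝ] TangentSpace I x :=
  let V := FiberBundle.extend E v
  D (fun y ↦ σ y (V y)) x - (σ x).comp (D V x)

/-- The trace of an endomorphism of a tangent space. -/
def endoTrace {x : M} (A : TangentSpace I x →L[ℝ] TangentSpace I x) : ℝ :=
  LinearMap.trace ℝ (TangentSpace I x) A.toLinearMap

end General

/-! ### The cone `ℝ × M` -/

section Cone

variable {E : Type*} [NormedAddCommGroup E] [NormedSpace ℝ E] [FiniteDimensional ℝ E]
  [CompleteSpace E] {H : Type*} [TopologicalSpace H] {I : ModelWithCorners ℝ E H}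
  {M : Type*} [TopologicalSpace M] [ChartedSpace H M] [IsManifold I ∞ M]

/-- The differential of the coordinate `q` along the factor `ℝ` of `ℝ × M`. -/
def dq (p : ℝ × M) : TangentSpace (𝓘(ℝ, ℝ).prod I) p →L[ℝ] ℝ :=
  mvfderiv (𝓘(ℝ, ℝ).prod I) (Prod.fst : ℝ × M → ℝ) p

/-- The differential of the projection `ℝ × M → M`. -/
def dproj (p : ℝ × M) : TangentSpace (𝓘(ℝ, ℝ).prod I) p →L[ℝ] TangentSpace I p.2 :=
  mfderiv (𝓘(ℝ, ℝ).prod I) I (Prod.snd : ℝ × M → M) p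

variable (I M) in
/-- The vector field `Q = ∂/∂q` on `ℝ × M`. -/
def radial (p : ℝ × M) : TangentSpace (𝓘(ℝ, ℝ).prod I) p :=
  ((1 : ℝ), (0 : TangentSpace I p.2))

/-- A vector field on `M`, regarded as a vector field on `ℝ × M`. -/
def fromBase (Y : Π x : M, TangentSpace I x) (p : ℝ × M) : TangentSpace (𝓘(ℝ, ℝ).prod I) p :=
  ((0 : ℝ), Y p.2)

/-- The two-form `e^{2q} (dα + dq ∧ α)` on `ℝ × M`, where `α` and `dα` are pulled back from `M`
and `(β ∧ γ)(u, v) = β(u) γ(v) - β(v) γ(u)`. -/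
def coneForm (α : OneForm I M) (p : ℝ × M) :
    TangentSpace (𝓘(ℝ, ℝ).prod I) p →L[ℝ] TangentSpace (𝓘(ℝ, ℝ).prod I) p →L[ℝ] ℝ :=
  let a : TangentSpace (𝓘(ℝ, ℝ).prod I) p →L[ℝ] ℝ := (α p.2).comp (dproj p)
  Real.exp (2 * p.1) •
    (((dproj p).precomp ℝ).comp ((α.d p.2).comp (dproj p)) + ((dq p).smulRight a - a.smulRight (dq p)))

theorem coneForm_apply (α : OneForm I M) (p : ℝ × M) (u v : TangentSpace (𝓘(ℝ, ℝ).prod I) p) :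
    coneForm α p u v = Real.exp (2 * p.1) * (α.d p.2 (dproj p u) (dproj p v)
      + (dq p u * α p.2 (dproj p v) - α p.2 (dproj p u) * dq p v)) :=
  rfl

/-- `D` is a cone connection on `ℝ × M`: it satisfies `∇Q = Id` and `∇_Q Y = Y` for the vector
fields `Y` on `M`, and it is invariant under translations in the direction of `ℝ`. -/
structure IsConeConnection (D : AffineConnection (𝓘(ℝ, ℝ).prod I) (ℝ × M)) : Prop where
  radial_eq_id : ∀ (p : ℝ × M) (v : TangentSpace (𝓘(ℝ, ℝ).prod I) p), D (radial I M) p v = v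
  apply_radial : ∀ (Y : Π x : M, TangentSpace I x), ContMDiff I I.tangent ∞ (T% Y) →
    ∀ p : ℝ × M, D (fromBase Y) p (radial I M p) = fromBase Y p
  invariant : ∀ (X Y : Π x : M, TangentSpace I x), ContMDiff I I.tangent ∞ (T% X) →
    ContMDiff I I.tangent ∞ (T% Y) → ∀ (q q' : ℝ) (x : M),
      dq (I := I) (q, x) (D (fromBase Y) (q, x) (fromBase X (q, x)))
          = dq (I := I) (q', x) (D (fromBase Y) (q', x) (fromBase X (q', x))) ∧
      dproj (I := I) (q, x) (D (fromBase Y) (q, x) (fromBase X (q, x)))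
          = dproj (I := I) (q', x) (D (fromBase Y) (q', x) (fromBase X (q', x)))

variable {E' : Type*} [NormedAddCommGroup E'] [NormedSpace ℝ E'] [FiniteDimensional ℝ E']
  [CompleteSpace E'] {H' : Type*} [TopologicalSpace H'] {J : ModelWithCorners ℝ E' H'}
  {N : Type*} [TopologicalSpace N] [ChartedSpace H' N] [IsManifold J ∞ N]

/-- `X'` is the horizontal lift to `ℝ × M` of the vector field `X` on `N`: it is annihilated by
`dq` and by `α`, and it projects to `X` along `ℝ × M → M → N`. -/
def IsHorizontalLift (α : OneForm I M) (pr : M → N) (X : Π y : N, TangentSpace J y)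
    (X' : Π p : ℝ × M, TangentSpace (𝓘(ℝ, ℝ).prod I) p) : Prop :=
  ∀ p, dq p (X' p) = 0 ∧ α p.2 (dproj p (X' p)) = 0 ∧
    mfderiv I J pr p.2 (dproj p (X' p)) = X (pr p.2)

/-- The connection `D` on `ℝ × M` is built from the connection `nabla` on the symplectic manifold
`(N, ν)`, the field of endomorphisms `σ`, the vector field `U` and the function `f` on `N` by the
formulas below, in which `R` is the Reeb vector field of `α`, `X, Y` are vector fields on `N`, and
a bar denotes the horizontal lift:
`∇_X̄ Ȳ = lift of (nabla_X Y) - ν(X, Y) R - ν(X, σ Y) Q`,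
`∇_R X̄ = ∇_X̄ R = lift of (σ X) + ν(X, U) Q`,
`∇_R R = f Q - Ū`, `∇_Q X̄ = X̄`, `∇_Q R = R`, `∇ Q = Id`. -/
structure IsBuiltFrom (D : AffineConnection (𝓘(ℝ, ℝ).prod I) (ℝ × M)) (α : OneForm I M)
    (R : Π x : M, TangentSpace I x) (pr : M → N)
    (ν : Π y : N, TangentSpace J y →L[ℝ] TangentSpace J y →L[ℝ] ℝ) (nabla : AffineConnection J N)
    (σ : Π y : N, TangentSpace J y →L[ℝ] TangentSpace J y) (U : Π y : N, TangentSpace J y)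
    (f : N → ℝ) : Prop where
  hor_hor : ∀ (X Y : Π y : N, TangentSpace J y), ContMDiff J J.tangent ∞ (T% X) →
    ContMDiff J J.tangent ∞ (T% Y) →
    ∀ X' Y' Z' : Π p : ℝ × M, TangentSpace (𝓘(ℝ, ℝ).prod I) p, IsHorizontalLift α pr X X' →
    IsHorizontalLift α pr Y Y' → IsHorizontalLift α pr (fun y ↦ nabla Y y (X y)) Z' →
    ∀ p, D Y' p (X' p) = Z' p - ν (pr p.2) (X (pr p.2)) (Y (pr p.2)) • fromBase R p
      - ν (pr p.2) (X (pr p.2)) (σ (pr p.2) (Y (pr p.2))) • radial I M p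
  reeb_hor : ∀ X : Π y : N, TangentSpace J y, ContMDiff J J.tangent ∞ (T% X) →
    ∀ X' Z' : Π p : ℝ × M, TangentSpace (𝓘(ℝ, ℝ).prod I) p, IsHorizontalLift α pr X X' →
    IsHorizontalLift α pr (fun y ↦ σ y (X y)) Z' →
    ∀ p, D X' p (fromBase R p)
      = Z' p + ν (pr p.2) (X (pr p.2)) (U (pr p.2)) • radial I M p
  hor_reeb : ∀ X : Π y : N, TangentSpace J y, ContMDiff J J.tangent ∞ (T% X) →
    ∀ X' Z' : Π p : ℝ × M, TangentSpace (𝓘(ℝ, ℝ).prod I) p, IsHorizontalLift α pr X X' →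
    IsHorizontalLift α pr (fun y ↦ σ y (X y)) Z' →
    ∀ p, D (fromBase R) p (X' p)
      = Z' p + ν (pr p.2) (X (pr p.2)) (U (pr p.2)) • radial I M p
  reeb_reeb : ∀ U' : Π p : ℝ × M, TangentSpace (𝓘(ℝ, ℝ).prod I) p, IsHorizontalLift α pr U U' →
    ∀ p, D (fromBase R) p (fromBase R p) = f (pr p.2) • radial I M p - U' p
  radial_hor : ∀ X : Π y : N, TangentSpace J y, ContMDiff J J.tangent ∞ (T% X) →
    ∀ X' : Π p : ℝ × M, TangentSpace (𝓘(ℝ, ℝ).prod I) p, IsHorizontalLift α pr X X' →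
    ∀ p, D X' p (radial I M p) = X' p
  radial_reeb : ∀ p, D (fromBase R) p (radial I M p) = fromBase R p
  apply_radial : ∀ (p : ℝ × M) (v : TangentSpace (𝓘(ℝ, ℝ).prod I) p), D (radial I M) p v = v

end Cone

end SymplecticCone

end

open Bundle VectorField
open scoped Manifold ContDiff

noncomputable section

set_option linter.unusedSectionVars false

open Filter
open scoped Topology

namespace SymplecticCone

/-! ### Smooth functions, brackets and criteria for smoothness -/

section Calculus

variable {E : Type*} [NormedAddCommGroup E] [NormedSpace ℝ E] [FiniteDimensional ℝ E]
  [CompleteSpace E] {H : Type*} [TopologicalSpace H] {I : ModelWithCorners ℝ E H}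
  {M : Type*} [TopologicalSpace M] [ChartedSpace H M] [IsManifold I ∞ M]

/-! At each point of the cone, `(dq, α, dπ)` identifies the tangent space with `ℝ × ℝ × TN`. It is
injective because a vector killed by `α` and `dπ` is killed by `dα = π^*ν` and lies in `ker α`, and
the dimensions agree. In this trivialization the connection is the componentwise derivative (the
pulled-back `∇` on the last factor) plus an algebraic product `ConeBase.mult`. The product is read
off from the required formulas: `Q` is a unit, `E·E = fQ - U`, `E·X = X·E = σX + ν(X,U)Q` and `X·Y =
-ν(X,Y)E - ν(X,σY)Q`.

A field of triples on `N` lifts to a vector field on the cone, and the covariant derivative of one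
lift along another is the lift of a field computed on `N` (`ConeFibration.cone_lift_lift`). Lifts
take every value at every point, so each tensorial statement may be checked on them.

The torsion vanishes for three reasons: `∇` is torsion-free (horizontal part), `σ` is skew for `ν`
(`Q`-part), and `dα = π^*ν`, which supplies the term `-2ν(X,Y)` of `α([X̄,Ȳ])` (`E`-part). On lifts
the two-form is `e^{2q}` times a function pulled back from `N`. It is parallel because `∇ν = 0` and
`σ` is skew. Closedness then needs no computation: a two-form preserved by a torsion-free connection
is closed.

For Ricci-flatness, `∇_Q t = t` on lifts and `∇Q = Id` give `R(Q,·) = 0` and `R(·,·)Q = 0`. Hence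
only the arguments `E` and `X̄` matter, and the trace has no `Q`-entry. The `E`-entry vanishes as
well (`curv_reeb_hor_hor`, `curv_reeb_hor_reeb`), which leaves a trace over `TN` (`ricci_cone_eq`):
`Ric(Ȳ,Z̄) = Ric^∇(Y,Z) - (2n+2)ν(Y,σZ)`, `Ric(Ȳ,E) = trace(X ↦ (∇_Xσ)Y) + (2n+1)ν(Y,U)`, `Ric(E,E)
= 2n f - trace(∇U) - trace(σ²)`. The equations for `σ`, `U` and `f` say exactly that these vanish.
The value `Ric(E,Ȳ)` follows from `ricci_symm`: for a torsion-free connection preserving a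
nondegenerate form, Bianchi expresses the antisymmetric part of Ricci as a trace of a skew
endomorphism. The same lemma on `N` makes `σ` skew. -/

theorem contMDiffAt_mvfderiv_apply {F : Type*} [NormedAddCommGroup F] [NormedSpace ℝ F]
    {g : M → F} {x : M} (hg : CMDiffAt ∞ g x) {V : Π x : M, TangentSpace I x}
    (hV : CMDiffAt ∞ (T% V) x) : CMDiffAt ∞ (fun y ↦ mvfderiv I g y (V y)) x := by
  have h := hg.mfderiv_const (m := ∞) (by simp)
  have h2 : ContMDiffAt I (𝓘(ℝ, F).prod 𝓘(ℝ, F)) ∞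
      (fun m ↦ TotalSpace.mk' F (E := (TangentSpace 𝓘(ℝ, F) : F → Type _)) (g m)
        (mfderiv I 𝓘(ℝ, F) g m (V m))) x :=
    ContMDiffAt.clm_apply_of_inCoordinates (b₁ := id) (b₂ := g) (v := V) h hV hg
  exact (contMDiff_snd_tangentBundle_modelSpace F 𝓘(ℝ, F)).contMDiffAt.comp x h2

theorem fderiv_comp_extChartAt_symm [I.Boundaryless] {F : Type*} [NormedAddCommGroup F]
    [NormedSpace ℝ F] (x : M) {u : E} (hu : u ∈ (extChartAt I x).target) {h : M → F}
    (hh : MDiffAt h ((extChartAt I x).symm u)) (V : Π x : M, TangentSpace I x) :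
    fderiv ℝ (h ∘ (extChartAt I x).symm) u
      (mpullbackWithin 𝓘(ℝ, E) I (extChartAt I x).symm V (Set.range I) u)
      = mvfderiv I h ((extChartAt I x).symm u) (V ((extChartAt I x).symm u)) := by
  have hinv := isInvertible_mfderivWithin_extChartAt_symm (I := I) hu
  have hd : MDifferentiableAt 𝓘(ℝ, E) I (extChartAt I x).symm u := by
    have := mdifferentiableWithinAt_extChartAt_symm (I := I) hu
    rwa [I.range_eq_univ, mdifferentiableWithinAt_univ] at this
  have h1 : mfderiv 𝓘(ℝ, E) 𝓘(ℝ, F) (h ∘ (extChartAt I x).symm) u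
      = (mfderiv I 𝓘(ℝ, F) h ((extChartAt I x).symm u)).comp
        (mfderiv 𝓘(ℝ, E) I (extChartAt I x).symm u) := mfderiv_comp u hh hd
  have h2 : mfderiv 𝓘(ℝ, E) I (extChartAt I x).symm u
      (mpullbackWithin 𝓘(ℝ, E) I (extChartAt I x).symm V (Set.range I) u)
      = V ((extChartAt I x).symm u) := by
    rw [mpullbackWithin_apply, I.range_eq_univ, mfderivWithin_univ]
    rw [I.range_eq_univ, mfderivWithin_univ] at hinv
    exact hinv.self_apply_inverse _
  rw [← mfderiv_eq_fderiv]
  exact (DFunLike.congr_fun h1 _).trans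
    (congrArg (mfderiv I 𝓘(ℝ, F) h ((extChartAt I x).symm u)) h2)

/-- In the chart at `x` this is the symmetry of the second derivative. It is the only way in which
brackets are computed below: in the tensoriality of curvature, in its skewness, and in the
`q`-component of the torsion. -/
theorem mvfderiv_mlieBracket [I.Boundaryless] {F : Type*} [NormedAddCommGroup F]
    [NormedSpace ℝ F] {g : M → F} {x : M} (hg : CMDiffAt ∞ g x) {V W : Π x : M, TangentSpace I x}
    (hV : CMDiffAt ∞ (T% V) x) (hW : CMDiffAt ∞ (T% W) x) :
    mvfderiv I g x (mlieBracket I V W x) = mvfderiv I (fun y ↦ mvfderiv I g y (W y)) x (V x)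
      - mvfderiv I (fun y ↦ mvfderiv I g y (V y)) x (W x) := by
  have key (h : M → F) (hh : MDiffAt h x) (V : Π x : M, TangentSpace I x) :
      fderiv ℝ (h ∘ (extChartAt I x).symm) (extChartAt I x x)
        (mpullbackWithin 𝓘(ℝ, E) I (extChartAt I x).symm V (Set.range I) (extChartAt I x x))
      = mvfderiv I h x (V x) := by
    have := fderiv_comp_extChartAt_symm (I := I) x (mem_extChartAt_target x) (h := h)
      (by rwa [extChartAt_to_inv]) V
    rwa [extChartAt_to_inv] at this
  have hd (V : Π x : M, TangentSpace I x) (hV : CMDiffAt ∞ (T% V) x) :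
      DifferentiableAt ℝ (mpullbackWithin 𝓘(ℝ, E) I (extChartAt I x).symm V (Set.range I))
        (extChartAt I x x) := by
    have h := MDifferentiableWithinAt.differentiableWithinAt_mpullbackWithin_vectorField (I := I)
      (s := Set.univ) (V := V) (x := x)
      (mdifferentiableWithinAt_univ.2 (hV.mdifferentiableAt (by simp)))
    rw [Set.preimage_univ, Set.univ_inter] at h
    rw [I.range_eq_univ] at h ⊢
    exact differentiableWithinAt_univ.1 h
  have hg' : ContDiffAt ℝ ∞ (g ∘ (extChartAt I x).symm) (extChartAt I x x) := by
    have h1 : ContMDiffAt 𝓘(ℝ, E) I ∞ (extChartAt I x).symm (extChartAt I x x) :=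
      (contMDiffOn_extChartAt_symm x).contMDiffAt
        ((isOpen_extChartAt_target x).mem_nhds (mem_extChartAt_target x))
    refine (ContMDiffAt.comp _ ?_ h1).contDiffAt
    rwa [extChartAt_to_inv]
  have hgd : ∀ᶠ y in 𝓝 x, MDiffAt g y := by
    exact ((contMDiffAt_iff_contMDiffAt_nhds (n := 1) (by simp)).1 (hg.of_le (by simp))).mono
      fun y hy ↦ hy.mdifferentiableAt (by simp)
  -- The outer derivative needs the chart expression of `V g` on a neighbourhood of the base point,
  -- not only at it.
  have hev (V : Π x : M, TangentSpace I x) :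
      (fun y ↦ mvfderiv I g y (V y)) ∘ (extChartAt I x).symm =ᶠ[𝓝 (extChartAt I x x)]
        fun u ↦ fderiv ℝ (g ∘ (extChartAt I x).symm) u
          (mpullbackWithin 𝓘(ℝ, E) I (extChartAt I x).symm V (Set.range I) u) := by
    have h1 : Tendsto (extChartAt I x).symm (𝓝 (extChartAt I x x)) (𝓝 x) := by
      have := continuousAt_extChartAt_symm (I := I) x
      rwa [ContinuousAt, extChartAt_to_inv] at this
    filter_upwards [h1.eventually hgd, extChartAt_target_mem_nhds (I := I) x] with u hu hu'
    exact (fderiv_comp_extChartAt_symm x hu' hu V).symm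
  have h2 (V W : Π x : M, TangentSpace I x) (hV : CMDiffAt ∞ (T% V) x)
      (hW : CMDiffAt ∞ (T% W) x) := key (fun y ↦ mvfderiv I g y (W y))
    ((contMDiffAt_mvfderiv_apply hg hW).mdifferentiableAt (by simp)) V
  have h3 := fderiv_apply_lieBracket (n := ∞) hg' (by
    simpa using (WithTop.coe_le_coe.2 (le_top : (2 : ℕ∞) ≤ ⊤)))
    (hd W hW) (hd V hV)
  have h4 : mvfderiv I g x (mlieBracket I V W x) =
      fderiv ℝ (g ∘ (extChartAt I x).symm) (extChartAt I x x)
        (lieBracket ℝ (mpullbackWithin 𝓘(ℝ, E) I (extChartAt I x).symm V (Set.range I))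
          (mpullbackWithin 𝓘(ℝ, E) I (extChartAt I x).symm W (Set.range I))
          (extChartAt I x x)) := by
    have h5 : mvfderiv I g x = (fderiv ℝ (g ∘ (extChartAt I x).symm) (extChartAt I x x)).comp
        (mfderiv I 𝓘(ℝ, E) (extChartAt I x) x) := by
      have h6 : MDifferentiableAt I 𝓘(ℝ, E) (extChartAt I x) x :=
        mdifferentiableAt_extChartAt (mem_chart_source H x)
      have h7 : MDifferentiableAt 𝓘(ℝ, E) 𝓘(ℝ, F) (g ∘ (extChartAt I x).symm)
          (extChartAt I x x) := (hg'.differentiableAt (by simp)).mdifferentiableAt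
      have h8 := mfderiv_comp x h7 h6
      rw [mfderiv_eq_fderiv] at h8
      refine Eq.trans ?_ h8
      have h9 : g =ᶠ[𝓝 x] (g ∘ (extChartAt I x).symm) ∘ extChartAt I x := by
        filter_upwards [extChartAt_source_mem_nhds (I := I) x] with y hy
        simp only [Function.comp_apply, (extChartAt I x).left_inv hy]
      exact h9.mfderiv_eq
    rw [h5, ← mlieBracketWithin_univ, mlieBracketWithin_apply, Set.preimage_univ, Set.univ_inter]
    let u : E := lieBracketWithin ℝ
      (mpullbackWithin 𝓘(ℝ, E) I (extChartAt I x).symm V (Set.range I))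
      (mpullbackWithin 𝓘(ℝ, E) I (extChartAt I x).symm W (Set.range I)) (Set.range I)
      (extChartAt I x x)
    have h10 : mfderiv I 𝓘(ℝ, E) (extChartAt I x) x
        ((mfderiv I 𝓘(ℝ, E) (extChartAt I x) x).inverse u) = u :=
      (isInvertible_mfderiv_extChartAt (I := I) (mem_extChartAt_source x)).self_apply_inverse u
    refine (congrArg (fderiv ℝ (g ∘ (extChartAt I x).symm) (extChartAt I x x)) h10).trans ?_
    simp only [u, I.range_eq_univ]
    exact congrArg (fderiv ℝ (g ∘ (extChartAt I x).symm) (extChartAt I x x))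
      (congrFun lieBracketWithin_univ _)
  rw [← h2 V W hV hW, ← h2 W V hW hV, (hev W).fderiv_eq, (hev V).fderiv_eq, h4, h3]

theorem _root_.ContMDiffAt.eventually_mdifferentiableAt {E' : Type*} [NormedAddCommGroup E']
    [NormedSpace ℝ E'] {H' : Type*} [TopologicalSpace H'] {I' : ModelWithCorners ℝ E' H'}
    {M' : Type*} [TopologicalSpace M'] [ChartedSpace H' M'] [IsManifold I' ∞ M'] {f : M → M'}
    {x : M} (hf : ContMDiffAt I I' ∞ f x) : ∀ᶠ y in 𝓝 x, MDifferentiableAt I I' f y := by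
  have : IsManifold I 1 M := .of_le (n := ∞) (by simp)
  have : IsManifold I' 1 M' := .of_le (n := ∞) (by simp)
  exact ((contMDiffAt_iff_contMDiffAt_nhds (n := 1) (by simp)).1 (hf.of_le (by simp))).mono
    fun y hy ↦ hy.mdifferentiableAt (by simp)

theorem eventually_mdifferentiableAt_section {V : Π x : M, TangentSpace I x} {x : M}
    (hV : CMDiffAt ∞ (T% V) x) : ∀ᶠ y in 𝓝 x, MDiffAt (T% V) y :=
  hV.eventually_mdifferentiableAt

theorem contMDiffAt_det {ι : Type*} [Fintype ι] [DecidableEq ι] {G : M → Matrix ι ι ℝ} {x : M}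
    (hG : ∀ i j, CMDiffAt ∞ (fun y ↦ G y i j) x) : CMDiffAt ∞ (fun y ↦ (G y).det) x := by
  simp only [Matrix.det_apply']
  exact contMDiffAt_finsetSum fun σ _ ↦ contMDiffAt_const.mul
    (contMDiffAt_finsetProd fun i _ ↦ hG _ _)

/-! ### Coordinate frames and Cramer's rule -/

section Frame

variable (I) in
/-- The coordinate frame near `x₀`. -/
def coordFrame (x₀ : M) : Fin (Module.finrank ℝ E) → Π x : M, TangentSpace I x :=
  (trivializationAt E (TangentSpace I) x₀).localFrame (Module.finBasis ℝ E)

variable (I) in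
/-- The coefficients of a vector in the coordinate frame near `x₀`. -/
def frameCoeff (x₀ : M) (i : Fin (Module.finrank ℝ E)) (x : M) : TangentSpace I x →ₗ[ℝ] ℝ :=
  (trivializationAt E (TangentSpace I) x₀).localFrameCoeff I (Module.finBasis ℝ E) i x

theorem contMDiffAt_coordFrame (x₀ : M) (i) : CMDiffAt ∞ (T% (coordFrame I x₀ i)) x₀ :=
  contMDiffAt_localFrame_of_mem _ _ _ _ (mem_baseSet_trivializationAt E (TangentSpace I) x₀)

theorem contMDiffAt_frameCoeff {x₀ : M} {V : Π x : M, TangentSpace I x}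
    (hV : CMDiffAt ∞ (T% V) x₀) (i) : CMDiffAt ∞ (fun y ↦ frameCoeff I x₀ i y (V y)) x₀ :=
  contMDiffAt_localFrameCoeff _
    (mem_baseSet_trivializationAt E (TangentSpace I) x₀) hV i

theorem eventually_eq_sum_frameCoeff (x₀ : M) (V : Π x : M, TangentSpace I x) :
    ∀ᶠ y in 𝓝 x₀, V y = ∑ i, frameCoeff I x₀ i y (V y) • coordFrame I x₀ i y :=
  (trivializationAt E (TangentSpace I) x₀).eventually_eq_localFrame_sum_coeff_smul _
    (mem_baseSet_trivializationAt E (TangentSpace I) x₀)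

theorem linearIndependent_coordFrame (x₀ : M) :
    LinearIndependent ℝ (fun i ↦ coordFrame I x₀ i x₀) :=
  ((trivializationAt E (TangentSpace I) x₀).isLocalFrameOn_localFrame_baseSet I 1
    (Module.finBasis ℝ E)).linearIndependent (mem_baseSet_trivializationAt E (TangentSpace I) x₀)

/-- The coefficients of `Z` in a frame solve a linear system whose matrix is the Gram matrix of the
frame under the covectors. Injectivity at the single point `x` makes this matrix invertible nearby,
and Cramer's rule gives smooth coefficients. This yields smoothness of lifts and of vector fields
defined by duality. -/
theorem contMDiffAt_of_covectors {ι : Type*} [Fintype ι]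
    {l : ι → Π x : M, TangentSpace I x →ₗ[ℝ] ℝ} {x : M}
    (hl : ∀ i, ∀ Y : Π x : M, TangentSpace I x, CMDiffAt ∞ (T% Y) x →
      CMDiffAt ∞ (fun y ↦ l i y (Y y)) x)
    (hinj : ∀ v : TangentSpace I x, (∀ i, l i x v = 0) → v = 0)
    {Z : Π x : M, TangentSpace I x} (hZ : ∀ i, CMDiffAt ∞ (fun y ↦ l i y (Z y)) x) :
    CMDiffAt ∞ (T% Z) x := by
  classical
  set s := coordFrame I x
  let G : M → Matrix _ _ ℝ := fun y ↦ Matrix.of fun j k ↦ ∑ i, l i y (s j y) * l i y (s k y)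
  let r : M → _ → ℝ := fun y j ↦ ∑ i, l i y (s j y) * l i y (Z y)
  have hls (i j) : CMDiffAt ∞ (fun y ↦ l i y (s j y)) x := hl i _ (contMDiffAt_coordFrame x j)
  have hG (j k) : CMDiffAt ∞ (fun y ↦ G y j k) x :=
    contMDiffAt_finsetSum fun i _ ↦ (hls i j).mul (hls i k)
  have hr (j) : CMDiffAt ∞ (fun y ↦ r y j) x :=
    contMDiffAt_finsetSum fun i _ ↦ (hls i j).mul (hZ i)
  have hdet : (G x).det ≠ 0 := by
    intro h0
    obtain ⟨v, hv0, hv⟩ := Matrix.exists_mulVec_eq_zero_iff.2 h0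
    apply hv0
    -- A kernel vector of the Gram matrix makes a sum of squares vanish, so every covector kills it.
    have h1 : ∑ i, (l i x (∑ j, v j • s j x)) ^ 2 = v ⬝ᵥ (G x).mulVec v := by
      simp only [map_sum, map_smul, smul_eq_mul, pow_two, dotProduct, Matrix.mulVec, G,
        Matrix.of_apply, Finset.mul_sum, Finset.sum_mul]
      rw [Finset.sum_comm]
      refine Finset.sum_congr rfl fun j _ ↦ ?_
      rw [Finset.sum_comm]
      refine Finset.sum_congr rfl fun k _ ↦ Finset.sum_congr rfl fun i _ ↦ by ring
    rw [hv, dotProduct_zero, Finset.sum_eq_zero_iff_of_nonneg fun i _ ↦ sq_nonneg _] at h1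
    have h2 := hinj _ fun i ↦ pow_eq_zero_iff two_ne_zero |>.1 (h1 i (Finset.mem_univ _))
    exact funext (Fintype.linearIndependent_iff.1 (linearIndependent_coordFrame x) v h2)
  have hsol : ∀ᶠ y in 𝓝 x, ∀ k, frameCoeff I x k y (Z y)
      = ((G y).det)⁻¹ * ∑ j, (G y).adjugate k j * r y j := by
    filter_upwards [(contMDiffAt_det hG).continuousAt.eventually_ne hdet,
      eventually_eq_sum_frameCoeff x Z] with y hy hZy k
    have h1 : r y = (G y).mulVec fun k ↦ frameCoeff I x k y (Z y) := by
      ext j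
      simp only [r, Matrix.mulVec, dotProduct, G, Matrix.of_apply]
      conv_lhs => rw [hZy]
      simp only [map_sum, map_smul, smul_eq_mul, Finset.mul_sum, Finset.sum_mul]
      rw [Finset.sum_comm]
      refine Finset.sum_congr rfl fun k _ ↦ Finset.sum_congr rfl fun i _ ↦ by ring
    have h2 : (G y).adjugate.mulVec (r y) = (G y).det • fun k ↦ frameCoeff I x k y (Z y) := by
      rw [h1, Matrix.mulVec_mulVec, Matrix.adjugate_mul, Matrix.smul_mulVec, Matrix.one_mulVec]
    have h3 := congrFun h2 k
    simp only [Matrix.mulVec, dotProduct, Pi.smul_apply, smul_eq_mul] at h3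
    rw [h3, inv_mul_cancel_left₀ hy]
  have hadj (k j) : CMDiffAt ∞ (fun y ↦ (G y).adjugate k j) x := by
    simp only [Matrix.adjugate_apply]
    refine contMDiffAt_det fun a b ↦ ?_
    simp only [Matrix.updateRow_apply]
    split_ifs
    · exact contMDiffAt_const
    · exact hG _ _
  have hcoef (k) : CMDiffAt ∞ (fun y ↦ frameCoeff I x k y (Z y)) x := by
    refine ContMDiffAt.congr_of_eventuallyEq (f := fun y ↦
      ((G y).det)⁻¹ * ∑ j, (G y).adjugate k j * r y j) ?_ (hsol.mono fun y hy ↦ hy k)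
    exact ((contMDiffAt_det hG).inv₀ hdet).mul
      (contMDiffAt_finsetSum fun j _ ↦ (hadj k j).mul (hr j))
  exact (contMDiffAt_iff_localFrameCoeff (Module.finBasis ℝ E)
    (mem_baseSet_trivializationAt E (TangentSpace I) x)).2 hcoef

end Frame

/-- In trivializations `A` is the sum of the rank-one maps sending a basis vector to the value of
`A` on the matching local frame field, so smoothness on the frame suffices. -/
theorem contMDiffAt_hom_of_apply {F₁ F₂ : Type*} [NormedAddCommGroup F₁] [NormedSpace ℝ F₁]
    [FiniteDimensional ℝ F₁] [NormedAddCommGroup F₂] [NormedSpace ℝ F₂] {V₁ V₂ : M → Type*}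
    [TopologicalSpace (TotalSpace F₁ V₁)] [∀ x, AddCommGroup (V₁ x)] [∀ x, Module ℝ (V₁ x)]
    [∀ x, TopologicalSpace (V₁ x)] [FiberBundle F₁ V₁] [VectorBundle ℝ F₁ V₁]
    [ContMDiffVectorBundle ∞ F₁ V₁ I]
    [TopologicalSpace (TotalSpace F₂ V₂)] [∀ x, AddCommGroup (V₂ x)] [∀ x, Module ℝ (V₂ x)]
    [∀ x, TopologicalSpace (V₂ x)] [∀ x, IsTopologicalAddGroup (V₂ x)]
    [∀ x, ContinuousSMul ℝ (V₂ x)] [FiberBundle F₂ V₂] [VectorBundle ℝ F₂ V₂]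
    {A : Π x : M, V₁ x →L[ℝ] V₂ x} {x : M}
    (h : ∀ Y : Π x : M, V₁ x, CMDiffAt ∞ (T% Y) x → CMDiffAt ∞ (T% (fun y ↦ A y (Y y))) x) :
    ContMDiffAt I (I.prod 𝓘(ℝ, F₁ →L[ℝ] F₂)) ∞
      (fun y ↦ TotalSpace.mk' (F₁ →L[ℝ] F₂) (E := fun x ↦ V₁ x →L[ℝ] V₂ x) y (A y)) x := by
  rw [contMDiffAt_hom_bundle]
  refine ⟨contMDiffAt_id, ?_⟩
  set e₁ := trivializationAt F₁ V₁ x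
  set e₂ := trivializationAt F₂ V₂ x
  let b := Module.finBasis ℝ F₁
  have hx : x ∈ e₁.baseSet := mem_baseSet_trivializationAt F₁ V₁ x
  have hx2 : x ∈ e₂.baseSet := mem_baseSet_trivializationAt F₂ V₂ x
  let B : M → F₁ →L[ℝ] F₂ := fun y ↦
    ∑ i, (LinearMap.toContinuousLinearMap (b.coord i)).smulRight
      (e₂ ⟨y, A y (e₁.localFrame b i y)⟩).2
  have hB : CMDiffAt ∞ B x := by
    refine contMDiffAt_finsetSum fun i _ ↦ ?_
    have h1 := h _ (contMDiffAt_localFrame_of_mem ∞ e₁ b i hx)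
    rw [contMDiffAt_section] at h1
    exact (ContinuousLinearMap.smulRightL ℝ F₁ F₂
      (LinearMap.toContinuousLinearMap (b.coord i))).contMDiff.contMDiffAt.comp x h1
  refine hB.congr_of_eventuallyEq ?_
  filter_upwards [e₁.open_baseSet.mem_nhds hx, e₂.open_baseSet.mem_nhds hx2] with y hy hy2
  refine ContinuousLinearMap.ext fun v ↦ ?_
  have h1 : e₁.symmL ℝ y v = ∑ i, b.coord i v • e₁.localFrame b i y := by
    conv_lhs => rw [← b.sum_repr v]
    rw [map_sum]
    refine Finset.sum_congr rfl fun i _ ↦ ?_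
    rw [map_smul, Module.Basis.coord_apply]
    simp [Trivialization.basisAt, hy]
  have h2 (z : V₂ y) : e₂.continuousLinearMapAt ℝ y z = (e₂ ⟨y, z⟩).2 := by
    simp [hy2]
  simp only [ContinuousLinearMap.inCoordinates, ContinuousLinearMap.comp_apply]
  rw [h1]
  simp only [map_sum, map_smul, B, sum_apply,
    ContinuousLinearMap.smulRight_apply, LinearMap.coe_toContinuousLinearMap']
  exact Finset.sum_congr rfl fun i _ ↦ by rw [← h2]

end Calculus

/-! ### Local computation of connections, and tensoriality of curvature -/

section Curvature

variable {E : Type*} [NormedAddCommGroup E] [NormedSpace ℝ E] [FiniteDimensional ℝ E]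
  [CompleteSpace E] {H : Type*} [TopologicalSpace H] {I : ModelWithCorners ℝ E H}
  {M : Type*} [TopologicalSpace M] [ChartedSpace H M] [IsManifold I ∞ M]

instance finiteDimensional_tangentSpace (x : M) : FiniteDimensional ℝ (TangentSpace I x) :=
  inferInstanceAs (FiniteDimensional ℝ E)

/-- A bump function globalizes the frame. Smoothness of a connection will be applied to globally
smooth fields only. -/
theorem exists_contMDiff_eventuallyEq_coordFrame [T2Space M] (x₀ : M)
    (i : Fin (Module.finrank ℝ E)) : ∃ S : Π x : M, TangentSpace I x,
      CMDiff ∞ (T% S) ∧ S =ᶠ[𝓝 x₀] coordFrame I x₀ i := by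
  let χ : SmoothBumpFunction I x₀ := Classical.arbitrary _
  refine ⟨(χ : M → ℝ) • coordFrame I x₀ i, ?_, ?_⟩
  · refine ContMDiffOn.smul_section_of_tsupport (u := (chartAt H x₀).source)
      χ.contMDiff.contMDiffOn (chartAt H x₀).open_source χ.tsupport_subset_chartAt_source ?_
    exact (trivializationAt E (TangentSpace I) x₀).contMDiffOn_localFrame_baseSet ∞ _ i
  · filter_upwards [χ.eventuallyEq_one] with y hy
    have hy' : χ y = 1 := hy
    exact (congrArg (· • coordFrame I x₀ i y) hy').trans (one_smul ℝ _)

variable (D : AffineConnection I M)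

theorem cov_congr {V W : Π x : M, TangentSpace I x} {x : M} (hV : MDiffAt (T% V) x)
    (h : ∀ᶠ y in 𝓝 x, V y = W y) : D V x = D W x :=
  D.isCovariantDerivativeOnUniv.congr_of_eventuallyEq hV
    (hV.congr_of_eventuallyEq (h.mono fun y hy ↦ by simp [hy])) univ_mem h

theorem cov_add {V W : Π x : M, TangentSpace I x} {x : M} (hV : MDiffAt (T% V) x)
    (hW : MDiffAt (T% W) x) : D (V + W) x = D V x + D W x :=
  D.isCovariantDerivativeOnUniv.add hV hW

theorem cov_smul {V : Π x : M, TangentSpace I x} {f : M → ℝ} {x : M} (hf : MDiffAt f x)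
    (hV : MDiffAt (T% V) x) (u : TangentSpace I x) :
    D (f • V) x u = f x • D V x u + mvfderiv I f x u • V x := by
  rw [D.isCovariantDerivativeOnUniv.leibniz hV hf]
  simp

theorem cov_sum {ι : Type*} (s : Finset ι) {V : ι → Π x : M, TangentSpace I x} {x : M}
    (hV : ∀ i, MDiffAt (T% (V i)) x) : D (fun y ↦ ∑ i ∈ s, V i y) x = ∑ i ∈ s, D (V i) x := by
  classical
  induction s using Finset.induction_on with
  | empty =>
    simp only [Finset.sum_empty]
    exact D.isCovariantDerivativeOnUniv.zero
  | insert i s hi ih =>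
    simp only [Finset.sum_insert hi, ← ih]
    exact cov_add D (hV i) (MDifferentiableAt.sum_section fun i _ ↦ hV i)

/-- Passes from globally smooth fields to fields smooth at a point: expand `W` in globalized frame
fields near `x` and use the Leibniz rule. -/
theorem contMDiffAt_cov_apply [T2Space M] (hD : D.ContMDiffCovariantDerivative ∞)
    {V W : Π x : M, TangentSpace I x} {x : M} (hV : CMDiffAt ∞ (T% V) x)
    (hW : CMDiffAt ∞ (T% W) x) : CMDiffAt ∞ (T% (fun y ↦ D W y (V y))) x := by
  choose S hS hSx using exists_contMDiff_eventuallyEq_coordFrame (I := I) x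
  let c : Fin (Module.finrank ℝ E) → M → ℝ := fun i y ↦ frameCoeff I x i y (W y)
  have hc (i) : CMDiffAt ∞ (c i) x := contMDiffAt_frameCoeff hW i
  let T : Fin (Module.finrank ℝ E) → Π y : M, TangentSpace I y := fun i ↦ c i • S i
  have hWc : ∀ᶠ y in 𝓝 x, W y = ∑ i, T i y := by
    filter_upwards [eventually_eq_sum_frameCoeff x W, eventually_all.2 hSx] with y hy hy2
    refine hy.trans (Finset.sum_congr rfl fun i _ ↦ ?_)
    exact congrArg (c i y • ·) (hy2 i).symm
  have hDS (i) : CMDiffAt ∞ (T% (fun y ↦ D (S i) y (V y))) x := by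
    have h1 := hD.contMDiff.contMDiff (σ := S i) (by simpa using (hS i).contMDiffOn)
    exact (h1.contMDiffAt univ_mem).clm_bundle_apply hV
  have hsum : CMDiffAt ∞ (T% (fun y ↦ ∑ i, (c i • (fun y ↦ D (S i) y (V y))
      + (fun y ↦ mvfderiv I (c i) y (V y)) • S i) y)) x :=
    ContMDiffAt.sum_section fun i _ ↦ ((hc i).smul_section (hDS i)).add_section
      ((contMDiffAt_mvfderiv_apply (hc i) hV).smul_section (hS i x))
  refine hsum.congr_of_eventuallyEq ?_
  filter_upwards [hWc.eventually_nhds, eventually_mdifferentiableAt_section hW,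
    eventually_all.2 fun i ↦ (hc i).eventually_mdifferentiableAt] with y h1 h2 h3
  have hSd (i) : MDiffAt (T% (S i)) y := (hS i y).mdifferentiableAt (by simp)
  have h4 : D W y (V y) = ∑ i, D (T i) y (V y) := by
    rw [cov_congr D h2 h1, cov_sum D _ fun i ↦ (h3 i).smul_section (hSd i), sum_apply]
  refine congrArg (TotalSpace.mk' E y) (h4.trans (Finset.sum_congr rfl fun i _ ↦ ?_))
  exact cov_smul D (h3 i) (hSd i) (V y)

/-- An operation on vector fields which respects addition and multiplication by functions, for
vector fields and functions that are smooth at `x`. -/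
structure SmoothTensorialAt {A : Type*} [AddCommGroup A] [Module ℝ A]
    (Φ : (Π x : M, TangentSpace I x) → A) (x : M) : Prop where
  smul : ∀ {f : M → ℝ} {V : Π x : M, TangentSpace I x}, CMDiffAt ∞ f x → CMDiffAt ∞ (T% V) x →
    Φ (f • V) = f x • Φ V
  add : ∀ {V W : Π x : M, TangentSpace I x}, CMDiffAt ∞ (T% V) x → CMDiffAt ∞ (T% W) x →
    Φ (V + W) = Φ V + Φ W

namespace SmoothTensorialAt

variable {A : Type*} [AddCommGroup A] [Module ℝ A] {Φ : (Π x : M, TangentSpace I x) → A} {x : M}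

/-- Multiply both fields by the indicator function of `{V = W}`. It equals 1 near `x`, hence is
smooth there, and it makes the two fields equal everywhere. -/
theorem congr_of_eventuallyEq (hΦ : SmoothTensorialAt Φ x) {V W : Π x : M, TangentSpace I x}
    (hV : CMDiffAt ∞ (T% V) x) (h : ∀ᶠ y in 𝓝 x, V y = W y) : Φ V = Φ W := by
  classical
  have hW : CMDiffAt ∞ (T% W) x :=
    hV.congr_of_eventuallyEq (h.mono fun y hy ↦ by simp [hy])
  let ψ : M → ℝ := fun y ↦ if V y = W y then 1 else 0
  have hψx : ψ x = 1 := by simp [ψ, h.self_of_nhds]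
  have hψ : CMDiffAt ∞ ψ x :=
    (contMDiffAt_const (c := (1 : ℝ))).congr_of_eventuallyEq (h.mono fun y hy ↦ by simp [ψ, hy])
  have hVW : ψ • V = ψ • W := by
    ext y : 1
    by_cases hy : V y = W y <;> simp [ψ, hy]
  calc Φ V = Φ (ψ • V) := by rw [hΦ.smul hψ hV, hψx, one_smul]
    _ = Φ W := by rw [hVW, hΦ.smul hψ hW, hψx, one_smul]

theorem sum (hΦ : SmoothTensorialAt Φ x) {ι : Type*} (s : Finset ι)
    {V : ι → Π x : M, TangentSpace I x} (hV : ∀ i, CMDiffAt ∞ (T% (V i)) x) :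
    Φ (fun y ↦ ∑ i ∈ s, V i y) = ∑ i ∈ s, Φ (V i) := by
  classical
  induction s using Finset.induction_on with
  | empty =>
    have h0 : CMDiffAt ∞ (T% (0 : Π x : M, TangentSpace I x)) x :=
      contMDiff_zeroSection ℝ (TangentSpace I : M → Type _) x
    have := hΦ.smul (f := fun _ ↦ 0) contMDiffAt_const h0
    simpa using! this
  | insert i s hi ih =>
    simp only [Finset.sum_insert hi, ← ih]
    exact hΦ.add (hV i) (ContMDiffAt.sum_section fun i _ ↦ hV i)

/-- The frame expansion near `x` shows that the value of `Φ` involves only the coefficients at `x`.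
-/
theorem pointwise (hΦ : SmoothTensorialAt Φ x) {V W : Π x : M, TangentSpace I x}
    (hV : CMDiffAt ∞ (T% V) x) (hW : CMDiffAt ∞ (T% W) x) (h : V x = W x) : Φ V = Φ W := by
  have key {V : Π x : M, TangentSpace I x} (hV : CMDiffAt ∞ (T% V) x) :
      Φ V = ∑ i, frameCoeff I x i x (V x) • Φ (coordFrame I x i) := by
    have hi (i) : CMDiffAt ∞ (T% ((fun y ↦ frameCoeff I x i y (V y)) • coordFrame I x i)) x :=
      (contMDiffAt_frameCoeff hV i).smul_section (contMDiffAt_coordFrame x i)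
    rw [hΦ.congr_of_eventuallyEq hV (eventually_eq_sum_frameCoeff x V)]
    refine (hΦ.sum Finset.univ hi).trans ?_
    exact Finset.sum_congr rfl fun i _ ↦
      hΦ.smul (contMDiffAt_frameCoeff hV i) (contMDiffAt_coordFrame x i)
  rw [key hV, key hW, h]

end SmoothTensorialAt

/-- The expression `∇_U ∇_V W - ∇_V ∇_U W - ∇_[U, V] W`. -/
def curvatureField (U V W : Π x : M, TangentSpace I x) (x : M) : TangentSpace I x :=
  D (fun y ↦ D W y (V y)) x (U x) - D (fun y ↦ D W y (U y)) x (V x) - D W x (mlieBracket I U V x)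

theorem curvature_eq_curvatureField (x : M) (u v w : TangentSpace I x) :
    curvature D x u v w = curvatureField D (FiberBundle.extend E u) (FiberBundle.extend E v)
      (FiberBundle.extend E w) x := by
  simp [curvature, curvatureField]

theorem curvatureField_swap (U V W : Π x : M, TangentSpace I x) (x : M) :
    curvatureField D U V W x = -curvatureField D V U W x := by
  simp only [curvatureField]
  rw [mlieBracket_swap_apply (V := U), map_neg]
  module

variable {D} in
-- The derivative of `f` produced by `∇_V(f ∇_U W)` cancels against the one in `[fU, V] = f[U, V] -
-- (Vf)U`.
theorem smoothTensorialAt_curvatureField_left [T2Space M] (hD : D.ContMDiffCovariantDerivative ∞)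
    {V W : Π x : M, TangentSpace I x} {x : M} (hW : CMDiffAt ∞ (T% W) x) :
    SmoothTensorialAt (curvatureField D · V W x) x where
  smul {f U} hf hU := by
    have h1 : (fun y ↦ D W y ((f • U) y)) = f • fun y ↦ D W y (U y) := by
      ext y : 1
      simp
    have hfd := hf.mdifferentiableAt (by simp : (∞ : ℕ∞ω) ≠ 0)
    simp only [curvatureField, h1]
    rw [cov_smul D hfd ((contMDiffAt_cov_apply D hD hU hW).mdifferentiableAt (by simp)),
      mlieBracket_smul_left hfd (hU.mdifferentiableAt (by simp))]
    simp only [Pi.smul_apply', map_smul, map_add, neg_smul, map_neg]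
    module
  add {U U'} hU hU' := by
    have h1 : (fun y ↦ D W y ((U + U') y)) = (fun y ↦ D W y (U y)) + fun y ↦ D W y (U' y) := by
      ext y : 1
      simp
    simp only [curvatureField, h1]
    rw [cov_add D ((contMDiffAt_cov_apply D hD hU hW).mdifferentiableAt (by simp))
        ((contMDiffAt_cov_apply D hD hU' hW).mdifferentiableAt (by simp)),
      mlieBracket_add_left (hU.mdifferentiableAt (by simp)) (hU'.mdifferentiableAt (by simp))]
    simp only [Pi.add_apply, map_add, add_apply]
    module

variable {D} in
theorem smoothTensorialAt_curvatureField_middle [T2Space M] (hD : D.ContMDiffCovariantDerivative ∞)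
    {U W : Π x : M, TangentSpace I x} {x : M} (hW : CMDiffAt ∞ (T% W) x) :
    SmoothTensorialAt (curvatureField D U · W x) x where
  smul {f V} hf hV := by
    rw [curvatureField_swap, (smoothTensorialAt_curvatureField_left hD hW).smul hf hV,
      curvatureField_swap D U V, smul_neg]
  add {V V'} hV hV' := by
    rw [curvatureField_swap, (smoothTensorialAt_curvatureField_left hD hW).add hV hV',
      curvatureField_swap D U V, curvatureField_swap D U V', neg_add]

variable {D} in
-- The second derivatives of `f` contribute `UVf - VUf - [U, V]f`, which is zero by
-- `mvfderiv_mlieBracket`.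
theorem smoothTensorialAt_curvatureField_right [T2Space M] [I.Boundaryless]
    (hD : D.ContMDiffCovariantDerivative ∞) {U V : Π x : M, TangentSpace I x} {x : M}
    (hU : CMDiffAt ∞ (T% U) x) (hV : CMDiffAt ∞ (T% V) x) :
    SmoothTensorialAt (curvatureField D U V · x) x where
  smul {f W} hf hW := by
    have hfd := hf.mdifferentiableAt (by simp : (∞ : ℕ∞ω) ≠ 0)
    have hWd := hW.mdifferentiableAt (by simp : (∞ : ℕ∞ω) ≠ 0)
    -- The two terms with one derivative on `f` and one on `W` are together symmetric in `U` and
    -- `V`, so they drop out of the commutator.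
    have key {U V : Π x : M, TangentSpace I x} (hU : CMDiffAt ∞ (T% U) x)
        (hV : CMDiffAt ∞ (T% V) x) : D (fun y ↦ D (f • W) y (V y)) x (U x)
          = f x • D (fun y ↦ D W y (V y)) x (U x) + mvfderiv I f x (U x) • D W x (V x)
            + (mvfderiv I f x (V x) • D W x (U x)
              + mvfderiv I (fun y ↦ mvfderiv I f y (V y)) x (U x) • W x) := by
      have h1 : ∀ᶠ y in 𝓝 x, D (f • W) y (V y) = ((f • fun y ↦ D W y (V y))
          + (fun y ↦ mvfderiv I f y (V y)) • W) y := by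
        filter_upwards [hf.eventually_mdifferentiableAt,
          eventually_mdifferentiableAt_section hW] with y hy hy2
        rw [cov_smul D hy hy2]
        rfl
      have h2 := (contMDiffAt_cov_apply D hD hV hW).mdifferentiableAt (by simp : (∞ : ℕ∞ω) ≠ 0)
      have h3 := (contMDiffAt_mvfderiv_apply hf hV).mdifferentiableAt (by simp : (∞ : ℕ∞ω) ≠ 0)
      have h4 := (contMDiffAt_cov_apply D hD hV (hf.smul_section hW)).mdifferentiableAt
        (by simp : (∞ : ℕ∞ω) ≠ 0)
      rw [cov_congr D h4 h1, cov_add D (hfd.smul_section h2) (h3.smul_section hWd),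
        add_apply, cov_smul D hfd h2, cov_smul D h3 hWd]
    simp only [curvatureField]
    rw [key hU hV, key hV hU, cov_smul D hfd hWd, mvfderiv_mlieBracket hf hU hV]
    module
  add {W W'} hW hW' := by
    have hWd := hW.mdifferentiableAt (by simp : (∞ : ℕ∞ω) ≠ 0)
    have hWd' := hW'.mdifferentiableAt (by simp : (∞ : ℕ∞ω) ≠ 0)
    have key {V : Π x : M, TangentSpace I x} (hV : CMDiffAt ∞ (T% V) x) :
        D (fun y ↦ D (W + W') y (V y)) x
          = D (fun y ↦ D W y (V y)) x + D (fun y ↦ D W' y (V y)) x := by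
      have h1 : ∀ᶠ y in 𝓝 x, D (W + W') y (V y) = ((fun y ↦ D W y (V y))
          + (fun y ↦ D W' y (V y))) y := by
        filter_upwards [eventually_mdifferentiableAt_section hW,
          eventually_mdifferentiableAt_section hW'] with y hy hy2
        rw [cov_add D hy hy2]
        rfl
      have h4 := (contMDiffAt_cov_apply D hD hV (hW.add_section hW')).mdifferentiableAt
        (by simp : (∞ : ℕ∞ω) ≠ 0)
      rw [cov_congr D h4 h1, cov_add D
        ((contMDiffAt_cov_apply D hD hV hW).mdifferentiableAt (by simp))
        ((contMDiffAt_cov_apply D hD hV hW').mdifferentiableAt (by simp))]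
    simp only [curvatureField]
    rw [key hU, key hV, cov_add D hWd hWd']
    simp only [add_apply]
    module

end Curvature

/-- The form identifies `V` with its dual and carries `A` to minus its transpose, so the trace of
`A` is its own negative. -/
theorem trace_eq_zero_of_skew {V : Type*} [AddCommGroup V] [Module ℝ V] [FiniteDimensional ℝ V]
    (B : V →ₗ[ℝ] V →ₗ[ℝ] ℝ) (hB : ∀ u, (∀ v, B u v = 0) → u = 0) (A : V →ₗ[ℝ] V)
    (hA : ∀ u v, B (A u) v + B u (A v) = 0) : LinearMap.trace ℝ V A = 0 := by
  have hinj : Function.Injective B := by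
    rw [← LinearMap.ker_eq_bot, LinearMap.ker_eq_bot']
    exact fun u hu ↦ hB u fun v ↦ by rw [hu]; rfl
  let e : V ≃ₗ[ℝ] Module.Dual ℝ V :=
    LinearEquiv.ofInjectiveOfFinrankEq B hinj Subspace.dual_finrank_eq.symm
  have h1 : e.conj A = (-1 : ℝ) • Module.Dual.transpose (R := ℝ) A := by
    refine LinearMap.ext fun φ ↦ ?_
    obtain ⟨u, rfl⟩ := e.surjective φ
    refine LinearMap.ext fun v ↦ ?_
    have : e.conj A (e u) = B (A u) := by
      simp [LinearEquiv.conj_apply, e]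
    rw [this]
    refine (eq_neg_of_add_eq_zero_left (hA u v)).trans ?_
    rw [LinearMap.smul_apply, LinearMap.smul_apply, neg_one_smul]
    rfl
  have h2 := LinearMap.trace_conj' A e
  rw [h1, map_smul, LinearMap.trace_transpose', smul_eq_mul] at h2
  linarith

/-! ### Symmetries of the curvature and Ricci tensors -/

section Curvature

variable {E : Type*} [NormedAddCommGroup E] [NormedSpace ℝ E] [FiniteDimensional ℝ E]
  [CompleteSpace E] {H : Type*} [TopologicalSpace H] {I : ModelWithCorners ℝ E H}
  {M : Type*} [TopologicalSpace M] [ChartedSpace H M] [IsManifold I ∞ M]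

theorem contMDiffAt_extend {x : M} (u : TangentSpace I x) :
    CMDiffAt ∞ (T% (FiberBundle.extend E u)) x :=
  FiberBundle.contMDiffAt_extend I E u

theorem extend_self {x : M} (u : TangentSpace I x) : FiberBundle.extend E u x = u :=
  FiberBundle.extend_apply_self E u

theorem mvfderiv_congr {F : Type*} [NormedAddCommGroup F] [NormedSpace ℝ F] {g g' : M → F} {x : M}
    (h : ∀ᶠ y in 𝓝 x, g y = g' y) : mvfderiv I g x = mvfderiv I g' x := by
  have h' : g =ᶠ[𝓝 x] g' := h
  have h1 := h'.mfderiv_eq (I := I) (I' := 𝓘(ℝ, F))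
  exact ContinuousLinearMap.ext fun u ↦ DFunLike.congr_fun h1 u

theorem two_le_infty : (2 : ℕ∞ω) ≤ ∞ := by
  simpa using (WithTop.coe_le_coe.2 (le_top : (2 : ℕ∞) ≤ ⊤))

theorem eventually_trace_eq_sum (x₀ : M) (A : Π x : M, TangentSpace I x →ₗ[ℝ] TangentSpace I x) :
    ∀ᶠ y in 𝓝 x₀, LinearMap.trace ℝ (TangentSpace I y) (A y)
      = ∑ i, frameCoeff I x₀ i y (A y (coordFrame I x₀ i y)) := by
  set e := trivializationAt E (TangentSpace I) x₀
  filter_upwards [e.open_baseSet.mem_nhds (mem_baseSet_trivializationAt E (TangentSpace I) x₀)]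
    with y hy
  rw [LinearMap.trace_eq_matrix_trace ℝ (e.basisAt (Module.finBasis ℝ E) hy)]
  refine Finset.sum_congr rfl fun i _ ↦ ?_
  rw [Matrix.diag_apply, LinearMap.toMatrix_apply]
  have h1 : coordFrame I x₀ i y = e.basisAt (Module.finBasis ℝ E) hy i :=
    e.localFrame_apply_of_mem_baseSet _ hy
  have h2 (v : TangentSpace I y) :
      frameCoeff I x₀ i y v = (e.basisAt (Module.finBasis ℝ E) hy).repr v i := by
    have := e.localFrameCoeff_apply_of_mem_baseSet (I := I) (Module.finBasis ℝ E) hy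
      (FiberBundle.extend E v) i
    rwa [FiberBundle.extend_apply_self] at this
  rw [h1, h2]

theorem contMDiffAt_trace {A : Π x : M, TangentSpace I x →ₗ[ℝ] TangentSpace I x} {x : M}
    (hA : ∀ V : Π x : M, TangentSpace I x, CMDiffAt ∞ (T% V) x →
      CMDiffAt ∞ (T% (fun y ↦ A y (V y))) x) :
    CMDiffAt ∞ (fun y ↦ LinearMap.trace ℝ (TangentSpace I y) (A y)) x :=
  (contMDiffAt_finsetSum fun i _ ↦ contMDiffAt_frameCoeff (hA _ (contMDiffAt_coordFrame x i)) i
    ).congr_of_eventuallyEq (eventually_trace_eq_sum x A)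

theorem contMDiffAt_apply_of_frame {A : Π x : M, TangentSpace I x →ₗ[ℝ] TangentSpace I x} {x : M}
    (hA : ∀ i, CMDiffAt ∞ (T% (fun y ↦ A y (coordFrame I x i y))) x)
    {V : Π x : M, TangentSpace I x} (hV : CMDiffAt ∞ (T% V) x) :
    CMDiffAt ∞ (T% (fun y ↦ A y (V y))) x := by
  have h : CMDiffAt ∞ (T% (fun y ↦ ∑ i, ((fun y ↦ frameCoeff I x i y (V y)) •
      fun y ↦ A y (coordFrame I x i y)) y)) x :=
    ContMDiffAt.sum_section fun i _ ↦ (contMDiffAt_frameCoeff hV i).smul_section (hA i)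
  refine h.congr_of_eventuallyEq ?_
  filter_upwards [eventually_eq_sum_frameCoeff x V] with y hy
  refine congrArg (TotalSpace.mk' E y) ((congrArg (A y) hy).trans ?_)
  rw [map_sum]
  exact Finset.sum_congr rfl fun i _ ↦ map_smul _ _ _

theorem eventually_contMDiffAt_coordFrame (x₀ : M) (i) :
    ∀ᶠ y in 𝓝 x₀, CMDiffAt ∞ (T% (coordFrame I x₀ i)) y := by
  set e := trivializationAt E (TangentSpace I) x₀
  filter_upwards [e.open_baseSet.mem_nhds (mem_baseSet_trivializationAt E (TangentSpace I) x₀)]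
    with y hy
  exact contMDiffAt_localFrame_of_mem _ _ _ _ hy

theorem contMDiffAt_mlieBracket {V W : Π x : M, TangentSpace I x} {x : M}
    (hV : CMDiffAt ∞ (T% V) x) (hW : CMDiffAt ∞ (T% W) x) :
    CMDiffAt ∞ (T% (mlieBracket I V W)) x :=
  have : IsManifold I (minSmoothness ℝ 2) M := .of_le (n := ∞) (by simp [two_le_infty])
  have : IsManifold I (((⊤ : ℕ∞) : ℕ∞ω) + 1) M := inferInstanceAs (IsManifold I ∞ M)
  ContMDiffAt.mlieBracket_vectorField (m := ⊤) (n := ⊤) hV hW (by simp)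

variable {D : AffineConnection I M}

section Linear

variable [T2Space M] [I.Boundaryless] (hD : D.ContMDiffCovariantDerivative ∞)
include hD

/-- The chosen extensions in `curvature` are replaced one slot at a time by tensoriality, so that
any convenient smooth fields may be used. -/
theorem curvature_apply {U V W : Π x : M, TangentSpace I x} {x : M} (hU : CMDiffAt ∞ (T% U) x)
    (hV : CMDiffAt ∞ (T% V) x) (hW : CMDiffAt ∞ (T% W) x) :
    curvature D x (U x) (V x) (W x) = curvatureField D U V W x := by
  rw [curvature_eq_curvatureField,
    (smoothTensorialAt_curvatureField_left hD (contMDiffAt_extend _)).pointwise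
      (contMDiffAt_extend _) hU (extend_self _),
    (smoothTensorialAt_curvatureField_middle hD (contMDiffAt_extend _)).pointwise
      (contMDiffAt_extend _) hV (extend_self _),
    (smoothTensorialAt_curvatureField_right hD hU hV).pointwise
      (contMDiffAt_extend _) hW (extend_self _)]

theorem curvature_add_left (x : M) (u u' v w : TangentSpace I x) :
    curvature D x (u + u') v w = curvature D x u v w + curvature D x u' v w := by
  have hu := contMDiffAt_extend u
  have hu' := contMDiffAt_extend u'
  have hv := contMDiffAt_extend v
  have hw := contMDiffAt_extend w
  have h := (smoothTensorialAt_curvatureField_left hD (V := FiberBundle.extend E v) hw).add hu hu'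
  rw [← curvature_apply hD hu hv hw, ← curvature_apply hD hu' hv hw,
    ← curvature_apply hD (hu.add_section hu') hv hw] at h
  simpa only [Pi.add_apply, extend_self] using! h

theorem curvature_smul_left (x : M) (c : ℝ) (u v w : TangentSpace I x) :
    curvature D x (c • u) v w = c • curvature D x u v w := by
  have hu := contMDiffAt_extend u
  have hv := contMDiffAt_extend v
  have hw := contMDiffAt_extend w
  have hc : CMDiffAt ∞ (fun _ : M ↦ c) x := contMDiffAt_const
  have h := (smoothTensorialAt_curvatureField_left hD (V := FiberBundle.extend E v) hw).smul hc hu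
  rw [← curvature_apply hD hu hv hw, ← curvature_apply hD (hc.smul_section hu) hv hw] at h
  simpa only [Pi.smul_apply', extend_self] using! h

theorem curvature_swap (x : M) (u v w : TangentSpace I x) :
    curvature D x u v w = -curvature D x v u w := by
  simp only [curvature_eq_curvatureField, curvatureField_swap D (FiberBundle.extend E u)]

theorem curvature_add_middle (x : M) (u v v' w : TangentSpace I x) :
    curvature D x u (v + v') w = curvature D x u v w + curvature D x u v' w := by
  simp only [curvature_swap hD x u, curvature_add_left hD, neg_add]

theorem curvature_smul_middle (x : M) (c : ℝ) (u v w : TangentSpace I x) :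
    curvature D x u (c • v) w = c • curvature D x u v w := by
  simp only [curvature_swap hD x u, curvature_smul_left hD, smul_neg]

theorem curvature_add_right (x : M) (u v w w' : TangentSpace I x) :
    curvature D x u v (w + w') = curvature D x u v w + curvature D x u v w' := by
  have hu := contMDiffAt_extend u
  have hv := contMDiffAt_extend v
  have hw := contMDiffAt_extend w
  have hw' := contMDiffAt_extend w'
  have h := (smoothTensorialAt_curvatureField_right hD hu hv).add hw hw'
  rw [← curvature_apply hD hu hv hw, ← curvature_apply hD hu hv hw',
    ← curvature_apply hD hu hv (hw.add_section hw')] at h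
  simpa only [Pi.add_apply, extend_self] using! h

theorem curvature_smul_right (x : M) (c : ℝ) (u v w : TangentSpace I x) :
    curvature D x u v (c • w) = c • curvature D x u v w := by
  have hu := contMDiffAt_extend u
  have hv := contMDiffAt_extend v
  have hw := contMDiffAt_extend w
  have hc : CMDiffAt ∞ (fun _ : M ↦ c) x := contMDiffAt_const
  have h := (smoothTensorialAt_curvatureField_right hD hu hv).smul hc hw
  rw [← curvature_apply hD hu hv hw, ← curvature_apply hD hu hv (hc.smul_section hw)] at h
  simpa only [Pi.smul_apply', extend_self] using! h

/-- The endomorphism `u ↦ R(u, v) w`. -/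
def curvatureLeft (x : M) (v w : TangentSpace I x) : TangentSpace I x →ₗ[ℝ] TangentSpace I x where
  toFun u := curvature D x u v w
  map_add' u u' := curvature_add_left hD x u u' v w
  map_smul' c u := curvature_smul_left hD x c u v w

/-- On frame fields the curvature is an explicit combination of smooth fields; linearity in each of
the three slots gives the general case. -/
theorem contMDiffAt_curvature {U V W : Π x : M, TangentSpace I x} {x : M}
    (hU : CMDiffAt ∞ (T% U) x) (hV : CMDiffAt ∞ (T% V) x) (hW : CMDiffAt ∞ (T% W) x) :
    CMDiffAt ∞ (T% (fun y ↦ curvature D y (U y) (V y) (W y))) x := by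
  have hs := contMDiffAt_coordFrame (I := I) x
  have h1 (i j k) : CMDiffAt ∞ (T% (fun y ↦ curvature D y (coordFrame I x i y)
      (coordFrame I x j y) (coordFrame I x k y))) x := by
    have h := ((contMDiffAt_cov_apply D hD (hs i) (contMDiffAt_cov_apply D hD (hs j) (hs k))
      ).sub_section (contMDiffAt_cov_apply D hD (hs j) (contMDiffAt_cov_apply D hD (hs i) (hs k)))
      ).sub_section (contMDiffAt_cov_apply D hD (contMDiffAt_mlieBracket (hs i) (hs j)) (hs k))
    refine h.congr_of_eventuallyEq ?_
    filter_upwards [eventually_contMDiffAt_coordFrame (I := I) x i,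
      eventually_contMDiffAt_coordFrame (I := I) x j,
      eventually_contMDiffAt_coordFrame (I := I) x k] with y hi hj hk
    exact congrArg (TotalSpace.mk' E y) (curvature_apply hD hi hj hk)
  have h2 (i j) := contMDiffAt_apply_of_frame (x := x) (A := fun y ↦
    (⟨⟨fun w ↦ curvature D y (coordFrame I x i y) (coordFrame I x j y) w,
      curvature_add_right hD y _ _⟩, fun c ↦ curvature_smul_right hD y c _ _⟩ :
      TangentSpace I y →ₗ[ℝ] TangentSpace I y)) (h1 i j) hW
  have h3 (i) := contMDiffAt_apply_of_frame (x := x) (A := fun y ↦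
    (⟨⟨fun v ↦ curvature D y (coordFrame I x i y) v (W y),
      fun v v' ↦ curvature_add_middle hD y _ v v' _⟩, fun c v ↦ curvature_smul_middle hD y c _ v _⟩ :
      TangentSpace I y →ₗ[ℝ] TangentSpace I y)) (h2 i) hV
  exact contMDiffAt_apply_of_frame (x := x) (A := fun y ↦ curvatureLeft hD y (V y) (W y)) h3 hU

theorem ricci_eq_trace (x : M) (v w : TangentSpace I x) :
    ricci D x v w = LinearMap.trace ℝ (TangentSpace I x) (curvatureLeft hD x v w) := by
  rw [LinearMap.trace_eq_matrix_trace ℝ (Module.finBasis ℝ (TangentSpace I x))]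
  exact Finset.sum_congr rfl fun i _ ↦ by
    rw [Matrix.diag_apply, LinearMap.toMatrix_apply]; rfl

/-- The Ricci tensor as a bilinear form. -/
def ricciForm (x : M) : TangentSpace I x →ₗ[ℝ] TangentSpace I x →ₗ[ℝ] ℝ :=
  LinearMap.mk₂ ℝ (ricci D x)
    (fun v v' w ↦ by simp only [ricci, curvature_add_middle hD, map_add, Finset.sum_add_distrib])
    (fun c v w ↦ by
      simp only [ricci, curvature_smul_middle hD, map_smul, smul_eq_mul, Finset.mul_sum])
    (fun v w w' ↦ by simp only [ricci, curvature_add_right hD, map_add, Finset.sum_add_distrib])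
    (fun c v w ↦ by
      simp only [ricci, curvature_smul_right hD, map_smul, smul_eq_mul, Finset.mul_sum])

theorem contMDiffAt_ricci {V W : Π x : M, TangentSpace I x} {x : M}
    (hV : CMDiffAt ∞ (T% V) x) (hW : CMDiffAt ∞ (T% W) x) :
    CMDiffAt ∞ (fun y ↦ ricci D y (V y) (W y)) x := by
  simp only [ricci_eq_trace hD]
  exact contMDiffAt_trace fun U hU ↦ contMDiffAt_curvature hD hU hV hW

/-- Expand `UVg - VUg = [U, V]g` for the function `g = Ω(W, Z)` using `DΩ = 0`. The mixed products
of first derivatives cancel and the rest is the claim. -/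
theorem curvature_skew {Ω : Π x : M, TangentSpace I x →L[ℝ] TangentSpace I x →L[ℝ] ℝ}
    (hΩ : ∀ x (V W : Π x : M, TangentSpace I x), CMDiffAt ∞ (T% V) x → CMDiffAt ∞ (T% W) x →
      CMDiffAt ∞ (fun y ↦ Ω y (V y) (W y)) x) (hpr : Preserves D Ω) (x : M)
    (u v w z : TangentSpace I x) :
    Ω x (curvature D x u v w) z + Ω x w (curvature D x u v z) = 0 := by
  have hu := contMDiffAt_extend u
  have hv := contMDiffAt_extend v
  have hw := contMDiffAt_extend w
  have hz := contMDiffAt_extend z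
  have md {V : Π x : M, TangentSpace I x} (hV : CMDiffAt ∞ (T% V) x) : MDiffAt (T% V) x :=
    hV.mdifferentiableAt (by simp)
  have key {u v : TangentSpace I x} (hu : CMDiffAt ∞ (T% (FiberBundle.extend E u)) x)
      (hv : CMDiffAt ∞ (T% (FiberBundle.extend E v)) x) :
      mvfderiv I (fun y ↦ mvfderiv I (fun y ↦ Ω y (FiberBundle.extend E w y)
        (FiberBundle.extend E z y)) y (FiberBundle.extend E v y)) x u
      = Ω x (D (fun y ↦ D (FiberBundle.extend E w) y (FiberBundle.extend E v y)) x u) z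
        + Ω x (D (FiberBundle.extend E w) x v) (D (FiberBundle.extend E z) x u)
        + (Ω x (D (FiberBundle.extend E w) x u) (D (FiberBundle.extend E z) x v)
        + Ω x w (D (fun y ↦ D (FiberBundle.extend E z) y (FiberBundle.extend E v y)) x u)) := by
    have h1 : (fun y ↦ mvfderiv I (fun y ↦ Ω y (FiberBundle.extend E w y)
        (FiberBundle.extend E z y)) y (FiberBundle.extend E v y)) =ᶠ[𝓝 x]
        (fun y ↦ Ω y (D (FiberBundle.extend E w) y (FiberBundle.extend E v y))
          (FiberBundle.extend E z y)) + fun y ↦ Ω y (FiberBundle.extend E w y)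
            (D (FiberBundle.extend E z) y (FiberBundle.extend E v y)) := by
      filter_upwards [eventually_mdifferentiableAt_section hw,
        eventually_mdifferentiableAt_section hz] with y h1 h2
      exact hpr y _ _ h1 h2 _
    have hwv := contMDiffAt_cov_apply D hD hv hw
    have hzv := contMDiffAt_cov_apply D hD hv hz
    rw [mvfderiv_congr h1, mvfderiv_add ((hΩ x _ _ hwv hz).mdifferentiableAt (by simp))
      ((hΩ x _ _ hw hzv).mdifferentiableAt (by simp)), add_apply,
      hpr x _ _ (md hwv) (md hz), hpr x _ _ (md hw) (md hzv)]
    simp only [extend_self]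
  have h1 := mvfderiv_mlieBracket (hΩ x _ _ hw hz) hu hv
  simp only [extend_self] at h1
  rw [key hu hv, key hv hu, hpr x _ _ (md hw) (md hz)] at h1
  simp only [curvature_eq_curvatureField, curvatureField, map_sub, extend_self,
    sub_apply] at h1 ⊢
  linarith

/-- Without torsion, `[U, [V, W]] = ∇_U∇_V W - ∇_U∇_W V - ∇_[V, W] U`. The cyclic sum of the
right-hand sides is the cyclic sum of curvatures, and that of the left-hand sides vanishes by
Jacobi. -/
theorem curvature_bianchi (htor : D.torsion = 0) (x : M) (u v w : TangentSpace I x) :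
    curvature D x u v w + curvature D x v w u + curvature D x w u v = 0 := by
  have hu := contMDiffAt_extend u
  have hv := contMDiffAt_extend v
  have hw := contMDiffAt_extend w
  have md {V : Π x : M, TangentSpace I x} (hV : CMDiffAt ∞ (T% V) x) : MDiffAt (T% V) x :=
    hV.mdifferentiableAt (by simp)
  have tor {V W : Π x : M, TangentSpace I x} {y : M} (hV : MDiffAt (T% V) y)
      (hW : MDiffAt (T% W) y) : D W y (V y) - D V y (W y) = mlieBracket I V W y :=
    D.torsion_eq_zero_iff.1 htor hV hW
  have key {U V W : Π x : M, TangentSpace I x} (hU : CMDiffAt ∞ (T% U) x)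
      (hV : CMDiffAt ∞ (T% V) x) (hW : CMDiffAt ∞ (T% W) x) :
      D (fun y ↦ D W y (V y)) x (U x) - D (fun y ↦ D V y (W y)) x (U x)
        - D U x (mlieBracket I V W x) = mlieBracket I U (mlieBracket I V W) x := by
    have h1 := contMDiffAt_mlieBracket hV hW
    have h2 : D (mlieBracket I V W) x = D (fun y ↦ D W y (V y)) x - D (fun y ↦ D V y (W y)) x := by
      have h3 : ∀ᶠ y in 𝓝 x, mlieBracket I V W y
          = ((fun y ↦ D W y (V y)) + ((fun _ : M ↦ (-1 : ℝ)) • fun y ↦ D V y (W y))) y := by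
        filter_upwards [eventually_mdifferentiableAt_section hV,
          eventually_mdifferentiableAt_section hW] with y hy hy2
        rw [← tor hy hy2, sub_eq_add_neg, ← neg_one_smul ℝ]
        rfl
      have h4 : MDiffAt (fun _ : M ↦ (-1 : ℝ)) x := mdifferentiableAt_const
      have h5 := md (contMDiffAt_cov_apply D hD hV hW)
      have h6 := md (contMDiffAt_cov_apply D hD hW hV)
      rw [cov_congr D (md h1) h3, cov_add D h5 (h4.smul_section h6)]
      refine ContinuousLinearMap.ext fun u ↦ ?_
      rw [add_apply, cov_smul D h4 h6]
      have h7 : mvfderiv I (fun _ : M ↦ (-1 : ℝ)) x u = 0 := by simp [mvfderiv_const]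
      rw [h7, zero_smul, add_zero, neg_one_smul, ← sub_eq_add_neg, sub_apply]
    rw [← tor (md hU) (md h1), h2, sub_apply]
  have : IsManifold I (minSmoothness ℝ 3) M := .of_le (n := ∞) (by
    simpa using (WithTop.coe_le_coe.2 (le_top : (3 : ℕ∞) ≤ ⊤)))
  have h := leibniz_identity_mlieBracket_apply (I := I) (U := FiberBundle.extend E u)
    (V := FiberBundle.extend E v) (W := FiberBundle.extend E w) (x := x)
    (hu.of_le (by simp [two_le_infty]))
    (hv.of_le (by simp [two_le_infty]))
    (hw.of_le (by simp [two_le_infty]))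
  rw [mlieBracket_swap_apply (V := mlieBracket I _ _)] at h
  have h1 := key hu hv hw
  have h2 := key hv hw hu
  have h3 := key hw hu hv
  have h4 : mlieBracket I (FiberBundle.extend E v) (mlieBracket I (FiberBundle.extend E u)
      (FiberBundle.extend E w)) x = -mlieBracket I (FiberBundle.extend E v)
        (mlieBracket I (FiberBundle.extend E w) (FiberBundle.extend E u)) x := by
    have : mlieBracket I (FiberBundle.extend E u) (FiberBundle.extend E w)
        = (-1 : ℝ) • mlieBracket I (FiberBundle.extend E w) (FiberBundle.extend E u) := by
      ext y : 1
      rw [mlieBracket_swap_apply, Pi.smul_apply, neg_one_smul]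
    rw [this, mlieBracket_const_smul_right (md (contMDiffAt_mlieBracket hw hu)), neg_one_smul]
  rw [h4, ← h1, ← h2, ← h3] at h
  simp only [curvature_eq_curvatureField, curvatureField]
  rw [← sub_eq_zero] at h
  rw [← h]
  module

/-- By Bianchi the difference of the two sides is the trace of `u ↦ -R(v, w)u`, which is skew for
`Ω` and hence traceless. Used on `N` to make `σ` skew, and on the cone to exchange the Reeb and
horizontal arguments. -/
theorem ricci_symm (htor : D.torsion = 0)
    {Ω : Π x : M, TangentSpace I x →L[ℝ] TangentSpace I x →L[ℝ] ℝ}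
    (hΩ : ∀ x (V W : Π x : M, TangentSpace I x), CMDiffAt ∞ (T% V) x → CMDiffAt ∞ (T% W) x →
      CMDiffAt ∞ (fun y ↦ Ω y (V y) (W y)) x) (hpr : Preserves D Ω)
    (hnd : ∀ x u, (∀ v, Ω x u v = 0) → u = 0) (x : M) (v w : TangentSpace I x) :
    ricci D x v w = ricci D x w v := by
  rw [ricci_eq_trace hD, ricci_eq_trace hD, ← sub_eq_zero, ← map_sub]
  refine trace_eq_zero_of_skew (LinearMap.mk₂ ℝ (fun u v ↦ Ω x u v) (by simp) (by simp) (by simp)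
    (by simp)) (hnd x) _ fun u z ↦ ?_
  have h (u : TangentSpace I x) : (curvatureLeft hD x v w - curvatureLeft hD x w v) u
      = -curvature D x v w u := by
    have := curvature_bianchi hD htor x u v w
    rw [curvature_swap hD x w u] at this
    simp only [curvatureLeft, LinearMap.sub_apply, LinearMap.coe_mk, AddHom.coe_mk]
    rw [← sub_eq_zero, ← this]
    module
  rw [h, h]
  have := curvature_skew hD hΩ hpr x v w u z
  simp only [LinearMap.mk₂_apply, map_neg, LinearMap.neg_apply]
  linarith

end Linear

theorem SmoothTensorialAt.extend_add {A : Type*} [AddCommGroup A] [Module ℝ A]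
    {Φ : (Π x : M, TangentSpace I x) → A} {x : M} (hΦ : SmoothTensorialAt Φ x)
    (u v : TangentSpace I x) : Φ (FiberBundle.extend E (u + v))
      = Φ (FiberBundle.extend E u) + Φ (FiberBundle.extend E v) := by
  have hu := contMDiffAt_extend u
  have hv := contMDiffAt_extend v
  rw [← hΦ.add hu hv]
  refine hΦ.pointwise (contMDiffAt_extend _) (hu.add_section hv) ?_
  simp only [Pi.add_apply, extend_self]

theorem SmoothTensorialAt.extend_smul {A : Type*} [AddCommGroup A] [Module ℝ A]
    {Φ : (Π x : M, TangentSpace I x) → A} {x : M} (hΦ : SmoothTensorialAt Φ x)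
    (c : ℝ) (u : TangentSpace I x) : Φ (FiberBundle.extend E (c • u))
      = c • Φ (FiberBundle.extend E u) := by
  have hu := contMDiffAt_extend u
  have hc : CMDiffAt ∞ (fun _ : M ↦ c) x := contMDiffAt_const
  refine Eq.trans ?_ (hΦ.smul hc hu)
  refine hΦ.pointwise (contMDiffAt_extend _) (hc.smul_section hu) ?_
  simp only [Pi.smul_apply', extend_self]

/-! ### The covariant derivative of an endomorphism field -/

section CovEndo

variable (D) in
theorem smoothTensorialAt_covEndo {σ : Π x : M, TangentSpace I x →L[ℝ] TangentSpace I x} {x : M}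
    (hσ : ∀ V : Π x : M, TangentSpace I x, CMDiffAt ∞ (T% V) x →
      CMDiffAt ∞ (T% (fun y ↦ σ y (V y))) x) :
    SmoothTensorialAt (fun V ↦ D (fun y ↦ σ y (V y)) x - (σ x).comp (D V x)) x where
  smul {f V} hf hV := by
    have h1 : (fun y ↦ σ y ((f • V) y)) = f • fun y ↦ σ y (V y) := by
      ext y : 1
      exact map_smul _ _ _
    have hfd := hf.mdifferentiableAt (by simp : (∞ : ℕ∞ω) ≠ 0)
    rw [h1]
    refine ContinuousLinearMap.ext fun u ↦ ?_
    simp only [sub_apply, smul_apply, ContinuousLinearMap.comp_apply,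
      cov_smul D hfd ((hσ V hV).mdifferentiableAt (by simp)),
      cov_smul D hfd (hV.mdifferentiableAt (by simp)), map_add, map_smul]
    module
  add {V W} hV hW := by
    have h1 : (fun y ↦ σ y ((V + W) y)) = (fun y ↦ σ y (V y)) + fun y ↦ σ y (W y) := by
      ext y : 1
      exact map_add _ _ _
    rw [h1, cov_add D ((hσ V hV).mdifferentiableAt (by simp))
      ((hσ W hW).mdifferentiableAt (by simp)),
      cov_add D (hV.mdifferentiableAt (by simp)) (hW.mdifferentiableAt (by simp))]
    refine ContinuousLinearMap.ext fun u ↦ ?_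
    simp only [sub_apply, add_apply, ContinuousLinearMap.comp_apply, map_add]
    module

theorem covEndo_apply {σ : Π x : M, TangentSpace I x →L[ℝ] TangentSpace I x} {x : M}
    (hσ : ∀ V : Π x : M, TangentSpace I x, CMDiffAt ∞ (T% V) x →
      CMDiffAt ∞ (T% (fun y ↦ σ y (V y))) x)
    {V : Π x : M, TangentSpace I x} (hV : CMDiffAt ∞ (T% V) x) (u : TangentSpace I x) :
    covEndo D σ x (V x) u = D (fun y ↦ σ y (V y)) x u - σ x (D V x u) :=
  DFunLike.congr_fun ((smoothTensorialAt_covEndo D hσ).pointwise (contMDiffAt_extend _) hV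
    (extend_self _)) u

theorem contMDiffAt_covEndo [T2Space M] (hD : D.ContMDiffCovariantDerivative ∞)
    {σ : Π x : M, TangentSpace I x →L[ℝ] TangentSpace I x}
    (hσ : ∀ x (V : Π x : M, TangentSpace I x), CMDiffAt ∞ (T% V) x →
      CMDiffAt ∞ (T% (fun y ↦ σ y (V y))) x) {U V : Π x : M, TangentSpace I x} {x : M}
    (hU : CMDiffAt ∞ (T% U) x) (hV : CMDiffAt ∞ (T% V) x) :
    CMDiffAt ∞ (T% (fun y ↦ covEndo D σ y (V y) (U y))) x := by
  have hs := contMDiffAt_coordFrame (I := I) x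
  refine contMDiffAt_apply_of_frame (x := x) (A := fun y ↦
    (⟨⟨fun v ↦ covEndo D σ y v (U y), fun v v' ↦ ?_⟩, fun c v ↦ ?_⟩ :
      TangentSpace I y →ₗ[ℝ] TangentSpace I y)) (fun i ↦ ?_) hV
  · exact DFunLike.congr_fun ((smoothTensorialAt_covEndo D (hσ y)).extend_add v v') (U y)
  · exact DFunLike.congr_fun ((smoothTensorialAt_covEndo D (hσ y)).extend_smul c v) (U y)
  · have h := (contMDiffAt_cov_apply D hD hU (hσ x _ (hs i))).sub_section
      (hσ x _ (contMDiffAt_cov_apply D hD hU (hs i)))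
    refine h.congr_of_eventuallyEq ?_
    filter_upwards [eventually_contMDiffAt_coordFrame (I := I) x i] with y hi
    exact congrArg (TotalSpace.mk' E y) (covEndo_apply (hσ y) hi (U y))

end CovEndo

end Curvature

/-! ### Duality by the symplectic form, and the data σ, U, f -/

section Symplectic

variable {E : Type*} [NormedAddCommGroup E] [NormedSpace ℝ E] [FiniteDimensional ℝ E]
  [CompleteSpace E] {H : Type*} [TopologicalSpace H] {I : ModelWithCorners ℝ E H}
  {M : Type*} [TopologicalSpace M] [ChartedSpace H M] [IsManifold I ∞ M]

instance t2Space_tangentSpace (x : M) : T2Space (TangentSpace I x) := inferInstanceAs (T2Space E)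

theorem OneForm.contMDiffAt_apply (α : OneForm I M) {V : Π x : M, TangentSpace I x} {x : M}
    (hV : CMDiffAt ∞ (T% V) x) : CMDiffAt ∞ (fun y ↦ α y (V y)) x := by
  have h : ContMDiffAt I (I.prod 𝓘(ℝ, ℝ)) ∞
      (fun m ↦ TotalSpace.mk' ℝ (E := Bundle.Trivial M ℝ) m (α m (V m))) x := by
    apply ContMDiffAt.clm_bundle_apply (F₁ := E)
    · exact α.smooth x
    · exact hV
  exact (contMDiffAt_totalSpace.1 h).2

namespace IsSymplecticForm

variable {ν : Π x : M, TangentSpace I x →L[ℝ] TangentSpace I x →L[ℝ] ℝ} (hν : IsSymplecticForm ν)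
include hν

theorem contMDiffAt_apply {V W : Π x : M, TangentSpace I x} {x : M}
    (hV : CMDiffAt ∞ (T% V) x) (hW : CMDiffAt ∞ (T% W) x) :
    CMDiffAt ∞ (fun y ↦ ν y (V y) (W y)) x := by
  have h : ContMDiffAt I (I.prod 𝓘(ℝ, ℝ)) ∞
      (fun m ↦ TotalSpace.mk' ℝ (E := Bundle.Trivial M ℝ) m (ν m (V m) (W m))) x := by
    apply ContMDiffAt.clm_bundle_apply₂ (F₁ := E) (F₂ := E)
    · exact hν.smooth x
    · exact hV
    · exact hW
  exact (contMDiffAt_totalSpace.1 h).2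

theorem swap (x : M) (u v : TangentSpace I x) : ν x u v = -ν x v u := by
  have h := hν.alternating x (u + v)
  simp only [map_add, add_apply, hν.alternating] at h
  linarith

theorem nondegenerate_right (x : M) (u : TangentSpace I x) (h : ∀ v, ν x v u = 0) : u = 0 :=
  hν.nondegenerate x u fun v ↦ by rw [hν.swap, h, neg_zero]

theorem trace_eq_zero_of_skew {x : M} (A : TangentSpace I x →ₗ[ℝ] TangentSpace I x)
    (hA : ∀ u v, ν x (A u) v + ν x u (A v) = 0) :
    LinearMap.trace ℝ (TangentSpace I x) A = 0 :=
  SymplecticCone.trace_eq_zero_of_skew (LinearMap.mk₂ ℝ (fun u v ↦ ν x u v) (by simp) (by simp)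
    (by simp) (by simp)) (hν.nondegenerate x) _ hA

/-- The form `u ↦ ν(u, v)`. -/
def flipForm (_hν : IsSymplecticForm ν) (x : M) (v : TangentSpace I x) :
    TangentSpace I x →ₗ[ℝ] ℝ where
  toFun u := ν x u v
  map_add' u u' := by simp
  map_smul' c u := by simp

theorem flipForm_apply (x : M) (u v : TangentSpace I x) : hν.flipForm x v u = ν x u v := rfl

theorem exists_sharp (x : M) : ∃ sh : Module.Dual ℝ (TangentSpace I x) →ₗ[ℝ] TangentSpace I x,
    ∀ φ v, ν x v (sh φ) = φ v := by
  let B : TangentSpace I x →ₗ[ℝ] Module.Dual ℝ (TangentSpace I x) :=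
    LinearMap.mk₂ ℝ (fun u v ↦ ν x v u) (by simp) (by simp) (by simp) (by simp)
  have hinj : Function.Injective B := by
    rw [← LinearMap.ker_eq_bot, LinearMap.ker_eq_bot']
    exact fun u hu ↦ hν.nondegenerate_right x u fun v ↦ DFunLike.congr_fun hu v
  let e := LinearEquiv.ofInjectiveOfFinrankEq B hinj Subspace.dual_finrank_eq.symm
  exact ⟨e.symm.toLinearMap, fun φ v ↦ DFunLike.congr_fun (e.apply_symm_apply φ) v⟩

/-- The covectors `ν(∂ᵢ, ·)` of a coordinate frame are jointly injective by nondegeneracy, so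
`contMDiffAt_of_covectors` applies. This makes `σ` and `U`, which are defined by duality, smooth. -/
theorem contMDiffAt_of_apply {Z : Π x : M, TangentSpace I x} {x : M}
    (hZ : ∀ V : Π x : M, TangentSpace I x, CMDiffAt ∞ (T% V) x →
      CMDiffAt ∞ (fun y ↦ ν y (V y) (Z y)) x) : CMDiffAt ∞ (T% Z) x := by
  refine contMDiffAt_of_covectors (l := fun i y ↦ (ν y (coordFrame I x i y)).toLinearMap)
    (fun i Y hY ↦ hν.contMDiffAt_apply (contMDiffAt_coordFrame x i) hY) (fun v hv ↦ ?_)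
    fun i ↦ hZ _ (contMDiffAt_coordFrame x i)
  refine hν.nondegenerate_right x v fun u ↦ ?_
  have h := (eventually_eq_sum_frameCoeff x (FiberBundle.extend E u)).self_of_nhds
  rw [extend_self] at h
  rw [h, map_sum, sum_apply]
  refine Finset.sum_eq_zero fun i _ ↦ ?_
  rw [map_smul, smul_apply]
  exact (congrArg _ (hv i)).trans (smul_zero _)

end IsSymplecticForm

variable {ν : Π x : M, TangentSpace I x →L[ℝ] TangentSpace I x →L[ℝ] ℝ}
  {nabla : AffineConnection I M}

/-- Differentiate the identity `ν(σV, W) + ν(V, σW) = 0` along `u`. It makes the trace of `v ↦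
(∇_uσ)v` vanish in the mixed Ricci component. -/
theorem covEndo_skew (hpr : Preserves nabla ν)
    {σ : Π x : M, TangentSpace I x →L[ℝ] TangentSpace I x}
    (hσ : ∀ x (V : Π x : M, TangentSpace I x), CMDiffAt ∞ (T% V) x →
      CMDiffAt ∞ (T% (fun y ↦ σ y (V y))) x)
    (hskew : ∀ x u v, ν x (σ x u) v + ν x u (σ x v) = 0) (x : M) (u v w : TangentSpace I x) :
    ν x (covEndo nabla σ x v u) w + ν x v (covEndo nabla σ x w u) = 0 := by
  have hv := contMDiffAt_extend v
  have hw := contMDiffAt_extend w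
  have md {V : Π x : M, TangentSpace I x} (hV : CMDiffAt ∞ (T% V) x) : MDiffAt (T% V) x :=
    hV.mdifferentiableAt (by simp)
  have h1 := covEndo_apply (D := nabla) (hσ x) hv u
  have h2 := covEndo_apply (D := nabla) (hσ x) hw u
  rw [extend_self] at h1 h2
  have h3 := hpr x _ _ (md (hσ x _ hv)) (md hw) u
  have h4 := hpr x _ _ (md hv) (md (hσ x _ hw)) u
  have h5 : mvfderiv I (fun y ↦ ν y (FiberBundle.extend E v y) (σ y (FiberBundle.extend E w y))) x
      = -mvfderiv I (fun y ↦ ν y (σ y (FiberBundle.extend E v y)) (FiberBundle.extend E w y)) x := by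
    rw [← mvfderiv_neg]
    congr 1
    ext y
    exact (neg_eq_of_add_eq_zero_right (hskew y _ _)).symm
  rw [h5, neg_apply, h3] at h4
  simp only [extend_self] at h4
  rw [h1, h2]
  simp only [map_sub, sub_apply]
  have h6 := hskew x (nabla (FiberBundle.extend E v) x u) w
  have h7 := hskew x v (nabla (FiberBundle.extend E w) x u)
  linarith

theorem exists_cone_data [T2Space M] [I.Boundaryless] {n : ℕ} (hn : Module.finrank ℝ E = 2 * n)
    (hν : IsSymplecticForm ν) (hD : nabla.ContMDiffCovariantDerivative ∞)
    (htor : nabla.torsion = 0) (hpr : Preserves nabla ν) :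
    ∃ (σ : Π x : M, TangentSpace I x →L[ℝ] TangentSpace I x) (U : Π x : M, TangentSpace I x)
      (f : M → ℝ), (∀ x (V : Π x : M, TangentSpace I x), CMDiffAt ∞ (T% V) x →
        CMDiffAt ∞ (T% (fun y ↦ σ y (V y))) x) ∧
      (∀ x, CMDiffAt ∞ (T% U) x) ∧ (∀ x, CMDiffAt ∞ f x) ∧
      (∀ x u v, ν x (σ x u) v + ν x u (σ x v) = 0) ∧
      (∀ x v w, ν x v (σ x w) = 1 / (2 * n + 2) * ricci nabla x v w) ∧
      (∀ x v, (2 * n + 1) * ν x v (U x) = -endoTrace (covEndo nabla σ x v)) ∧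
      ∀ x, 2 * n * f x = endoTrace (nabla U x) + endoTrace ((σ x).comp (σ x)) := by
  choose sh hsh using hν.exists_sharp
  let σ (x : M) : TangentSpace I x →L[ℝ] TangentSpace I x := LinearMap.toContinuousLinearMap
    (sh x ∘ₗ ((1 / (2 * n + 2) : ℝ) • (ricciForm hD x).flip))
  have hσ1 (x v w) : ν x v (σ x w) = 1 / (2 * n + 2) * ricci nabla x v w := hsh x _ v
  have hσ2 (x : M) (V : Π x : M, TangentSpace I x) (hV : CMDiffAt ∞ (T% V) x) :
      CMDiffAt ∞ (T% (fun y ↦ σ y (V y))) x := by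
    refine hν.contMDiffAt_of_apply fun W hW ↦ ?_
    simp only [hσ1]
    exact contMDiffAt_const.mul (contMDiffAt_ricci hD hW hV)
  -- Since `ν` is antisymmetric, skewness of `σ` amounts to symmetry of the Ricci tensor.
  have hσ3 (x u v) : ν x (σ x u) v + ν x u (σ x v) = 0 := by
    rw [hν.swap, hσ1, hσ1,
      ricci_symm hD htor (fun x V W ↦ hν.contMDiffAt_apply) hpr hν.nondegenerate]
    ring
  let τ (x : M) : Module.Dual ℝ (TangentSpace I x) :=
    { toFun := fun v ↦ endoTrace (covEndo nabla σ x v)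
      map_add' := fun v w ↦ by
        have : covEndo nabla σ x (v + w) = covEndo nabla σ x v + covEndo nabla σ x w :=
          (smoothTensorialAt_covEndo nabla (hσ2 x)).extend_add v w
        rw [this]
        exact map_add (LinearMap.trace ℝ _) _ _
      map_smul' := fun c v ↦ by
        have : covEndo nabla σ x (c • v) = c • covEndo nabla σ x v :=
          (smoothTensorialAt_covEndo nabla (hσ2 x)).extend_smul c v
        rw [this]
        exact map_smul (LinearMap.trace ℝ _) _ _ }
  let U (x : M) : TangentSpace I x := sh x (-(1 / (2 * n + 1) : ℝ) • τ x)
  have hU1 (x v) : ν x v (U x) = -(1 / (2 * n + 1) : ℝ) * endoTrace (covEndo nabla σ x v) :=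
    hsh x _ v
  have hU2 (x) : CMDiffAt ∞ (T% U) x := by
    refine hν.contMDiffAt_of_apply fun W hW ↦ ?_
    simp only [hU1]
    exact contMDiffAt_const.mul (contMDiffAt_trace fun V hV ↦ contMDiffAt_covEndo hD hσ2 hV hW)
  let f (x : M) : ℝ := 1 / (2 * n) *
    (endoTrace (nabla U x) + endoTrace ((σ x).comp (σ x)))
  refine ⟨σ, U, f, hσ2, hU2, fun x ↦ ?_, hσ3, hσ1, fun x v ↦ ?_, fun x ↦ ?_⟩
  · exact contMDiffAt_const.mul ((contMDiffAt_trace fun V hV ↦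
      contMDiffAt_cov_apply nabla hD hV (hU2 x)).add
        (contMDiffAt_trace fun V hV ↦ hσ2 x _ (hσ2 x _ hV)))
  · rw [hU1]
    have : (2 * n + 1 : ℝ) ≠ 0 := by positivity
    field_simp
  -- For `n = 0` the division in `f` yields 0; the equation still holds because the tangent spaces
  -- are zero and so are all traces.
  · rcases Nat.eq_zero_or_pos n with rfl | hpos
    · have : Subsingleton (TangentSpace I x) := by
        have : Subsingleton E := Module.finrank_zero_iff.1 (by simpa using hn)
        exact this
      have h0 (A : TangentSpace I x →L[ℝ] TangentSpace I x) : endoTrace A = 0 := by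
        rw [endoTrace, Subsingleton.elim A.toLinearMap 0, map_zero]
      simp [h0]
    · have : (n : ℝ) ≠ 0 := by positivity
      simp only [f]
      field_simp

end Symplectic

/-! ### The pulled-back connection on vector fields along a map -/

section Along

variable {E : Type*} [NormedAddCommGroup E] [NormedSpace ℝ E] [FiniteDimensional ℝ E]
  [CompleteSpace E] {H : Type*} [TopologicalSpace H] {I : ModelWithCorners ℝ E H}
  {P : Type*} [TopologicalSpace P] [ChartedSpace H P] [IsManifold I ∞ P]
  {F : Type*} [NormedAddCommGroup F] [NormedSpace ℝ F] [FiniteDimensional ℝ F]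
  [CompleteSpace F] {G : Type*} [TopologicalSpace G] {J : ModelWithCorners ℝ F G}
  {N : Type*} [TopologicalSpace N] [ChartedSpace G N] [IsManifold J ∞ N]

theorem frameCoeff_eq_repr {x₀ y : N}
    (hy : y ∈ (trivializationAt F (TangentSpace J) x₀).baseSet) (v : TangentSpace J y) (i) :
    frameCoeff J x₀ i y v = (Module.finBasis ℝ F).repr
      (trivializationAt F (TangentSpace J) x₀ ⟨y, v⟩).2 i := by
  have h := (trivializationAt F (TangentSpace J) x₀).localFrameCoeff_eq_coeff (I := J)
    (b := Module.finBasis ℝ F) (s := FiberBundle.extend F v) hy (i := i)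
  simp only [FiberBundle.extend_apply_self] at h
  exact h

variable {pr : P → N}

theorem eventually_mem_baseSet_along {p : P} (hpr : ContinuousAt pr p) :
    ∀ᶠ p' in 𝓝 p, pr p' ∈ (trivializationAt F (TangentSpace J) (pr p)).baseSet :=
  hpr.eventually ((trivializationAt F (TangentSpace J) (pr p)).open_baseSet.mem_nhds
    (mem_baseSet_trivializationAt F (TangentSpace J) (pr p)))

theorem contMDiffAt_frameCoeff_along {Z : Π p : P, TangentSpace J (pr p)} {p : P}
    (hZ : ContMDiffAt I J.tangent ∞ (fun p' ↦ TotalSpace.mk' F (pr p') (Z p')) p) (i) :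
    CMDiffAt ∞ (fun p' ↦ frameCoeff J (pr p) i (pr p') (Z p')) p := by
  have h := contMDiffAt_totalSpace.1 hZ
  have h1 := (LinearMap.toContinuousLinearMap
    ((Module.finBasis ℝ F).coord i)).contMDiff.contMDiffAt.comp p h.2
  refine h1.congr_of_eventuallyEq ?_
  filter_upwards [eventually_mem_baseSet_along (J := J) (F := F) h.1.continuousAt] with p' hp'
  exact frameCoeff_eq_repr hp' _ i

theorem mdifferentiableAt_frameCoeff_along {Z : Π p : P, TangentSpace J (pr p)} {p : P}
    (hZ : MDifferentiableAt I J.tangent (fun p' ↦ TotalSpace.mk' F (pr p') (Z p')) p) (i) :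
    MDiffAt (fun p' ↦ frameCoeff J (pr p) i (pr p') (Z p')) p := by
  have h := (mdifferentiableAt_totalSpace _ _).1 hZ
  have h1 := (LinearMap.toContinuousLinearMap
    ((Module.finBasis ℝ F).coord i)).mdifferentiableAt.comp p h.2
  refine h1.congr_of_eventuallyEq ?_
  filter_upwards [eventually_mem_baseSet_along (J := J) (F := F) h.1.continuousAt] with p' hp'
  exact frameCoeff_eq_repr hp' _ i

theorem contMDiffAt_mfderiv_along (hpr : ContMDiff I J ∞ pr) {Y : Π p : P, TangentSpace I p} {p : P}
    (hY : CMDiffAt ∞ (T% Y) p) :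
    ContMDiffAt I J.tangent ∞ (fun p' ↦ TotalSpace.mk' F (pr p') (mfderiv I J pr p' (Y p'))) p :=
  (hpr.contMDiff_tangentMap (m := ∞) (by simp)).contMDiffAt.comp p hY

theorem mdifferentiableAt_mfderiv_along (hpr : ContMDiff I J ∞ pr) {Y : Π p : P, TangentSpace I p}
    {p : P} (hY : MDiffAt (T% Y) p) : MDifferentiableAt I J.tangent
      (fun p' ↦ TotalSpace.mk' F (pr p') (mfderiv I J pr p' (Y p'))) p :=
  ((hpr.contMDiff_tangentMap (m := ∞) (by simp)).mdifferentiable (by simp) _).comp p hY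

variable (nabla : AffineConnection J N)

variable (I pr) in
/-- The covariant derivative, along `pr`, of a vector field along `pr`. -/
def covAlong (Z : Π p : P, TangentSpace J (pr p)) (p : P) :
    TangentSpace I p →L[ℝ] TangentSpace J (pr p) :=
  ∑ i, ((mvfderiv I (fun p' ↦ frameCoeff J (pr p) i (pr p') (Z p')) p).smulRight
      (coordFrame J (pr p) i (pr p))
    + frameCoeff J (pr p) i (pr p) (Z p) •
      (nabla (coordFrame J (pr p) i) (pr p)).comp (mfderiv I J pr p))

theorem covAlong_apply (Z : Π p : P, TangentSpace J (pr p)) (p : P) (v : TangentSpace I p) :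
    covAlong I pr nabla Z p v = ∑ i, (mvfderiv I (fun p' ↦ frameCoeff J (pr p) i (pr p') (Z p')) p v •
      coordFrame J (pr p) i (pr p) + frameCoeff J (pr p) i (pr p) (Z p) •
        nabla (coordFrame J (pr p) i) (pr p) (mfderiv I J pr p v)) := by
  simp [covAlong]

theorem sum_frameCoeff (x : N) (v : TangentSpace J x) :
    ∑ i, frameCoeff J x i x v • coordFrame J x i x = v := by
  have h := (eventually_eq_sum_frameCoeff x (FiberBundle.extend F v)).self_of_nhds
  rw [extend_self] at h
  exact h.symm

theorem covAlong_add {Z Z' : Π p : P, TangentSpace J (pr p)} {p : P}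
    (hZ : MDifferentiableAt I J.tangent (fun p' ↦ TotalSpace.mk' F (pr p') (Z p')) p)
    (hZ' : MDifferentiableAt I J.tangent (fun p' ↦ TotalSpace.mk' F (pr p') (Z' p')) p)
    (v : TangentSpace I p) : covAlong I pr nabla (fun p ↦ Z p + Z' p) p v
      = covAlong I pr nabla Z p v + covAlong I pr nabla Z' p v := by
  simp only [covAlong_apply, ← Finset.sum_add_distrib]
  refine Finset.sum_congr rfl fun i _ ↦ ?_
  have h : mvfderiv I (fun p' ↦ frameCoeff J (pr p) i (pr p') (Z p' + Z' p')) p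
      = mvfderiv I (fun p' ↦ frameCoeff J (pr p) i (pr p') (Z p')) p
        + mvfderiv I (fun p' ↦ frameCoeff J (pr p) i (pr p') (Z' p')) p := by
    rw [← mvfderiv_add (mdifferentiableAt_frameCoeff_along hZ i)
      (mdifferentiableAt_frameCoeff_along hZ' i)]
    congr 1
    ext p'
    simp
  rw [h, map_add, add_apply]
  module

theorem covAlong_smul {Z : Π p : P, TangentSpace J (pr p)} {g : P → ℝ} {p : P}
    (hg : MDiffAt g p)
    (hZ : MDifferentiableAt I J.tangent (fun p' ↦ TotalSpace.mk' F (pr p') (Z p')) p)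
    (v : TangentSpace I p) : covAlong I pr nabla (fun p ↦ g p • Z p) p v
      = g p • covAlong I pr nabla Z p v + mvfderiv I g p v • Z p := by
  conv_rhs => rw [← sum_frameCoeff (J := J) (pr p) (Z p)]
  simp only [covAlong_apply, Finset.smul_sum, ← Finset.sum_add_distrib]
  refine Finset.sum_congr rfl fun i _ ↦ ?_
  have h : mvfderiv I (fun p' ↦ frameCoeff J (pr p) i (pr p') (g p' • Z p')) p
      = g p • mvfderiv I (fun p' ↦ frameCoeff J (pr p) i (pr p') (Z p')) p
        + frameCoeff J (pr p) i (pr p) (Z p) • mvfderiv I g p := by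
    rw [← mvfderiv_mul hg (mdifferentiableAt_frameCoeff_along hZ i)]
    congr 1
    ext p'
    simp
  rw [h, map_smul, add_apply, smul_apply, smul_apply, smul_eq_mul, smul_eq_mul, smul_eq_mul]
  module

/-- The chain rule for the frame coefficients of `X`. It lets derivatives of lifted fields be
computed on `N`. -/
theorem covAlong_comp {X : Π y : N, TangentSpace J y} {p : P} (hpr : MDifferentiableAt I J pr p)
    (hX : CMDiffAt ∞ (T% X) (pr p)) (v : TangentSpace I p) :
    covAlong I pr nabla (fun p ↦ X (pr p)) p v = nabla X (pr p) (mfderiv I J pr p v) := by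
  let c : Fin (Module.finrank ℝ F) → N → ℝ := fun i y ↦ frameCoeff J (pr p) i y (X y)
  have hc (i) : MDiffAt (c i) (pr p) := (contMDiffAt_frameCoeff hX i).mdifferentiableAt (by simp)
  have hs (i) : MDiffAt (T% (coordFrame J (pr p) i)) (pr p) :=
    (contMDiffAt_coordFrame (pr p) i).mdifferentiableAt (by simp)
  let T : Fin (Module.finrank ℝ F) → Π y : N, TangentSpace J y :=
    fun i ↦ c i • coordFrame J (pr p) i
  have hXT : ∀ᶠ y in 𝓝 (pr p), X y = ∑ i, T i y := eventually_eq_sum_frameCoeff (pr p) X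
  rw [cov_congr nabla (hX.mdifferentiableAt (by simp)) hXT,
    cov_sum nabla _ fun i ↦ (hc i).smul_section (hs i), sum_apply, covAlong_apply]
  refine Finset.sum_congr rfl fun i _ ↦ ?_
  refine Eq.trans ?_ (cov_smul nabla (hc i) (hs i) _).symm
  have h : mvfderiv I (fun p' ↦ frameCoeff J (pr p) i (pr p') (X (pr p'))) p v
      = mvfderiv J (c i) (pr p) (mfderiv I J pr p v) :=
    mvfderiv_comp_apply (g := c i) p (hc i) hpr v
  rw [h, add_comm]

end Along

/-! ### One-forms from their action on vector fields -/

section FunctionForm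

variable {E : Type*} [NormedAddCommGroup E] [NormedSpace ℝ E] [FiniteDimensional ℝ E]
  [CompleteSpace E] {H : Type*} [TopologicalSpace H] {I : ModelWithCorners ℝ E H}
  {M : Type*} [TopologicalSpace M] [ChartedSpace H M] [IsManifold I ∞ M]

/-- A one-form from a field of covectors sending smooth vector fields to smooth functions. -/
def OneForm.ofApply (l : Π x : M, TangentSpace I x →L[ℝ] ℝ)
    (hl : ∀ x (V : Π x : M, TangentSpace I x), CMDiffAt ∞ (T% V) x →
      CMDiffAt ∞ (fun y ↦ l y (V y)) x) : OneForm I M where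
  toFun := l
  smooth x := by
    apply contMDiffAt_hom_of_apply (F₁ := E) (F₂ := ℝ) (V₁ := (TangentSpace I : M → Type _))
      (V₂ := Bundle.Trivial M ℝ) (A := l)
    intro Y hY
    rw [contMDiffAt_totalSpace]
    exact ⟨contMDiffAt_id, hl x Y hY⟩

/-- The differential of a smooth function as a one-form. -/
def OneForm.ofFunction (q : M → ℝ) (hq : ∀ x, CMDiffAt ∞ q x) : OneForm I M :=
  .ofApply (mvfderiv I q) fun x _ hV ↦ contMDiffAt_mvfderiv_apply (hq x) hV

end FunctionForm

/-! ### Fields of triples and the definition of the cone connection -/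

section Base

variable {F : Type*} [NormedAddCommGroup F] [NormedSpace ℝ F] [FiniteDimensional ℝ F]
  [CompleteSpace F] {G : Type*} [TopologicalSpace G] {J : ModelWithCorners ℝ F G}
  {N : Type*} [TopologicalSpace N] [ChartedSpace G N] [IsManifold J ∞ N]

variable (J N) in
/-- The data on the symplectic base from which a cone connection is built. -/
structure ConeBase where
  /-- The symplectic form. -/
  ν : Π y : N, TangentSpace J y →L[ℝ] TangentSpace J y →L[ℝ] ℝ
  isSymplectic : IsSymplecticForm ν
  /-- The symplectic connection. -/
  nabla : AffineConnection J N
  smooth : nabla.ContMDiffCovariantDerivative ∞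
  torsion_eq_zero : nabla.torsion = 0
  preserves : Preserves nabla ν
  /-- The field of endomorphisms. -/
  σ : Π y : N, TangentSpace J y →L[ℝ] TangentSpace J y
  /-- The vector field. -/
  U : Π y : N, TangentSpace J y
  /-- The function. -/
  f : N → ℝ
  smooth_σ : ∀ y (V : Π y : N, TangentSpace J y), CMDiffAt ∞ (T% V) y →
    CMDiffAt ∞ (T% (fun y ↦ σ y (V y))) y
  smooth_U : ∀ y, CMDiffAt ∞ (T% U) y
  smooth_f : ∀ y, CMDiffAt ∞ f y
  skew_σ : ∀ y u v, ν y (σ y u) v + ν y u (σ y v) = 0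

variable (J) in
/-- The components of a tangent vector along the radial, Reeb and horizontal directions. -/
abbrev Triple (y : N) : Type _ := ℝ × ℝ × TangentSpace J y

/-- Smoothness of a field of triples. -/
structure SmoothTripleAt (s : Π y : N, Triple J y) (y : N) : Prop where
  fst : CMDiffAt ∞ (fun y ↦ (s y).1) y
  snd : CMDiffAt ∞ (fun y ↦ (s y).2.1) y
  vec : CMDiffAt ∞ (T% (fun y ↦ (s y).2.2)) y

namespace ConeBase

variable (B : ConeBase J N)

/-- The algebraic part of the cone connection. -/
def mult (y : N) : Triple J y →ₗ[ℝ] Triple J y →ₗ[ℝ] Triple J y :=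
  LinearMap.mk₂ ℝ (fun s t ↦
    (s.1 * t.1 - B.ν y s.2.2 (B.σ y t.2.2) + s.2.1 * B.ν y t.2.2 (B.U y)
      + t.2.1 * B.ν y s.2.2 (B.U y) + s.2.1 * t.2.1 * B.f y,
     s.1 * t.2.1 + s.2.1 * t.1 - B.ν y s.2.2 t.2.2,
     s.1 • t.2.2 + t.1 • s.2.2 + s.2.1 • B.σ y t.2.2 + t.2.1 • B.σ y s.2.2
      - (s.2.1 * t.2.1) • B.U y))
    (fun s s' t ↦ by
      refine Prod.ext ?_ (Prod.ext ?_ ?_) <;>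
      simp only [Prod.fst_add, Prod.snd_add, map_add, add_apply]
      · ring
      · ring
      · module)
    (fun c s t ↦ by
      refine Prod.ext ?_ (Prod.ext ?_ ?_) <;>
      simp only [Prod.smul_fst, Prod.smul_snd, map_smul, smul_apply, smul_eq_mul]
      · ring
      · ring
      · module)
    (fun s t t' ↦ by
      refine Prod.ext ?_ (Prod.ext ?_ ?_) <;>
      simp only [Prod.fst_add, Prod.snd_add, map_add, add_apply]
      · ring
      · ring
      · module)
    (fun c s t ↦ by
      refine Prod.ext ?_ (Prod.ext ?_ ?_) <;>
      simp only [Prod.smul_fst, Prod.smul_snd, map_smul, smul_apply, smul_eq_mul]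
      · ring
      · ring
      · module)

theorem mult_apply (y : N) (s t : Triple J y) : B.mult y s t =
    (s.1 * t.1 - B.ν y s.2.2 (B.σ y t.2.2) + s.2.1 * B.ν y t.2.2 (B.U y)
      + t.2.1 * B.ν y s.2.2 (B.U y) + s.2.1 * t.2.1 * B.f y,
     s.1 * t.2.1 + s.2.1 * t.1 - B.ν y s.2.2 t.2.2,
     s.1 • t.2.2 + t.1 • s.2.2 + s.2.1 • B.σ y t.2.2 + t.2.1 • B.σ y s.2.2
      - (s.2.1 * t.2.1) • B.U y) :=
  rfl

/-- The componentwise derivative of a field of triples. -/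
def deriv (t : Π y : N, Triple J y) (y : N) : TangentSpace J y →ₗ[ℝ] Triple J y :=
  (mvfderiv J (fun y ↦ (t y).1) y).toLinearMap.prod
    ((mvfderiv J (fun y ↦ (t y).2.1) y).toLinearMap.prod
      (B.nabla (fun y ↦ (t y).2.2) y).toLinearMap)

theorem deriv_apply (t : Π y : N, Triple J y) (y : N) (w : TangentSpace J y) : B.deriv t y w
    = (mvfderiv J (fun y ↦ (t y).1) y w, mvfderiv J (fun y ↦ (t y).2.1) y w,
      B.nabla (fun y ↦ (t y).2.2) y w) :=
  rfl

/-- The covariant derivative of `t` in the direction of `s`, for fields of triples. -/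
def cov (s t : Π y : N, Triple J y) (y : N) : Triple J y :=
  B.deriv t y (s y).2.2 + B.mult y (s y) (t y)

theorem cov_apply (s t : Π y : N, Triple J y) (y : N) : B.cov s t y =
    (mvfderiv J (fun y ↦ (t y).1) y (s y).2.2 + ((s y).1 * (t y).1
      - B.ν y (s y).2.2 (B.σ y (t y).2.2) + (s y).2.1 * B.ν y (t y).2.2 (B.U y)
      + (t y).2.1 * B.ν y (s y).2.2 (B.U y) + (s y).2.1 * (t y).2.1 * B.f y),
     mvfderiv J (fun y ↦ (t y).2.1) y (s y).2.2 + ((s y).1 * (t y).2.1 + (s y).2.1 * (t y).1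
      - B.ν y (s y).2.2 (t y).2.2),
     B.nabla (fun y ↦ (t y).2.2) y (s y).2.2 + ((s y).1 • (t y).2.2 + (t y).1 • (s y).2.2
      + (s y).2.1 • B.σ y (t y).2.2 + (t y).2.1 • B.σ y (s y).2.2
      - ((s y).2.1 * (t y).2.1) • B.U y)) :=
  rfl

theorem smoothTripleAt_cov [T2Space N] {s t : Π y : N, Triple J y} {y : N}
    (hs : SmoothTripleAt s y) (ht : SmoothTripleAt t y) : SmoothTripleAt (B.cov s t) y where
  fst := by
    simp only [cov_apply]
    have hν {V W : Π y : N, TangentSpace J y} (hV : CMDiffAt ∞ (T% V) y)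
      (hW : CMDiffAt ∞ (T% W) y) := B.isSymplectic.contMDiffAt_apply hV hW
    exact (contMDiffAt_mvfderiv_apply ht.fst hs.vec).add (((((hs.fst.mul ht.fst).sub
      (hν hs.vec (B.smooth_σ y _ ht.vec))).add (hs.snd.mul (hν ht.vec (B.smooth_U y)))).add
      (ht.snd.mul (hν hs.vec (B.smooth_U y)))).add ((hs.snd.mul ht.snd).mul (B.smooth_f y)))
  snd := by
    simp only [cov_apply]
    exact (contMDiffAt_mvfderiv_apply ht.snd hs.vec).add (((hs.fst.mul ht.snd).add
      (hs.snd.mul ht.fst)).sub (B.isSymplectic.contMDiffAt_apply hs.vec ht.vec))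
  vec := by
    simp only [cov_apply]
    exact (contMDiffAt_cov_apply B.nabla B.smooth hs.vec ht.vec).add_section
      (((((hs.fst.smul_section ht.vec).add_section (ht.fst.smul_section hs.vec)).add_section
      (hs.snd.smul_section (B.smooth_σ y _ ht.vec))).add_section
      (ht.snd.smul_section (B.smooth_σ y _ hs.vec))).sub_section
      ((hs.snd.mul ht.snd).smul_section (B.smooth_U y)))

end ConeBase

variable {E : Type*} [NormedAddCommGroup E] [NormedSpace ℝ E] [FiniteDimensional ℝ E]
  [CompleteSpace E] {H : Type*} [TopologicalSpace H] {I : ModelWithCorners ℝ E H}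
  {P : Type*} [TopologicalSpace P] [ChartedSpace H P] [IsManifold I ∞ P]

variable (I P) in
/-- A fibration over a symplectic manifold on whose total space a cone connection is built. -/
structure ConeFibration (B : ConeBase J N) where
  /-- The radial coordinate. -/
  q : P → ℝ
  smooth_q : ∀ p, CMDiffAt ∞ q p
  /-- The form dual to the Reeb direction. -/
  b : OneForm I P
  /-- The projection. -/
  pr : P → N
  smooth_pr : ContMDiff I J ∞ pr
  bijective : ∀ p, Function.Bijective (fun u : TangentSpace I p ↦
    ((mvfderiv I q p u, b p u, mfderiv I J pr p u) : Triple J (pr p)))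
  structure_eq : ∀ p (V W : Π p : P, TangentSpace I p), CMDiffAt ∞ (T% V) p →
    CMDiffAt ∞ (T% W) p → mvfderiv I (fun p ↦ b p (W p)) p (V p)
      - mvfderiv I (fun p ↦ b p (V p)) p (W p) - b p (mlieBracket I V W p)
      = 2 * B.ν (pr p) (mfderiv I J pr p (V p)) (mfderiv I J pr p (W p))

namespace ConeFibration

variable {B : ConeBase J N} (S : ConeFibration I P B)

/-- The decomposition of tangent vectors into components. -/
def toTriple (p : P) : TangentSpace I p ≃ₗ[ℝ] Triple J (S.pr p) :=
  LinearEquiv.ofBijective ((mvfderiv I S.q p).toLinearMap.prod ((S.b p).toLinearMap.prod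
    (mfderiv I J S.pr p).toLinearMap)) (S.bijective p)

theorem toTriple_apply (p : P) (u : TangentSpace I p) :
    S.toTriple p u = (mvfderiv I S.q p u, S.b p u, mfderiv I J S.pr p u) :=
  rfl

/-- The vector field with the given components. -/
def lift (s : Π y : N, Triple J y) (p : P) : TangentSpace I p :=
  (S.toTriple p).symm (s (S.pr p))

theorem toTriple_lift (s : Π y : N, Triple J y) (p : P) :
    S.toTriple p (S.lift s p) = s (S.pr p) :=
  (S.toTriple p).apply_symm_apply _

theorem dq_lift (s : Π y : N, Triple J y) (p : P) :
    mvfderiv I S.q p (S.lift s p) = (s (S.pr p)).1 :=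
  congrArg Prod.fst (S.toTriple_lift s p)

theorem b_lift (s : Π y : N, Triple J y) (p : P) : S.b p (S.lift s p) = (s (S.pr p)).2.1 :=
  congrArg (fun t ↦ t.2.1) (S.toTriple_lift s p)

theorem mfderiv_lift (s : Π y : N, Triple J y) (p : P) :
    mfderiv I J S.pr p (S.lift s p) = (s (S.pr p)).2.2 :=
  congrArg (fun t ↦ t.2.2) (S.toTriple_lift s p)

theorem mdifferentiableAt_dq {V : Π p : P, TangentSpace I p} {p : P} (hV : MDiffAt (T% V) p) :
    MDiffAt (fun p ↦ mvfderiv I S.q p (V p)) p :=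
  (OneForm.ofFunction S.q S.smooth_q).mdifferentiableAt_apply hV

/-- The cone connection. -/
def coneFun (Y : Π p : P, TangentSpace I p) (p : P) : TangentSpace I p →L[ℝ] TangentSpace I p :=
  LinearMap.toContinuousLinearMap ((S.toTriple p).symm.toLinearMap ∘ₗ
    ((mvfderiv I (fun p ↦ mvfderiv I S.q p (Y p)) p).toLinearMap.prod
      ((mvfderiv I (fun p ↦ S.b p (Y p)) p).toLinearMap.prod
        (covAlong I S.pr B.nabla (fun p ↦ mfderiv I J S.pr p (Y p)) p).toLinearMap)
    + (B.mult (S.pr p)).flip (S.toTriple p (Y p)) ∘ₗ (S.toTriple p).toLinearMap))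

theorem toTriple_coneFun (Y : Π p : P, TangentSpace I p) (p : P) (v : TangentSpace I p) :
    S.toTriple p (S.coneFun Y p v) = (mvfderiv I (fun p ↦ mvfderiv I S.q p (Y p)) p v,
      mvfderiv I (fun p ↦ S.b p (Y p)) p v,
      covAlong I S.pr B.nabla (fun p ↦ mfderiv I J S.pr p (Y p)) p v)
        + B.mult (S.pr p) (S.toTriple p v) (S.toTriple p (Y p)) :=
  (S.toTriple p).apply_symm_apply _

/-- The cone connection. -/
def cone : AffineConnection I P where
  toFun := S.coneFun
  isCovariantDerivativeOnUniv :=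
    { add := fun {Y Y' p} hY hY' _ ↦ by
        refine ContinuousLinearMap.ext fun v ↦ (S.toTriple p).injective ?_
        have h1 : mvfderiv I (fun p ↦ mvfderiv I S.q p ((Y + Y') p)) p
            = mvfderiv I (fun p ↦ mvfderiv I S.q p (Y p)) p
              + mvfderiv I (fun p ↦ mvfderiv I S.q p (Y' p)) p := by
          rw [← mvfderiv_add (S.mdifferentiableAt_dq hY) (S.mdifferentiableAt_dq hY')]
          congr 1
          ext p
          exact map_add _ _ _
        have h2 : mvfderiv I (fun p ↦ S.b p ((Y + Y') p)) p
            = mvfderiv I (fun p ↦ S.b p (Y p)) p + mvfderiv I (fun p ↦ S.b p (Y' p)) p := by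
          rw [← mvfderiv_add (S.b.mdifferentiableAt_apply hY) (S.b.mdifferentiableAt_apply hY')]
          congr 1
          ext p
          exact map_add _ _ _
        have h3 : covAlong I S.pr B.nabla (fun p ↦ mfderiv I J S.pr p ((Y + Y') p)) p v
            = covAlong I S.pr B.nabla (fun p ↦ mfderiv I J S.pr p (Y p)) p v
              + covAlong I S.pr B.nabla (fun p ↦ mfderiv I J S.pr p (Y' p)) p v := by
          rw [← covAlong_add B.nabla (mdifferentiableAt_mfderiv_along S.smooth_pr hY)
            (mdifferentiableAt_mfderiv_along S.smooth_pr hY')]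
          congr 2
          ext p : 1
          exact map_add _ _ _
        rw [add_apply, map_add, toTriple_coneFun, toTriple_coneFun, toTriple_coneFun, h1, h2, h3,
          Pi.add_apply, map_add, map_add]
        refine Eq.trans ?_ (add_add_add_comm _ _ _ _)
        rfl
      leibniz := fun {Y g p} hY hg _ ↦ by
        refine ContinuousLinearMap.ext fun v ↦ (S.toTriple p).injective ?_
        have h1 : mvfderiv I (fun p ↦ mvfderiv I S.q p ((g • Y) p)) p v
            = g p * mvfderiv I (fun p ↦ mvfderiv I S.q p (Y p)) p v
              + mvfderiv I g p v * mvfderiv I S.q p (Y p) := by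
          have := DFunLike.congr_fun (mvfderiv_mul hg (S.mdifferentiableAt_dq hY)) v
          simp only [add_apply, smul_apply, smul_eq_mul] at this
          rw [mul_comm (mvfderiv I g p v), ← this]
          congr 2
          ext p
          exact map_smul _ _ _
        have h2 : mvfderiv I (fun p ↦ S.b p ((g • Y) p)) p v
            = g p * mvfderiv I (fun p ↦ S.b p (Y p)) p v + mvfderiv I g p v * S.b p (Y p) := by
          have := DFunLike.congr_fun (mvfderiv_mul hg (S.b.mdifferentiableAt_apply hY)) v
          simp only [add_apply, smul_apply, smul_eq_mul] at this
          rw [mul_comm (mvfderiv I g p v), ← this]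
          congr 2
          ext p
          exact map_smul _ _ _
        have h3 : covAlong I S.pr B.nabla (fun p ↦ mfderiv I J S.pr p ((g • Y) p)) p v
            = g p • covAlong I S.pr B.nabla (fun p ↦ mfderiv I J S.pr p (Y p)) p v
              + mvfderiv I g p v • mfderiv I J S.pr p (Y p) := by
          rw [← covAlong_smul B.nabla hg (mdifferentiableAt_mfderiv_along S.smooth_pr hY)]
          congr 2
          ext p : 1
          exact map_smul _ _ _
        have h4 : S.toTriple p ((g p • S.coneFun Y p + (mvfderiv I g p).smulRight (Y p)) v)
            = g p • S.toTriple p (S.coneFun Y p v) + mvfderiv I g p v • S.toTriple p (Y p) := by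
          simp
        refine Eq.trans ?_ h4.symm
        rw [toTriple_coneFun, toTriple_coneFun, h1, h2, h3, Pi.smul_apply', map_smul, map_smul,
          smul_add, add_right_comm]
        rfl }

theorem toTriple_cone (Y : Π p : P, TangentSpace I p) (p : P) (v : TangentSpace I p) :
    S.toTriple p (S.cone Y p v) = (mvfderiv I (fun p ↦ mvfderiv I S.q p (Y p)) p v,
      mvfderiv I (fun p ↦ S.b p (Y p)) p v,
      covAlong I S.pr B.nabla (fun p ↦ mfderiv I J S.pr p (Y p)) p v)
        + B.mult (S.pr p) (S.toTriple p v) (S.toTriple p (Y p)) :=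
  S.toTriple_coneFun Y p v

theorem toTriple_cone_lift {t : Π y : N, Triple J y} {p : P} (ht : SmoothTripleAt t (S.pr p))
    (v : TangentSpace I p) : S.toTriple p (S.cone (S.lift t) p v)
      = B.deriv t (S.pr p) (mfderiv I J S.pr p v)
        + B.mult (S.pr p) (S.toTriple p v) (t (S.pr p)) := by
  have hpr : MDifferentiableAt I J S.pr p := S.smooth_pr.mdifferentiable (by simp) p
  rw [toTriple_cone, toTriple_lift]
  simp only [dq_lift, b_lift, mfderiv_lift]
  congr 1
  refine Prod.ext ?_ (Prod.ext ?_ ?_)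
  · exact mvfderiv_comp_apply (g := fun y ↦ (t y).1) p (ht.fst.mdifferentiableAt (by simp)) hpr v
  · exact mvfderiv_comp_apply (g := fun y ↦ (t y).2.1) p (ht.snd.mdifferentiableAt (by simp)) hpr v
  · exact covAlong_comp B.nabla hpr ht.vec v

/-- The components of a lift are functions and fields pulled back from `N`, so their derivatives are
derivatives on `N`. All later computations with the cone connection pass through this reduction. -/
theorem cone_lift_lift (s : Π y : N, Triple J y) {t : Π y : N, Triple J y} {p : P}
    (ht : SmoothTripleAt t (S.pr p)) :
    S.cone (S.lift t) p (S.lift s p) = S.lift (B.cov s t) p := by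
  refine (S.toTriple p).injective ?_
  rw [toTriple_cone_lift S ht, toTriple_lift, toTriple_lift, mfderiv_lift]
  rfl

end ConeFibration

end Base

/-! ### Criteria for a connection to preserve a form, for closedness and for smoothness -/

section General

variable {E : Type*} [NormedAddCommGroup E] [NormedSpace ℝ E] [FiniteDimensional ℝ E]
  [CompleteSpace E] {H : Type*} [TopologicalSpace H] {I : ModelWithCorners ℝ E H}
  {M : Type*} [TopologicalSpace M] [ChartedSpace H M] [IsManifold I ∞ M]
  {D : AffineConnection I M} {Ω : Π x : M, TangentSpace I x →L[ℝ] TangentSpace I x →L[ℝ] ℝ}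

/-- The defect `v(Ω(X, Y)) - Ω(∇_vX, Y) - Ω(X, ∇_vY)` is tensorial in `X` and `Y`, so one pair of
extensions of each pair of vectors decides it. -/
theorem preserves_of_pointwise
    (hΩ : ∀ x (X Y : Π x : M, TangentSpace I x), MDiffAt (T% X) x → MDiffAt (T% Y) x →
      MDiffAt (fun y ↦ Ω y (X y) (Y y)) x)
    (h : ∀ x (u w v : TangentSpace I x), ∃ X Y : Π x : M, TangentSpace I x, MDiffAt (T% X) x ∧
      MDiffAt (T% Y) x ∧ X x = u ∧ Y x = w ∧
      mvfderiv I (fun y ↦ Ω y (X y) (Y y)) x v = Ω x (D X x v) (Y x) + Ω x (X x) (D Y x v)) :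
    Preserves D Ω := by
  intro x X Y hX hY v
  let Φ (X Y : Π x : M, TangentSpace I x) : ℝ :=
    mvfderiv I (fun y ↦ Ω y (X y) (Y y)) x v - Ω x (D X x v) (Y x) - Ω x (X x) (D Y x v)
  have h1 (Y : Π x : M, TangentSpace I x) (hY : MDiffAt (T% Y) x) : TensorialAt I E (Φ · Y) x :=
    { smul := fun {g X} hg hX ↦ by
        have h1 : mvfderiv I (fun y ↦ Ω y ((g • X) y) (Y y)) x
            = g x • mvfderiv I (fun y ↦ Ω y (X y) (Y y)) x + Ω x (X x) (Y x) • mvfderiv I g x := by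
          rw [← mvfderiv_mul hg (hΩ x X Y hX hY)]
          congr 1
          ext y
          simp
        simp only [Φ, h1, cov_smul D hg hX]
        simp
        ring
      add := fun {X X'} hX hX' ↦ by
        have h1 : mvfderiv I (fun y ↦ Ω y ((X + X') y) (Y y)) x
            = mvfderiv I (fun y ↦ Ω y (X y) (Y y)) x
              + mvfderiv I (fun y ↦ Ω y (X' y) (Y y)) x := by
          rw [← mvfderiv_add (hΩ x X Y hX hY) (hΩ x X' Y hX' hY)]
          congr 1
          ext y
          simp
        simp only [Φ, h1, cov_add D hX hX']
        simp
        ring }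
  have h2 (X : Π x : M, TangentSpace I x) (hX : MDiffAt (T% X) x) : TensorialAt I E (Φ X ·) x :=
    { smul := fun {g Y} hg hY ↦ by
        have h1 : mvfderiv I (fun y ↦ Ω y (X y) ((g • Y) y)) x
            = g x • mvfderiv I (fun y ↦ Ω y (X y) (Y y)) x + Ω x (X x) (Y x) • mvfderiv I g x := by
          rw [← mvfderiv_mul hg (hΩ x X Y hX hY)]
          congr 1
          ext y
          simp
        simp only [Φ, h1, cov_smul D hg hY]
        simp
        ring
      add := fun {Y Y'} hY hY' ↦ by
        have h1 : mvfderiv I (fun y ↦ Ω y (X y) ((Y + Y') y)) x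
            = mvfderiv I (fun y ↦ Ω y (X y) (Y y)) x
              + mvfderiv I (fun y ↦ Ω y (X y) (Y' y)) x := by
          rw [← mvfderiv_add (hΩ x X Y hX hY) (hΩ x X Y' hX hY')]
          congr 1
          ext y
          simp
        simp only [Φ, h1, cov_add D hY hY']
        simp
        ring }
  obtain ⟨X', Y', hX', hY', hXX', hYY', h'⟩ := h x (X x) (Y x) v
  have h3 : Φ X Y = Φ X' Y' :=
    TensorialAt.pointwise₂ h1 h2 hX hX' hY hY' hXX'.symm hYY'.symm
  simp only [Φ, h'] at h3
  linarith

/-- Writing both derivatives of `Ω` and brackets through `D`, every term appears twice with opposite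
signs. -/
theorem closed_of_preserves (htor : D.torsion = 0) (hpr : Preserves D Ω)
    (halt : ∀ x u v, Ω x u v = -Ω x v u) {x : M} {X Y Z : Π x : M, TangentSpace I x}
    (hX : MDiffAt (T% X) x) (hY : MDiffAt (T% Y) x) (hZ : MDiffAt (T% Z) x) :
    mvfderiv I (fun y ↦ Ω y (Y y) (Z y)) x (X x)
        - mvfderiv I (fun y ↦ Ω y (X y) (Z y)) x (Y x)
        + mvfderiv I (fun y ↦ Ω y (X y) (Y y)) x (Z x)
        - Ω x (mlieBracket I X Y x) (Z x) + Ω x (mlieBracket I X Z x) (Y x)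
        - Ω x (mlieBracket I Y Z x) (X x) = 0 := by
  have : IsManifold I 2 M := .of_le (n := ∞) two_le_infty
  have tor {V W : Π x : M, TangentSpace I x} (hV : MDiffAt (T% V) x) (hW : MDiffAt (T% W) x) :
      D W x (V x) - D V x (W x) = mlieBracket I V W x := D.torsion_eq_zero_iff.1 htor hV hW
  rw [hpr x _ _ hY hZ, hpr x _ _ hX hZ, hpr x _ _ hX hY, ← tor hX hY, ← tor hX hZ, ← tor hY hZ]
  simp only [map_sub, sub_apply]
  rw [halt x (Y x), halt x (X x) (D Z x (Y x)), halt x (X x) (D Y x (Z x))]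
  ring

theorem contMDiffCovariantDerivative_of_apply
    (h : ∀ x (V W : Π x : M, TangentSpace I x), CMDiffAt ∞ (T% V) x → CMDiffAt ∞ (T% W) x →
      CMDiffAt ∞ (T% (fun y ↦ D W y (V y))) x) : D.ContMDiffCovariantDerivative ∞ where
  contMDiff :=
    { contMDiff := fun {W} hW ↦ by
        refine contMDiffOn_univ.2 fun x ↦ contMDiffAt_hom_of_apply fun V hV ↦ h x V W hV ?_
        exact (contMDiffOn_univ.1 hW x).of_le (by simp) }

end General

theorem mvfderiv_comp_mfderiv {E : Type*} [NormedAddCommGroup E] [NormedSpace ℝ E]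
    {H : Type*} [TopologicalSpace H] {I : ModelWithCorners ℝ E H}
    {P : Type*} [TopologicalSpace P] [ChartedSpace H P]
    {F : Type*} [NormedAddCommGroup F] [NormedSpace ℝ F]
    {G : Type*} [TopologicalSpace G] {J : ModelWithCorners ℝ F G}
    {N : Type*} [TopologicalSpace N] [ChartedSpace G N]
    {A : Type*} [NormedAddCommGroup A] [NormedSpace ℝ A] {g : N → A} {pr : P → N} (p : P)
    (hg : MDiffAt g (pr p)) (hpr : MDifferentiableAt I J pr p) (v : TangentSpace I p) :
    mvfderiv I (g ∘ pr) p v = mvfderiv J g (pr p) (mfderiv I J pr p v) :=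
  mfderiv_comp_apply p hg hpr v

/-! ### Lifts span: smoothness, torsion and the symplectic form on the cone -/

section Base

variable {F : Type*} [NormedAddCommGroup F] [NormedSpace ℝ F] [FiniteDimensional ℝ F]
  [CompleteSpace F] {G : Type*} [TopologicalSpace G] {J : ModelWithCorners ℝ F G}
  {N : Type*} [TopologicalSpace N] [ChartedSpace G N] [IsManifold J ∞ N]
  {E : Type*} [NormedAddCommGroup E] [NormedSpace ℝ E] [FiniteDimensional ℝ E]
  [CompleteSpace E] {H : Type*} [TopologicalSpace H] {I : ModelWithCorners ℝ E H}
  {P : Type*} [TopologicalSpace P] [ChartedSpace H P] [IsManifold I ∞ P]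

/-- Brackets of related fields are related: test both sides on a chart of `N`, whose differential at
`pr p` is injective, and use `mvfderiv_mlieBracket` upstairs and downstairs. -/
theorem mfderiv_mlieBracket [I.Boundaryless] [J.Boundaryless] {pr : P → N}
    (hpr : ContMDiff I J ∞ pr) {V W : Π p : P, TangentSpace I p} {X Y : Π y : N, TangentSpace J y}
    {p : P} (hV : CMDiffAt ∞ (T% V) p) (hW : CMDiffAt ∞ (T% W) p)
    (hX : CMDiffAt ∞ (T% X) (pr p)) (hY : CMDiffAt ∞ (T% Y) (pr p))
    (hVX : ∀ᶠ p' in 𝓝 p, mfderiv I J pr p' (V p') = X (pr p'))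
    (hWY : ∀ᶠ p' in 𝓝 p, mfderiv I J pr p' (W p') = Y (pr p')) :
    mfderiv I J pr p (mlieBracket I V W p) = mlieBracket J X Y (pr p) := by
  let g : N → F := extChartAt J (pr p)
  have hg : CMDiffAt ∞ g (pr p) := contMDiffAt_extChartAt
  have hpr' (p') : MDifferentiableAt I J pr p' := hpr.mdifferentiable (by simp) p'
  have hinj : Function.Injective (mvfderiv J g (pr p)) :=
    (isInvertible_mfderiv_extChartAt (I := J) (mem_extChartAt_source (pr p))).injective
  have key {V W : Π p : P, TangentSpace I p} {X Y : Π y : N, TangentSpace J y}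
      (hY : CMDiffAt ∞ (T% Y) (pr p))
      (hVX : ∀ᶠ p' in 𝓝 p, mfderiv I J pr p' (V p') = X (pr p'))
      (hWY : ∀ᶠ p' in 𝓝 p, mfderiv I J pr p' (W p') = Y (pr p')) :
      mvfderiv I (fun p' ↦ mvfderiv I (g ∘ pr) p' (W p')) p (V p)
        = mvfderiv J (fun y ↦ mvfderiv J g y (Y y)) (pr p) (X (pr p)) := by
    have h : ∀ᶠ p' in 𝓝 p, mvfderiv I (g ∘ pr) p' (W p') = mvfderiv J g (pr p') (Y (pr p')) := by
      filter_upwards [(hpr p).continuousAt.eventually hg.eventually_mdifferentiableAt, hWY]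
        with p' hp' hp''
      rw [mvfderiv_comp_mfderiv p' hp' (hpr' p'), hp'']
    rw [mvfderiv_congr h, ← hVX.self_of_nhds]
    exact mvfderiv_comp_mfderiv (g := fun y ↦ mvfderiv J g y (Y y)) p
      ((contMDiffAt_mvfderiv_apply hg hY).mdifferentiableAt (by simp)) (hpr' p) _
  apply hinj
  rw [mvfderiv_mlieBracket hg hX hY, ← key hY hVX hWY, ← key hX hWY hVX,
    ← mvfderiv_mlieBracket (ContMDiffAt.comp p hg (hpr p)) hV hW]
  exact (mvfderiv_comp_mfderiv p (hg.mdifferentiableAt (by simp)) (hpr' p) _).symm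

/-- A smooth local extension of a triple, with constant scalar components. -/
def extendTriple {y : N} (w : Triple J y) (y' : N) : Triple J y' :=
  (w.1, w.2.1, FiberBundle.extend F w.2.2 y')

theorem extendTriple_self {y : N} (w : Triple J y) : extendTriple w y = w := by
  simp [extendTriple]

theorem smoothTripleAt_extendTriple {y : N} (w : Triple J y) :
    SmoothTripleAt (extendTriple w) y :=
  ⟨contMDiffAt_const, contMDiffAt_const, contMDiffAt_extend _⟩

theorem eventually_eq_sum_frameCoeff_apply (x₀ : N) :
    ∀ᶠ y in 𝓝 x₀, ∀ v : TangentSpace J y,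
      v = ∑ i, frameCoeff J x₀ i y v • coordFrame J x₀ i y := by
  set e := trivializationAt F (TangentSpace J) x₀
  filter_upwards [e.open_baseSet.mem_nhds (mem_baseSet_trivializationAt F (TangentSpace J) x₀)]
    with y hy v
  have h := e.eq_sum_localFrameCoeff_smul (I := J) (b := Module.finBasis ℝ F)
    (s := FiberBundle.extend F v) hy
  simp only [FiberBundle.extend_apply_self] at h
  exact h

variable (J) in
/-- A frame of fields of triples near `x₀`. -/
def tripleFrame (x₀ : N) : Unit ⊕ Unit ⊕ Fin (Module.finrank ℝ F) → Π y : N, Triple J y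
  | .inl _, _ => (1, 0, 0)
  | .inr (.inl _), _ => (0, 1, 0)
  | .inr (.inr i), y => (0, 0, coordFrame J x₀ i y)

theorem contMDiffAt_zero (x : N) : CMDiffAt ∞ (T% (fun y : N ↦ (0 : TangentSpace J y))) x :=
  contMDiff_zeroSection ℝ (TangentSpace J : N → Type _) x

theorem smoothTripleAt_tripleFrame (x₀ : N) (i) : SmoothTripleAt (tripleFrame J x₀ i) x₀ := by
  rcases i with _ | _ | i
  · exact ⟨contMDiffAt_const, contMDiffAt_const, contMDiffAt_zero x₀⟩
  · exact ⟨contMDiffAt_const, contMDiffAt_const, contMDiffAt_zero x₀⟩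
  · exact ⟨contMDiffAt_const, contMDiffAt_const, contMDiffAt_coordFrame x₀ i⟩

theorem eventually_smoothTripleAt_tripleFrame (x₀ : N) (i) :
    ∀ᶠ y in 𝓝 x₀, SmoothTripleAt (tripleFrame J x₀ i) y := by
  rcases i with _ | _ | i
  · exact .of_forall fun x ↦ ⟨contMDiffAt_const, contMDiffAt_const, contMDiffAt_zero x⟩
  · exact .of_forall fun x ↦ ⟨contMDiffAt_const, contMDiffAt_const, contMDiffAt_zero x⟩
  · exact (eventually_contMDiffAt_coordFrame x₀ i).mono
      fun x h ↦ ⟨contMDiffAt_const, contMDiffAt_const, h⟩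

variable (J) in
/-- The coefficients of a triple in `tripleFrame`. -/
def tripleCoeff (x₀ : N) (y : N) : Unit ⊕ Unit ⊕ Fin (Module.finrank ℝ F) → Triple J y →ₗ[ℝ] ℝ
  | .inl _ => LinearMap.fst ℝ _ _
  | .inr (.inl _) => LinearMap.fst ℝ _ _ ∘ₗ LinearMap.snd ℝ _ _
  | .inr (.inr i) => frameCoeff J x₀ i y ∘ₗ LinearMap.snd ℝ _ _ ∘ₗ LinearMap.snd ℝ _ _

theorem contMDiffAt_tripleCoeff {s : Π y : N, Triple J y} {x₀ : N} (hs : SmoothTripleAt s x₀) (i) :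
    CMDiffAt ∞ (fun y ↦ tripleCoeff J x₀ y i (s y)) x₀ := by
  rcases i with _ | _ | i
  · exact hs.fst
  · exact hs.snd
  · exact contMDiffAt_frameCoeff hs.vec i

theorem eventually_eq_sum_tripleCoeff (x₀ : N) : ∀ᶠ y in 𝓝 x₀, ∀ w : Triple J y,
    w = ∑ i, tripleCoeff J x₀ y i w • tripleFrame J x₀ i y := by
  filter_upwards [eventually_eq_sum_frameCoeff_apply (J := J) x₀] with y hy w
  simp only [Fintype.sum_sum_type, tripleCoeff, tripleFrame, Finset.univ_unique,
    Finset.sum_singleton]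
  refine Prod.ext ?_ (Prod.ext ?_ ?_)
  · simp [Prod.fst_sum]
  · simp [Prod.fst_sum, Prod.snd_sum]
  · simp only [Prod.snd_add, Prod.snd_sum, Prod.smul_snd, smul_zero, zero_add]
    exact hy w.2.2

namespace ConeFibration

variable {B : ConeBase J N} (S : ConeFibration I P B)

theorem contMDiffAt_coeff {V : Π p : P, TangentSpace I p} {p : P} (hV : CMDiffAt ∞ (T% V) p) (i) :
    CMDiffAt ∞ (fun p' ↦ tripleCoeff J (S.pr p) (S.pr p') i (S.toTriple p' (V p'))) p := by
  rcases i with _ | _ | i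
  · exact contMDiffAt_mvfderiv_apply (S.smooth_q p) hV
  · exact S.b.contMDiffAt_apply hV
  · exact contMDiffAt_frameCoeff_along (contMDiffAt_mfderiv_along S.smooth_pr hV) i

theorem contMDiffAt_lift {s : Π y : N, Triple J y} {p : P} (hs : SmoothTripleAt s (S.pr p)) :
    CMDiffAt ∞ (T% (S.lift s)) p := by
  refine contMDiffAt_of_covectors
    (l := fun i p' ↦ tripleCoeff J (S.pr p) (S.pr p') i ∘ₗ (S.toTriple p').toLinearMap)
    (fun i Y hY ↦ S.contMDiffAt_coeff hY i) (fun v hv ↦ ?_) fun i ↦ ?_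
  · refine (S.toTriple p).injective ?_
    rw [(eventually_eq_sum_tripleCoeff (J := J) (S.pr p)).self_of_nhds (S.toTriple p v), map_zero]
    refine Finset.sum_eq_zero fun i _ ↦ ?_
    have h : tripleCoeff J (S.pr p) (S.pr p) i (S.toTriple p v) = 0 := hv i
    rw [h, zero_smul]
  · have h (p' : P) : (tripleCoeff J (S.pr p) (S.pr p') i ∘ₗ (S.toTriple p').toLinearMap)
        (S.lift s p') = tripleCoeff J (S.pr p) (S.pr p') i (s (S.pr p')) :=
      congrArg _ (S.toTriple_lift s p')
    simp only [h]
    exact ContMDiffAt.comp p (contMDiffAt_tripleCoeff hs i) (S.smooth_pr p)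

theorem mdifferentiableAt_lift {s : Π y : N, Triple J y} {p : P}
    (hs : SmoothTripleAt s (S.pr p)) : MDiffAt (T% (S.lift s)) p :=
  (S.contMDiffAt_lift hs).mdifferentiableAt (by simp)

/-- Every tangent vector is thus the value of a lift with constant scalar components, so tensors on
the cone are determined by their values on such lifts. -/
theorem lift_extendTriple {p : P} (u : TangentSpace I p) :
    S.lift (extendTriple (S.toTriple p u)) p = u := by
  rw [lift, extendTriple_self, LinearEquiv.symm_apply_apply]

theorem eventually_eq_sum_lift (p : P) : ∀ᶠ p' in 𝓝 p, ∀ v : TangentSpace I p',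
    v = ∑ i, tripleCoeff J (S.pr p) (S.pr p') i (S.toTriple p' v) •
      S.lift (tripleFrame J (S.pr p) i) p' := by
  filter_upwards [(S.smooth_pr p).continuousAt.eventually
    (eventually_eq_sum_tripleCoeff (J := J) (S.pr p))] with p' hp' v
  refine (S.toTriple p').injective ?_
  rw [map_sum]
  simp only [map_smul, toTriple_lift]
  exact hp' _

theorem contMDiffAt_cone_lift [T2Space N] {t : Π y : N, Triple J y} {p : P}
    (ht : ∀ᶠ y in 𝓝 (S.pr p), SmoothTripleAt t y) {V : Π p : P, TangentSpace I p}
    (hV : CMDiffAt ∞ (T% V) p) : CMDiffAt ∞ (T% (fun p' ↦ S.cone (S.lift t) p' (V p'))) p := by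
  let s := tripleFrame J (S.pr p)
  have h : CMDiffAt ∞ (T% (fun p' ↦ ∑ i, ((fun p' ↦ tripleCoeff J (S.pr p) (S.pr p') i
      (S.toTriple p' (V p'))) • S.lift (B.cov (s i) t)) p')) p :=
    ContMDiffAt.sum_section fun i _ ↦ (S.contMDiffAt_coeff hV i).smul_section
      (S.contMDiffAt_lift (B.smoothTripleAt_cov (smoothTripleAt_tripleFrame _ i)
        ht.self_of_nhds))
  refine h.congr_of_eventuallyEq ?_
  filter_upwards [S.eventually_eq_sum_lift p, (S.smooth_pr p).continuousAt.eventually ht]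
    with p' hp' hp2
  refine congrArg (TotalSpace.mk' E p') ?_
  have h2 := congrArg (S.cone (S.lift t) p') (hp' (V p'))
  refine h2.trans ?_
  rw [map_sum]
  refine Finset.sum_congr rfl fun i _ ↦ ?_
  rw [map_smul, S.cone_lift_lift _ hp2]
  rfl

/-- The fields lifted from a frame of triples form a frame on the cone. Expanding `W` in it and
using the Leibniz rule reduces to `contMDiffAt_cone_lift`, where `V` is expanded in the same way. -/
theorem contMDiffAt_cone_apply [T2Space N] {V W : Π p : P, TangentSpace I p} {p : P}
    (hV : CMDiffAt ∞ (T% V) p) (hW : CMDiffAt ∞ (T% W) p) :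
    CMDiffAt ∞ (T% (fun p' ↦ S.cone W p' (V p'))) p := by
  let g (i : Unit ⊕ Unit ⊕ Fin (Module.finrank ℝ F)) (p' : P) : ℝ :=
    tripleCoeff J (S.pr p) (S.pr p') i (S.toTriple p' (W p'))
  let L (i : Unit ⊕ Unit ⊕ Fin (Module.finrank ℝ F)) := S.lift (tripleFrame J (S.pr p) i)
  have hg (i) : CMDiffAt ∞ (g i) p := S.contMDiffAt_coeff hW i
  have hL (i) : CMDiffAt ∞ (T% (L i)) p := S.contMDiffAt_lift (smoothTripleAt_tripleFrame _ i)
  let T (i : Unit ⊕ Unit ⊕ Fin (Module.finrank ℝ F)) : Π p : P, TangentSpace I p := g i • L i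
  have hWT : ∀ᶠ p' in 𝓝 p, W p' = ∑ i, T i p' :=
    (S.eventually_eq_sum_lift p).mono fun p' hp' ↦ hp' (W p')
  have h : CMDiffAt ∞ (T% (fun p' ↦ ∑ i, (g i • (fun p' ↦ S.cone (L i) p' (V p'))
      + (fun p' ↦ mvfderiv I (g i) p' (V p')) • L i) p')) p :=
    ContMDiffAt.sum_section fun i _ ↦ ((hg i).smul_section (S.contMDiffAt_cone_lift
      (eventually_smoothTripleAt_tripleFrame _ i) hV)).add_section
      ((contMDiffAt_mvfderiv_apply (hg i) hV).smul_section (hL i))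
  refine h.congr_of_eventuallyEq ?_
  filter_upwards [hWT.eventually_nhds, eventually_mdifferentiableAt_section hW,
    eventually_all.2 fun i ↦ (hg i).eventually_mdifferentiableAt,
    eventually_all.2 fun i ↦ eventually_mdifferentiableAt_section (hL i)] with p' h1 h2 h3 h4
  have h5 : S.cone W p' (V p') = ∑ i, S.cone (T i) p' (V p') := by
    rw [cov_congr S.cone h2 h1, cov_sum S.cone _ fun i ↦ (h3 i).smul_section (h4 i), sum_apply]
  refine congrArg (TotalSpace.mk' E p') (h5.trans (Finset.sum_congr rfl fun i _ ↦ ?_))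
  exact cov_smul S.cone (h3 i) (h4 i) (V p')

theorem smooth_cone [T2Space N] : S.cone.ContMDiffCovariantDerivative ∞ :=
  contMDiffCovariantDerivative_of_apply fun _ _ _ hV hW ↦ S.contMDiffAt_cone_apply hV hW

theorem mfderiv_mlieBracket_lift [I.Boundaryless] [J.Boundaryless] {s t : Π y : N, Triple J y}
    {p : P} (hs : SmoothTripleAt s (S.pr p)) (ht : SmoothTripleAt t (S.pr p)) :
    mfderiv I J S.pr p (mlieBracket I (S.lift s) (S.lift t) p)
      = mlieBracket J (fun y ↦ (s y).2.2) (fun y ↦ (t y).2.2) (S.pr p) :=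
  mfderiv_mlieBracket S.smooth_pr (S.contMDiffAt_lift hs) (S.contMDiffAt_lift ht) hs.vec ht.vec
    (.of_forall (S.mfderiv_lift s)) (.of_forall (S.mfderiv_lift t))

/-- Compare the three components of `∇_sT - ∇_tS` and `[s, t]` on lifts. The radial one uses that
`ν(X, σY)` is symmetric, the Reeb one is the structure equation, and the last one is the vanishing
torsion on `N`. -/
theorem torsion_cone [I.Boundaryless] [J.Boundaryless] : S.cone.torsion = 0 := by
  have : IsManifold I 2 P := .of_le (n := ∞) two_le_infty
  funext p
  refine ContinuousLinearMap.ext fun u ↦ ContinuousLinearMap.ext fun v ↦ ?_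
  rw [← S.lift_extendTriple u, ← S.lift_extendTriple v]
  set s := extendTriple (S.toTriple p u)
  set t := extendTriple (S.toTriple p v)
  have hs : SmoothTripleAt s (S.pr p) := smoothTripleAt_extendTriple _
  have ht : SmoothTripleAt t (S.pr p) := smoothTripleAt_extendTriple _
  rw [S.cone.torsion_apply (S.mdifferentiableAt_lift hs) (S.mdifferentiableAt_lift ht)]
  refine sub_eq_zero.2 ((S.toTriple p).injective ?_)
  rw [map_sub, S.cone_lift_lift s ht, S.cone_lift_lift t hs, toTriple_lift, toTriple_lift,
    toTriple_apply, mfderiv_mlieBracket_lift S hs ht]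
  have hq := mvfderiv_mlieBracket (S.smooth_q p) (S.contMDiffAt_lift hs) (S.contMDiffAt_lift ht)
  have hb := S.structure_eq p _ _ (S.contMDiffAt_lift hs) (S.contMDiffAt_lift ht)
  have hpr : MDifferentiableAt I J S.pr p := S.smooth_pr.mdifferentiable (by simp) p
  have h1 {s t : Π y : N, Triple J y} (ht : SmoothTripleAt t (S.pr p)) :
      mvfderiv I (fun p ↦ (t (S.pr p)).1) p (S.lift s p)
        = mvfderiv J (fun y ↦ (t y).1) (S.pr p) (s (S.pr p)).2.2 := by
    rw [← mfderiv_lift]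
    exact mvfderiv_comp_apply (g := fun y ↦ (t y).1) p (ht.fst.mdifferentiableAt (by simp)) hpr _
  have h2 {s t : Π y : N, Triple J y} (ht : SmoothTripleAt t (S.pr p)) :
      mvfderiv I (fun p ↦ (t (S.pr p)).2.1) p (S.lift s p)
        = mvfderiv J (fun y ↦ (t y).2.1) (S.pr p) (s (S.pr p)).2.2 := by
    rw [← mfderiv_lift]
    exact mvfderiv_comp_apply (g := fun y ↦ (t y).2.1) p (ht.snd.mdifferentiableAt (by simp)) hpr _
  simp only [dq_lift, b_lift, mfderiv_lift, h1 hs, h1 ht, h2 hs, h2 ht] at hq hb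
  have hN := B.nabla.torsion_eq_zero_iff.1 B.torsion_eq_zero
    (hs.vec.mdifferentiableAt (by simp)) (ht.vec.mdifferentiableAt (by simp))
  rw [hq, ← hN]
  have hσ := B.skew_σ (S.pr p) (s (S.pr p)).2.2 (t (S.pr p)).2.2
  have hσ2 := B.isSymplectic.swap (S.pr p) (B.σ _ (s (S.pr p)).2.2) (t (S.pr p)).2.2
  have hsw := B.isSymplectic.swap (S.pr p) (s (S.pr p)).2.2 (t (S.pr p)).2.2
  refine Prod.ext ?_ (Prod.ext ?_ ?_)
  · simp only [ConeBase.cov_apply, Prod.fst_sub]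
    linear_combination -hσ + hσ2
  · simp only [ConeBase.cov_apply, Prod.fst_sub, Prod.snd_sub]
    linear_combination hb + hsw
  · simp only [ConeBase.cov_apply, Prod.snd_sub]
    module

/-! ### The two-form on the cone is parallel, nondegenerate and closed -/

section Form

variable {Ω : Π p : P, TangentSpace I p →L[ℝ] TangentSpace I p →L[ℝ] ℝ}
  (hΩ : ∀ p u v, Ω p u v = Real.exp (2 * S.q p) * (B.ν (S.pr p) (mfderiv I J S.pr p u)
    (mfderiv I J S.pr p v) + (mvfderiv I S.q p u * S.b p v - S.b p u * mvfderiv I S.q p v)))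
include hΩ

theorem contMDiffAt_form {X Y : Π p : P, TangentSpace I p} {p : P} (hX : CMDiffAt ∞ (T% X) p)
    (hY : CMDiffAt ∞ (T% Y) p) : CMDiffAt ∞ (fun p ↦ Ω p (X p) (Y p)) p := by
  have h : ContMDiffAt I (J.prod 𝓘(ℝ, ℝ)) ∞ (fun p ↦ TotalSpace.mk' ℝ (E := Bundle.Trivial N ℝ)
      (S.pr p) (B.ν (S.pr p) (mfderiv I J S.pr p (X p)) (mfderiv I J S.pr p (Y p)))) p := by
    apply ContMDiffAt.clm_bundle_apply₂ (F₁ := F) (F₂ := F)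
    · exact (B.isSymplectic.smooth (S.pr p)).comp p (S.smooth_pr p)
    · exact contMDiffAt_mfderiv_along S.smooth_pr hX
    · exact contMDiffAt_mfderiv_along S.smooth_pr hY
  have hν := (contMDiffAt_totalSpace.1 h).2
  have he : CMDiffAt ∞ (fun p ↦ Real.exp (2 * S.q p)) p :=
    Real.contDiff_exp.contMDiff.contMDiffAt.comp p (contMDiffAt_const.mul (S.smooth_q p))
  simp only [hΩ]
  exact he.mul (hν.add (((contMDiffAt_mvfderiv_apply (S.smooth_q p) hX).mul
    (S.b.contMDiffAt_apply hY)).sub ((S.b.contMDiffAt_apply hX).mul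
    (contMDiffAt_mvfderiv_apply (S.smooth_q p) hY))))

theorem smooth_form : ContMDiff I (I.prod 𝓘(ℝ, E →L[ℝ] E →L[ℝ] ℝ)) ∞
    (fun x ↦ TotalSpace.mk' (E →L[ℝ] E →L[ℝ] ℝ) x (Ω x)) := by
  intro p
  apply contMDiffAt_hom_of_apply (F₁ := E) (F₂ := E →L[ℝ] ℝ) (V₁ := (TangentSpace I : P → Type _))
    (V₂ := fun p : P ↦ TangentSpace I p →L[ℝ] Bundle.Trivial P ℝ p) (A := Ω)
  intro X hX
  apply contMDiffAt_hom_of_apply (F₁ := E) (F₂ := ℝ) (V₁ := (TangentSpace I : P → Type _))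
    (V₂ := Bundle.Trivial P ℝ) (A := fun p ↦ Ω p (X p))
  intro Y hY
  rw [contMDiffAt_totalSpace]
  exact ⟨contMDiffAt_id, S.contMDiffAt_form hΩ hX hY⟩

theorem mdifferentiableAt_form {X Y : Π p : P, TangentSpace I p} {p : P}
    (hX : MDiffAt (T% X) p) (hY : MDiffAt (T% Y) p) : MDiffAt (fun p ↦ Ω p (X p) (Y p)) p := by
  have h : MDifferentiableAt I (I.prod 𝓘(ℝ, ℝ))
      (fun p ↦ TotalSpace.mk' ℝ (E := Bundle.Trivial P ℝ) p (Ω p (X p) (Y p))) p := by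
    apply MDifferentiableAt.clm_bundle_apply₂ (F₁ := E) (F₂ := E)
    · exact (S.smooth_form hΩ).mdifferentiable (by simp) p
    · exact hX
    · exact hY
  exact ((mdifferentiableAt_totalSpace _ _).1 h).2

theorem form_swap (p : P) (u v : TangentSpace I p) : Ω p u v = -Ω p v u := by
  rw [hΩ, hΩ, B.isSymplectic.swap]
  ring

theorem preserves_form : Preserves S.cone Ω := by
  refine preserves_of_pointwise (fun p X Y ↦ S.mdifferentiableAt_form hΩ) fun p u w v ↦ ?_
  let s := extendTriple (S.toTriple p u)
  let t := extendTriple (S.toTriple p w)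
  have hs : SmoothTripleAt s (S.pr p) := smoothTripleAt_extendTriple _
  have ht : SmoothTripleAt t (S.pr p) := smoothTripleAt_extendTriple _
  refine ⟨S.lift s, S.lift t, S.mdifferentiableAt_lift hs, S.mdifferentiableAt_lift ht,
    S.lift_extendTriple u, S.lift_extendTriple w, ?_⟩
  have hpr : MDifferentiableAt I J S.pr p := S.smooth_pr.mdifferentiable (by simp) p
  let h (y : N) : ℝ := B.ν y (s y).2.2 (t y).2.2 + ((s y).1 * (t y).2.1 - (s y).2.1 * (t y).1)
  have md {g : N → ℝ} (hg : CMDiffAt ∞ g (S.pr p)) : MDiffAt g (S.pr p) :=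
    hg.mdifferentiableAt (by simp)
  have hν := B.isSymplectic.contMDiffAt_apply hs.vec ht.vec
  have hh : MDiffAt h (S.pr p) := md (hν.add ((hs.fst.mul ht.snd).sub (hs.snd.mul ht.fst)))
  -- The scalar components of the extensions are constant, so only the `ν`-term of `h` varies.
  have hdh (w : TangentSpace J (S.pr p)) : mvfderiv J h (S.pr p) w
      = mvfderiv J (fun y ↦ B.ν y (s y).2.2 (t y).2.2) (S.pr p) w := by
    have hc : h = (fun y ↦ B.ν y (s y).2.2 (t y).2.2)
        + fun _ ↦ (s (S.pr p)).1 * (t (S.pr p)).2.1 - (s (S.pr p)).2.1 * (t (S.pr p)).1 := rfl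
    rw [hc, mvfderiv_add (md hν) mdifferentiableAt_const, mvfderiv_const, add_zero]
  have hq : MDiffAt S.q p := (S.smooth_q p).mdifferentiableAt (by simp)
  have he : MDiffAt (fun p ↦ Real.exp (2 * S.q p)) p :=
    (Real.contDiff_exp.contMDiff.contMDiffAt.comp p (contMDiffAt_const.mul (S.smooth_q p)) :
      CMDiffAt ∞ (fun p ↦ Real.exp (2 * S.q p)) p).mdifferentiableAt (by simp)
  have hde : mvfderiv I (fun p ↦ Real.exp (2 * S.q p)) p v
      = Real.exp (2 * S.q p) * (2 * mvfderiv I S.q p v) := by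
    have h1 : HasDerivAt (fun r : ℝ ↦ Real.exp (2 * r)) (Real.exp (2 * S.q p) * (2 * 1)) (S.q p) :=
      ((hasDerivAt_id (S.q p)).const_mul 2).exp
    have h2 := mvfderiv_comp_apply (g := fun r : ℝ ↦ Real.exp (2 * r)) p
      h1.differentiableAt.mdifferentiableAt hq v
    have h3 : mvfderiv 𝓘(ℝ, ℝ) (fun r : ℝ ↦ Real.exp (2 * r)) (S.q p)
        = fderiv ℝ (fun r : ℝ ↦ Real.exp (2 * r)) (S.q p) := mfderiv_eq_fderiv
    have h4 (r : ℝ) : fderiv ℝ (fun r : ℝ ↦ Real.exp (2 * r)) (S.q p) r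
        = Real.exp (2 * S.q p) * (2 * r) := by
      rw [h1.hasFDerivAt.fderiv]
      simp
      ring
    exact h2.trans ((DFunLike.congr_fun h3 _).trans (h4 _))
  -- On lifts the form splits as `e^{2q}` times a function on `N`. The derivative of the exponential
  -- is what the radial terms of `mult` compensate.
  have hL : (fun p' ↦ Ω p' (S.lift s p') (S.lift t p'))
      = (fun p ↦ Real.exp (2 * S.q p)) * (h ∘ S.pr) := by
    ext p'
    simp only [hΩ, mfderiv_lift, b_lift, dq_lift, Pi.mul_apply, Function.comp_apply, h]
  have hdΩ := DFunLike.congr_fun (mvfderiv_mul he (hh.comp p hpr)) v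
  rw [← hL] at hdΩ
  simp only [add_apply, smul_apply, smul_eq_mul, Function.comp_apply] at hdΩ
  rw [mvfderiv_comp_apply p hh hpr, hdh, hde, B.preserves (S.pr p) _ _
    (hs.vec.mdifferentiableAt (by simp)) (ht.vec.mdifferentiableAt (by simp))] at hdΩ
  have hcs := S.toTriple_cone_lift hs v
  have hct := S.toTriple_cone_lift ht v
  have hconst (c : ℝ) (w : TangentSpace J (S.pr p)) :
      mvfderiv J (fun _ : N ↦ c) (S.pr p) w = 0 := by rw [mvfderiv_const]; rfl
  have hs1 := congrArg Prod.fst hcs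
  have hs2 := congrArg (fun t ↦ t.2.1) hcs
  have hs3 := congrArg (fun t ↦ t.2.2) hcs
  have ht1 := congrArg Prod.fst hct
  have ht2 := congrArg (fun t ↦ t.2.1) hct
  have ht3 := congrArg (fun t ↦ t.2.2) hct
  simp only [toTriple_apply, ConeBase.deriv_apply, ConeBase.mult_apply, Prod.fst_add,
    Prod.snd_add] at hs1 hs2 hs3 ht1 ht2 ht3
  have e1 (w) : mvfderiv J (fun y ↦ (s y).1) (S.pr p) w = 0 := hconst _ w
  have e2 (w) : mvfderiv J (fun y ↦ (s y).2.1) (S.pr p) w = 0 := hconst _ w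
  have e3 (w) : mvfderiv J (fun y ↦ (t y).1) (S.pr p) w = 0 := hconst _ w
  have e4 (w) : mvfderiv J (fun y ↦ (t y).2.1) (S.pr p) w = 0 := hconst _ w
  rw [hdΩ, hΩ, hΩ, hs1, hs2, hs3, ht1, ht2, ht3, e1, e2, e3, e4]
  simp only [dq_lift, b_lift, mfderiv_lift, map_add, map_sub, map_smul, add_apply, sub_apply,
    smul_apply, smul_eq_mul, h]
  have k (u w) := B.skew_σ (S.pr p) u w
  have sw (u w) := B.isSymplectic.swap (S.pr p) u w
  set V := mfderiv I J S.pr p v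
  set X := (s (S.pr p)).2.2
  set Y := (t (S.pr p)).2.2
  -- The remaining terms cancel by skewness of `σ` (the uses of `k`) and antisymmetry of `ν` (the
  -- uses of `sw`); those with `f` cancel by themselves.
  linear_combination (-Real.exp (2 * S.q p)) * (S.b p v * k X Y + (s (S.pr p)).2.1 * k V Y
    + (t (S.pr p)).2.1 * (k X V - sw (B.σ _ X) V) + (t (S.pr p)).1 * sw V X
    - S.b p v * (s (S.pr p)).2.1 * sw (B.U _) Y)

theorem isSymplecticForm_form [I.Boundaryless] [J.Boundaryless] : IsSymplecticForm Ω where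
  smooth := S.smooth_form hΩ
  alternating p u := by
    rw [hΩ, B.isSymplectic.alternating]
    ring
  nondegenerate p u hu := by
    have key (w : Triple J (S.pr p)) : B.ν (S.pr p) (mfderiv I J S.pr p u) w.2.2
        + (mvfderiv I S.q p u * w.2.1 - S.b p u * w.1) = 0 := by
      have h := hu ((S.toTriple p).symm w)
      have h1 := (S.toTriple p).apply_symm_apply w
      have h2 := congrArg Prod.fst h1
      have h3 := congrArg (fun t ↦ t.2.1) h1
      have h4 := congrArg (fun t ↦ t.2.2) h1
      simp only [toTriple_apply] at h2 h3 h4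
      rw [hΩ, h2, h3, h4] at h
      exact (mul_eq_zero.1 h).resolve_left (Real.exp_ne_zero _)
    refine (S.toTriple p).injective ?_
    rw [map_zero, toTriple_apply]
    refine Prod.ext ?_ (Prod.ext ?_ ?_)
    -- Pairing with the Reeb, radial and horizontal directions isolates the radial, Reeb and
    -- horizontal components of `u` in turn.
    · simpa using key (0, 1, 0)
    · simpa using key (1, 0, 0)
    · exact B.isSymplectic.nondegenerate _ _ fun v ↦ by simpa using key (0, 0, v)
  closed p X Y Z hX hY hZ :=
    closed_of_preserves S.torsion_cone (S.preserves_form hΩ) (S.form_swap hΩ) hX hY hZ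

end Form

end ConeFibration

end Base

/-- The identity of `U × V` is `inl ∘ fst + inr ∘ snd`; insert it after `A` and permute cyclically
under the trace. -/
theorem trace_prod {U V : Type*} [AddCommGroup U] [Module ℝ U] [FiniteDimensional ℝ U]
    [AddCommGroup V] [Module ℝ V] [FiniteDimensional ℝ V] (A : U × V →ₗ[ℝ] U × V) :
    LinearMap.trace ℝ (U × V) A
      = LinearMap.trace ℝ U (LinearMap.fst ℝ U V ∘ₗ A ∘ₗ LinearMap.inl ℝ U V)
        + LinearMap.trace ℝ V (LinearMap.snd ℝ U V ∘ₗ A ∘ₗ LinearMap.inr ℝ U V) := by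
  have h1 := LinearMap.trace_comp_comm' (A ∘ₗ LinearMap.inl ℝ U V) (LinearMap.fst ℝ U V)
  have h2 := LinearMap.trace_comp_comm' (A ∘ₗ LinearMap.inr ℝ U V) (LinearMap.snd ℝ U V)
  rw [h1, h2, ← map_add]
  congr 1
  ext <;> simp [Prod.mk_zero_zero]

theorem trace_real (A : ℝ →ₗ[ℝ] ℝ) : LinearMap.trace ℝ ℝ A = A 1 := by
  rw [LinearMap.trace_eq_matrix_trace ℝ (Module.Basis.singleton Unit ℝ)]
  simp [Matrix.trace, LinearMap.toMatrix_apply]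

theorem trace_triple {V : Type*} [AddCommGroup V] [Module ℝ V] [FiniteDimensional ℝ V]
    (A : ℝ × ℝ × V →ₗ[ℝ] ℝ × ℝ × V) : LinearMap.trace ℝ (ℝ × ℝ × V) A
      = (A (1, 0, 0)).1 + (A (0, 1, 0)).2.1 + LinearMap.trace ℝ V (LinearMap.snd ℝ ℝ V ∘ₗ
        LinearMap.snd ℝ ℝ (ℝ × V) ∘ₗ A ∘ₗ LinearMap.inr ℝ ℝ (ℝ × V) ∘ₗ LinearMap.inr ℝ ℝ V) := by
  rw [trace_prod, trace_prod, trace_real, trace_real, add_assoc]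
  rfl

/-! ### Curvature of the cone connection, computed on the base -/

section Base

variable {F : Type*} [NormedAddCommGroup F] [NormedSpace ℝ F] [FiniteDimensional ℝ F]
  [CompleteSpace F] {G : Type*} [TopologicalSpace G] {J : ModelWithCorners ℝ F G}
  {N : Type*} [TopologicalSpace N] [ChartedSpace G N] [IsManifold J ∞ N]

/-- The radial field of triples. -/
def radTriple (y : N) : Triple J y := (1, 0, 0)

/-- The Reeb field of triples. -/
def reebTriple (y : N) : Triple J y := (0, 1, 0)

/-- The field of horizontal triples given by a vector field. -/
def horTriple (X : Π y : N, TangentSpace J y) (y : N) : Triple J y := (0, 0, X y)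

theorem smoothTripleAt_radTriple (y : N) : SmoothTripleAt (radTriple (J := J)) y :=
  ⟨contMDiffAt_const, contMDiffAt_const, contMDiffAt_zero y⟩

theorem smoothTripleAt_reebTriple (y : N) : SmoothTripleAt (reebTriple (J := J)) y :=
  ⟨contMDiffAt_const, contMDiffAt_const, contMDiffAt_zero y⟩

theorem smoothTripleAt_horTriple {X : Π y : N, TangentSpace J y} {y : N}
    (hX : CMDiffAt ∞ (T% X) y) : SmoothTripleAt (horTriple X) y :=
  ⟨contMDiffAt_const, contMDiffAt_const, hX⟩

theorem eventually_contMDiffAt_extend {y : N} (u : TangentSpace J y) :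
    ∀ᶠ y' in 𝓝 y, CMDiffAt ∞ (T% (FiberBundle.extend F u)) y' := by
  obtain ⟨s, hs, h⟩ := FiberBundle.exists_contMDiffOn_extend (k := ∞) J F u
  exact (eventually_mem_nhds_iff.2 hs).mono fun y' hy' ↦ h.contMDiffAt hy'

theorem eventually_smoothTripleAt_extendTriple {y : N} (w : Triple J y) :
    ∀ᶠ y' in 𝓝 y, SmoothTripleAt (extendTriple w) y' :=
  (eventually_contMDiffAt_extend w.2.2).mono
    fun _ h ↦ ⟨contMDiffAt_const, contMDiffAt_const, h⟩

namespace ConeBase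

variable (B : ConeBase J N)

theorem nabla_zero (y : N) : B.nabla (fun y ↦ (0 : TangentSpace J y)) y = 0 :=
  B.nabla.isCovariantDerivativeOnUniv.zero

theorem mvfderiv_const_apply (c : ℝ) (y : N) (w : TangentSpace J y) :
    mvfderiv J (fun _ ↦ c) y w = 0 := by
  rw [mvfderiv_const]
  rfl

theorem cov_hor_hor (X Y : Π y : N, TangentSpace J y) : B.cov (horTriple X) (horTriple Y)
    = fun y ↦ (-B.ν y (X y) (B.σ y (Y y)), -B.ν y (X y) (Y y), B.nabla Y y (X y)) := by
  ext y : 1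
  simp only [cov_apply, horTriple, mvfderiv_const_apply]
  refine Prod.ext ?_ (Prod.ext ?_ ?_)
  · simp
  · simp
  · simp only
    module

theorem cov_hor_reeb (X : Π y : N, TangentSpace J y) : B.cov (horTriple X) reebTriple
    = fun y ↦ (B.ν y (X y) (B.U y), 0, B.σ y (X y)) := by
  ext y : 1
  simp only [cov_apply, horTriple, reebTriple, mvfderiv_const_apply, nabla_zero]
  refine Prod.ext ?_ (Prod.ext ?_ ?_)
  · simp
  · simp
  · simp

theorem cov_reeb_hor (X : Π y : N, TangentSpace J y) : B.cov reebTriple (horTriple X)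
    = fun y ↦ (B.ν y (X y) (B.U y), 0, B.σ y (X y)) := by
  ext y : 1
  simp only [cov_apply, horTriple, reebTriple, map_zero]
  refine Prod.ext ?_ (Prod.ext ?_ ?_)
  · simp
  · simp
  · simp

theorem cov_reeb_reeb : B.cov reebTriple reebTriple = fun y ↦ (B.f y, 0, -B.U y) := by
  ext y : 1
  simp only [cov_apply, reebTriple, map_zero]
  refine Prod.ext ?_ (Prod.ext ?_ ?_)
  · simp
  · simp
  · simp

theorem cov_rad_left (t : Π y : N, Triple J y) : B.cov radTriple t = t := by
  ext y : 1
  simp only [cov_apply, radTriple, map_zero]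
  refine Prod.ext ?_ (Prod.ext ?_ ?_)
  · simp
  · simp
  · simp

theorem cov_rad_right (s : Π y : N, Triple J y) : B.cov s radTriple = s := by
  ext y : 1
  simp only [cov_apply, radTriple, mvfderiv_const_apply, nabla_zero, map_zero]
  refine Prod.ext ?_ (Prod.ext ?_ ?_)
  · simp
  · simp
  · simp

/-- The curvature of the cone connection on fields of triples. -/
def curv (s t r : Π y : N, Triple J y) (y : N) : Triple J y :=
  B.cov s (B.cov t r) y - B.cov t (B.cov s r) y
    - (B.cov (B.cov s t) r y - B.cov (B.cov t s) r y)

/-- Formal: the radial field acts as the identity in either slot of `cov`, so all four terms equal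
`cov t r` and cancel in pairs. -/
theorem curv_rad_left (t r : Π y : N, Triple J y) (y : N) : B.curv radTriple t r y = 0 := by
  simp only [curv, cov_rad_left, cov_rad_right, sub_self]

theorem curv_rad_right (s t : Π y : N, Triple J y) (y : N) : B.curv s t radTriple y = 0 := by
  simp only [curv, cov_rad_right, sub_self]

/-- The corrections to the base curvature come from the radial and Reeb parts of `∇_Y Z` and `∇_X
Z`. The last term comes from the Reeb part `-2ν(X, Y)` of the bracket of the two horizontal fields.
-/
theorem curv_hor_hor_hor [T2Space N] [J.Boundaryless] {X Y Z : Π y : N, TangentSpace J y} {y : N}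
    (hX : CMDiffAt ∞ (T% X) y) (hY : CMDiffAt ∞ (T% Y) y) (hZ : CMDiffAt ∞ (T% Z) y) :
    (B.curv (horTriple X) (horTriple Y) (horTriple Z) y).2.2
      = curvature B.nabla y (X y) (Y y) (Z y) - B.ν y (Y y) (Z y) • B.σ y (X y)
        + B.ν y (X y) (Z y) • B.σ y (Y y) - B.ν y (Y y) (B.σ y (Z y)) • X y
        + B.ν y (X y) (B.σ y (Z y)) • Y y + (2 * B.ν y (X y) (Y y)) • B.σ y (Z y) := by
  have hN := B.nabla.torsion_eq_zero_iff.1 B.torsion_eq_zero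
    (hX.mdifferentiableAt (by simp)) (hY.mdifferentiableAt (by simp))
  rw [curvature_apply B.smooth hX hY hZ, curvatureField, ← hN]
  simp only [curv, cov_hor_hor, cov_apply, horTriple, Prod.snd_sub, map_sub]
  have h1 : B.ν y (Y y) (B.σ y (X y)) = B.ν y (X y) (B.σ y (Y y)) := by
    linear_combination (B.isSymplectic.swap y (Y y) (B.σ y (X y))) - B.skew_σ y (X y) (Y y)
  have h2 := B.isSymplectic.swap y (Y y) (X y)
  rw [h1, h2]
  module

/-- Both iterated derivatives have Reeb component `-ν(Y, σZ)`, and the Reeb and horizontal fields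
commute. This is the Reeb diagonal entry of a Ricci trace. -/
theorem curv_reeb_hor_hor (Y Z : Π y : N, TangentSpace J y) (y : N) :
    (B.curv reebTriple (horTriple Y) (horTriple Z) y).2.1 = 0 := by
  simp only [curv, cov_hor_hor, cov_hor_reeb, cov_reeb_hor]
  simp only [cov_apply, horTriple, reebTriple, Prod.snd_sub, Prod.fst_sub, map_zero,
    mvfderiv_const_apply, sub_self]
  simp

theorem curv_hor_hor_reeb {X Y : Π y : N, TangentSpace J y} {y : N}
    (hX : CMDiffAt ∞ (T% X) y) (hY : CMDiffAt ∞ (T% Y) y) :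
    (B.curv (horTriple X) (horTriple Y) reebTriple y).2.2
      = covEndo B.nabla B.σ y (Y y) (X y) - covEndo B.nabla B.σ y (X y) (Y y)
        + B.ν y (Y y) (B.U y) • X y - B.ν y (X y) (B.U y) • Y y
        - (2 * B.ν y (X y) (Y y)) • B.U y := by
  simp only [curv, cov_hor_hor, cov_hor_reeb]
  rw [covEndo_apply (B.smooth_σ y) hX, covEndo_apply (B.smooth_σ y) hY]
  simp only [cov_apply, horTriple, reebTriple, Prod.snd_sub, nabla_zero]
  rw [B.isSymplectic.swap y (Y y) (X y)]
  simp only [map_zero, zero_apply]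
  module

/-- Both iterated derivatives have Reeb component `ν(Y, U)`; again a diagonal entry of a Ricci
trace. -/
theorem curv_reeb_hor_reeb (Y : Π y : N, TangentSpace J y) (y : N) :
    (B.curv reebTriple (horTriple Y) reebTriple y).2.1 = 0 := by
  simp only [curv, cov_hor_reeb, cov_reeb_hor, cov_reeb_reeb]
  simp only [cov_apply, horTriple, reebTriple, Prod.snd_sub, Prod.fst_sub, map_zero,
    mvfderiv_const_apply, sub_self]
  simp

theorem curv_hor_reeb_reeb (X : Π y : N, TangentSpace J y) (y : N) :
    (B.curv (horTriple X) reebTriple reebTriple y).2.2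
      = B.f y • X y - B.nabla B.U y (X y) - B.σ y (B.σ y (X y)) := by
  have h : B.nabla (fun y ↦ -B.U y) y (X y) = -B.nabla B.U y (X y) := by
    have h1 : MDiffAt (fun _ : N ↦ (-1 : ℝ)) y := mdifferentiableAt_const
    have h2 := cov_smul B.nabla h1 ((B.smooth_U y).mdifferentiableAt (by simp)) (X y)
    rw [mvfderiv_const_apply, zero_smul, add_zero, neg_one_smul] at h2
    rw [← h2]
    congr 2
    ext y : 1
    exact (neg_one_smul ℝ _).symm
  simp only [curv, cov_hor_reeb, cov_reeb_hor, cov_reeb_reeb]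
  simp only [cov_apply, horTriple, reebTriple, Prod.snd_sub, sub_self, map_zero, h,
    Prod.snd_zero]
  module

end ConeBase

variable {E : Type*} [NormedAddCommGroup E] [NormedSpace ℝ E] [FiniteDimensional ℝ E]
  [CompleteSpace E] {H : Type*} [TopologicalSpace H] {I : ModelWithCorners ℝ E H}
  {P : Type*} [TopologicalSpace P] [ChartedSpace H P] [IsManifold I ∞ P]

namespace ConeFibration

variable {B : ConeBase J N} (S : ConeFibration I P B)

/-- Vanishing torsion turns `∇_[s, t]` into the difference of derivatives along `∇_sT` and `∇_tS`,
so only `cone_lift_lift` is needed. The smoothness hypotheses hold near the point because the inner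
derivative must be a lift on a neighbourhood. -/
theorem toTriple_curvature [T2Space N] [T2Space P] [J.Boundaryless] [I.Boundaryless]
    {s t r : Π y : N, Triple J y} {p : P} (hs : ∀ᶠ y in 𝓝 (S.pr p), SmoothTripleAt s y)
    (ht : ∀ᶠ y in 𝓝 (S.pr p), SmoothTripleAt t y) (hr : ∀ᶠ y in 𝓝 (S.pr p), SmoothTripleAt r y) :
    S.toTriple p (curvature S.cone p (S.lift s p) (S.lift t p) (S.lift r p))
      = B.curv s t r (S.pr p) := by
  have : IsManifold I 2 P := .of_le (n := ∞) two_le_infty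
  have hs0 := S.contMDiffAt_lift hs.self_of_nhds
  have ht0 := S.contMDiffAt_lift ht.self_of_nhds
  have hr0 := S.contMDiffAt_lift hr.self_of_nhds
  have hcont : ContinuousAt S.pr p := (S.smooth_pr p).continuousAt
  have key {s t : Π y : N, Triple J y} (ht : SmoothTripleAt t (S.pr p))
      (hst : CMDiffAt ∞ (T% (S.lift t)) p) :
      S.toTriple p (S.cone (fun p' ↦ S.cone (S.lift r) p' (S.lift t p')) p (S.lift s p))
        = B.cov s (B.cov t r) (S.pr p) := by
    have h1 : ∀ᶠ p' in 𝓝 p, S.cone (S.lift r) p' (S.lift t p') = S.lift (B.cov t r) p' :=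
      (hcont.eventually hr).mono fun p' hp' ↦ S.cone_lift_lift t hp'
    rw [cov_congr S.cone ((S.contMDiffAt_cone_apply hst hr0).mdifferentiableAt (by simp)) h1,
      S.cone_lift_lift s (B.smoothTripleAt_cov ht hr.self_of_nhds), toTriple_lift]
  rw [curvature_apply S.smooth_cone hs0 ht0 hr0, curvatureField,
    ← S.cone.torsion_eq_zero_iff.1 S.torsion_cone (hs0.mdifferentiableAt (by simp))
      (ht0.mdifferentiableAt (by simp)), S.cone_lift_lift s ht.self_of_nhds,
    S.cone_lift_lift t hs.self_of_nhds, map_sub (S.cone (S.lift r) p),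
    S.cone_lift_lift _ hr.self_of_nhds, S.cone_lift_lift _ hr.self_of_nhds]
  simp only [map_sub, toTriple_lift, key ht.self_of_nhds ht0, key hs.self_of_nhds hs0]
  rfl

/-! ### Ricci-flatness -/

section Ricci

variable [T2Space N] [T2Space P] [J.Boundaryless] [I.Boundaryless]

theorem curvature_rad_left (p : P) (v w : TangentSpace I p) :
    curvature S.cone p (S.lift radTriple p) v w = 0 := by
  refine (S.toTriple p).injective ?_
  rw [← S.lift_extendTriple v, ← S.lift_extendTriple w, S.toTriple_curvature
    (.of_forall smoothTripleAt_radTriple) (eventually_smoothTripleAt_extendTriple _)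
    (eventually_smoothTripleAt_extendTriple _), B.curv_rad_left, map_zero]

theorem curvature_rad_right (p : P) (u v : TangentSpace I p) :
    curvature S.cone p u v (S.lift radTriple p) = 0 := by
  refine (S.toTriple p).injective ?_
  rw [← S.lift_extendTriple u, ← S.lift_extendTriple v, S.toTriple_curvature
    (eventually_smoothTripleAt_extendTriple _) (eventually_smoothTripleAt_extendTriple _)
    (.of_forall smoothTripleAt_radTriple), B.curv_rad_right, map_zero]

theorem ricci_rad_left (p : P) (w : TangentSpace I p) :
    ricci S.cone p (S.lift radTriple p) w = 0 := by
  refine Finset.sum_eq_zero fun i _ ↦ ?_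
  rw [curvature_swap S.smooth_cone, curvature_rad_left, neg_zero, map_zero]

theorem ricci_rad_right (p : P) (v : TangentSpace I p) :
    ricci S.cone p v (S.lift radTriple p) = 0 := by
  refine Finset.sum_eq_zero fun i _ ↦ ?_
  rw [curvature_rad_right, map_zero]

/-- Take the trace in the decomposition into triples: the radial entry vanishes since `R(Q, ·) = 0`,
the Reeb entry by `hreeb`, and the horizontal block is `K`. -/
theorem ricci_cone_eq {t r : Π y : N, Triple J y} {p : P}
    (ht : ∀ᶠ y in 𝓝 (S.pr p), SmoothTripleAt t y) (hr : ∀ᶠ y in 𝓝 (S.pr p), SmoothTripleAt r y)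
    (hreeb : (B.curv reebTriple t r (S.pr p)).2.1 = 0)
    (K : TangentSpace J (S.pr p) →ₗ[ℝ] TangentSpace J (S.pr p))
    (hK : ∀ X : Π y : N, TangentSpace J y, CMDiffAt ∞ (T% X) (S.pr p) →
      (B.curv (horTriple X) t r (S.pr p)).2.2 = K (X (S.pr p))) :
    ricci S.cone p (S.lift t p) (S.lift r p) = LinearMap.trace ℝ _ K := by
  set e := S.toTriple p
  set A := curvatureLeft S.smooth_cone p (S.lift t p) (S.lift r p)
  have hA {s : Π y : N, Triple J y} (hs : ∀ᶠ y in 𝓝 (S.pr p), SmoothTripleAt s y) :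
      e.conj A (s (S.pr p)) = B.curv s t r (S.pr p) := by
    rw [← S.toTriple_curvature hs ht hr]
    rfl
  rw [ricci_eq_trace S.smooth_cone, ← LinearMap.trace_conj' A e, trace_triple]
  have h1 : e.conj A (1, 0, 0) = 0 :=
    (hA (.of_forall smoothTripleAt_radTriple)).trans (B.curv_rad_left _ _ _)
  have h2 : (e.conj A (0, 1, 0)).2.1 = 0 :=
    (congrArg (fun t ↦ t.2.1) (hA (.of_forall smoothTripleAt_reebTriple))).trans hreeb
  have h3 : LinearMap.snd ℝ ℝ (TangentSpace J (S.pr p)) ∘ₗ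
      LinearMap.snd ℝ ℝ (ℝ × TangentSpace J (S.pr p)) ∘ₗ e.conj A ∘ₗ
      LinearMap.inr ℝ ℝ (ℝ × TangentSpace J (S.pr p)) ∘ₗ
      LinearMap.inr ℝ ℝ (TangentSpace J (S.pr p)) = K := by
    refine LinearMap.ext fun x ↦ ?_
    have h4 := hA ((eventually_contMDiffAt_extend x).mono fun y hy ↦ smoothTripleAt_horTriple hy)
    have h5 := hK (FiberBundle.extend F x) (contMDiffAt_extend x)
    rw [← h4] at h5
    simp only [horTriple, extend_self] at h5
    exact h5
  rw [h1, h2, h3]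
  simp

variable {n : ℕ} (hn : Module.finrank ℝ F = 2 * n)
  (hσ : ∀ y v w, B.ν y v (B.σ y w) = 1 / (2 * n + 2) * ricci B.nabla y v w)
  (hU : ∀ y v, (2 * n + 1) * B.ν y v (B.U y) = -endoTrace (covEndo B.nabla B.σ y v))
  (hf : ∀ y, 2 * n * B.f y = endoTrace (B.nabla B.U y) + endoTrace ((B.σ y).comp (B.σ y)))

include hn hσ in
-- As `σ` is traceless, the trace is `Ric(Y, Z)` plus `ν(σY, Z) - 2nν(Y, σZ) + ν(Y, σZ) + 2ν(σZ,
-- Y)`. By skewness this sum is `-(2n+2)ν(Y, σZ)`, whence the normalization of `σ`.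
theorem ricci_hor_hor {p : P} (Y Z : TangentSpace J (S.pr p)) :
    ricci S.cone p (S.lift (horTriple (FiberBundle.extend F Y)) p)
      (S.lift (horTriple (FiberBundle.extend F Z)) p) = 0 := by
  let y := S.pr p
  have hY := eventually_contMDiffAt_extend Y
  have hZ := eventually_contMDiffAt_extend Z
  rw [S.ricci_cone_eq (hY.mono fun y hy ↦ smoothTripleAt_horTriple hy)
    (hZ.mono fun y hy ↦ smoothTripleAt_horTriple hy) (B.curv_reeb_hor_hor _ _ _)
    (curvatureLeft B.smooth y Y Z - B.ν y Y Z • (B.σ y).toLinearMap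
      + ((B.isSymplectic.flipForm y Z)).smulRight (B.σ y Y)
      - B.ν y Y (B.σ y Z) • LinearMap.id
      + (B.isSymplectic.flipForm y (B.σ y Z)).smulRight Y
      + (2 : ℝ) • (B.isSymplectic.flipForm y Y).smulRight (B.σ y Z))
    fun X hX ↦ ?_]
  · simp only [map_add, map_sub, map_smul, LinearMap.trace_smulRight, LinearMap.trace_id]
    have h1 : LinearMap.trace ℝ _ (B.σ y).toLinearMap = 0 :=
      B.isSymplectic.trace_eq_zero_of_skew _ (B.skew_σ y)
    have h2 : (Module.finrank ℝ (TangentSpace J y) : ℝ) = 2 * n := by exact_mod_cast hn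
    rw [h1, h2]
    have h3 := hσ y Y Z
    have h4 := B.skew_σ y Y Z
    have h5 := B.isSymplectic.swap y (B.σ y Z) Y
    have h6 : (2 * n + 2 : ℝ) ≠ 0 := by positivity
    simp only [IsSymplecticForm.flipForm_apply, smul_eq_mul]
    field_simp at h3
    linear_combination h4 + 2 * h5 - h3 - ricci_eq_trace B.smooth y Y Z
  · rw [B.curv_hor_hor_hor hX hY.self_of_nhds hZ.self_of_nhds]
    simp only [extend_self, LinearMap.add_apply, LinearMap.sub_apply, LinearMap.smul_apply,
      LinearMap.smulRight_apply, IsSymplecticForm.flipForm_apply, LinearMap.id_apply]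
    have h : curvatureLeft B.smooth y Y Z (X y) = curvature B.nabla (S.pr p) (X (S.pr p)) Y Z := rfl
    rw [h, smul_smul]
    rfl

include hn hU in
-- The trace of `X ↦ (∇_Yσ)X` vanishes by `covEndo_skew`. The terms with `U` add up to `(2n - 1 +
-- 2)ν(Y, U)`, which produces the coefficient `2n + 1`.
theorem ricci_hor_reeb {p : P} (Y : TangentSpace J (S.pr p)) :
    ricci S.cone p (S.lift (horTriple (FiberBundle.extend F Y)) p) (S.lift reebTriple p) = 0 := by
  let y := S.pr p
  have hY := eventually_contMDiffAt_extend Y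
  let τ : TangentSpace J y →ₗ[ℝ] TangentSpace J y :=
    { toFun := fun v ↦ covEndo B.nabla B.σ y v Y
      map_add' := fun v v' ↦ DFunLike.congr_fun
        ((smoothTensorialAt_covEndo B.nabla (B.smooth_σ y)).extend_add v v') Y
      map_smul' := fun c v ↦ DFunLike.congr_fun
        ((smoothTensorialAt_covEndo B.nabla (B.smooth_σ y)).extend_smul c v) Y }
  rw [S.ricci_cone_eq (hY.mono fun y hy ↦ smoothTripleAt_horTriple hy)
    (.of_forall smoothTripleAt_reebTriple) (B.curv_reeb_hor_reeb _ _)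
    ((covEndo B.nabla B.σ y Y).toLinearMap - τ + B.ν y Y (B.U y) • LinearMap.id
      - (B.isSymplectic.flipForm y (B.U y)).smulRight Y
      - (2 : ℝ) • (B.isSymplectic.flipForm y Y).smulRight (B.U y))
    fun X hX ↦ ?_]
  · simp only [map_add, map_sub, map_smul, LinearMap.trace_smulRight, LinearMap.trace_id]
    have h1 : LinearMap.trace ℝ _ τ = 0 := B.isSymplectic.trace_eq_zero_of_skew _
      (covEndo_skew B.preserves B.smooth_σ B.skew_σ y Y)
    have h2 : (Module.finrank ℝ (TangentSpace J y) : ℝ) = 2 * n := by exact_mod_cast hn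
    have h3 := hU y Y
    have h4 := B.isSymplectic.swap y (B.U y) Y
    rw [endoTrace] at h3
    rw [h1, h2]
    simp only [IsSymplecticForm.flipForm_apply, smul_eq_mul]
    linear_combination h3 - 2 * h4
  · rw [B.curv_hor_hor_reeb hX hY.self_of_nhds]
    simp only [extend_self, LinearMap.add_apply, LinearMap.sub_apply, LinearMap.smul_apply,
      LinearMap.smulRight_apply, IsSymplecticForm.flipForm_apply, LinearMap.id_apply]
    rw [smul_smul]
    rfl

include hn hf in
theorem ricci_reeb_reeb (p : P) :
    ricci S.cone p (S.lift reebTriple p) (S.lift reebTriple p) = 0 := by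
  let y := S.pr p
  rw [S.ricci_cone_eq (.of_forall smoothTripleAt_reebTriple)
    (.of_forall smoothTripleAt_reebTriple) (by simp [ConeBase.curv])
    (B.f y • LinearMap.id - (B.nabla B.U y).toLinearMap - ((B.σ y).comp (B.σ y)).toLinearMap)
    fun X hX ↦ ?_]
  · have h2 : (Module.finrank ℝ (TangentSpace J y) : ℝ) = 2 * n := by exact_mod_cast hn
    have h3 := hf y
    simp only [endoTrace] at h3
    simp only [map_sub, map_smul, LinearMap.trace_id, smul_eq_mul]
    rw [h2]
    linear_combination h3
  · rw [B.curv_hor_reeb_reeb]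
    rfl

include hn hσ hU hf in
theorem ricci_cone {Ω : Π p : P, TangentSpace I p →L[ℝ] TangentSpace I p →L[ℝ] ℝ}
    (hΩ : ∀ p u v, Ω p u v = Real.exp (2 * S.q p) * (B.ν (S.pr p) (mfderiv I J S.pr p u)
      (mfderiv I J S.pr p v) + (mvfderiv I S.q p u * S.b p v - S.b p u * mvfderiv I S.q p v)))
    (p : P) (v w : TangentSpace I p) : ricci S.cone p v w = 0 := by
  have hdec (v : TangentSpace I p) : v = (S.toTriple p v).1 • S.lift radTriple p
      + (S.toTriple p v).2.1 • S.lift reebTriple p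
      + S.lift (horTriple (FiberBundle.extend F (S.toTriple p v).2.2)) p := by
    refine (S.toTriple p).injective ?_
    rw [map_add, map_add, map_smul, map_smul, toTriple_lift, toTriple_lift, toTriple_lift]
    simp [radTriple, reebTriple, horTriple]
  -- Symmetry spares the computation of the Ricci component with the Reeb field in the first slot
  -- and a horizontal one in the second.
  have hsymm := ricci_symm S.smooth_cone S.torsion_cone
    (fun x V W ↦ S.contMDiffAt_form hΩ) (S.preserves_form hΩ)
    (S.isSymplecticForm_form hΩ).nondegenerate p
  have hbil (v w : TangentSpace I p) : ricci S.cone p v w = ricciForm S.smooth_cone p v w := rfl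
  rw [hdec v, hdec w, hbil]
  simp only [map_add, map_smul, LinearMap.add_apply, LinearMap.smul_apply, ← hbil,
    ricci_rad_left, ricci_rad_right, S.ricci_hor_hor hn hσ, S.ricci_hor_reeb hn hU,
    S.ricci_reeb_reeb hn hf, hsymm (S.lift reebTriple p) (S.lift (horTriple _) p)]
  simp

end Ricci

end ConeFibration

end Base

/-! ### The cone over a contact manifold as a fibration over N -/

section Cone

variable {E : Type*} [NormedAddCommGroup E] [NormedSpace ℝ E] [FiniteDimensional ℝ E]
  [CompleteSpace E] {H : Type*} [TopologicalSpace H] {I : ModelWithCorners ℝ E H}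
  {M : Type*} [TopologicalSpace M] [ChartedSpace H M] [IsManifold I ∞ M]
  {F : Type*} [NormedAddCommGroup F] [NormedSpace ℝ F] [FiniteDimensional ℝ F]
  [CompleteSpace F] {G : Type*} [TopologicalSpace G] {J : ModelWithCorners ℝ F G}
  {N : Type*} [TopologicalSpace N] [ChartedSpace G N] [IsManifold J ∞ N]

theorem dq_apply (p : ℝ × M) (u : TangentSpace (𝓘(ℝ, ℝ).prod I) p) : dq p u = u.1 := by
  have h := mfderiv_fst (I := 𝓘(ℝ, ℝ)) (I' := I) (x := p)
  exact DFunLike.congr_fun h u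

theorem dproj_apply (p : ℝ × M) (u : TangentSpace (𝓘(ℝ, ℝ).prod I) p) : dproj p u = u.2 :=
  DFunLike.congr_fun (mfderiv_snd (I := 𝓘(ℝ, ℝ)) (I' := I) (x := p)) u

theorem tangent_prod_ext {p : ℝ × M} {u v : TangentSpace (𝓘(ℝ, ℝ).prod I) p} (h : dq p u = dq p v)
    (h' : dproj p u = dproj p v) : u = v := by
  rw [dq_apply, dq_apply] at h
  rw [dproj_apply, dproj_apply] at h'
  exact Prod.ext h h'

theorem contMDiffAt_prod_section {c : ℝ} {X : Π x : M, TangentSpace I x} {p : ℝ × M}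
    (hX : CMDiffAt ∞ (T% X) p.2) :
    ContMDiffAt (𝓘(ℝ, ℝ).prod I) (𝓘(ℝ, ℝ).prod I).tangent ∞ (fun p : ℝ × M ↦
      TotalSpace.mk' (ℝ × E) (E := (TangentSpace (𝓘(ℝ, ℝ).prod I) : ℝ × M → Type _)) p
        (c, X p.2)) p := by
  have h1 : ContMDiffAt (𝓘(ℝ, ℝ).prod I) 𝓘(ℝ, ℝ).tangent ∞ (fun p : ℝ × M ↦
      TotalSpace.mk' ℝ (E := (TangentSpace 𝓘(ℝ, ℝ) : ℝ → Type _)) p.1 c) p := by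
    rw [contMDiffAt_totalSpace]
    refine ⟨contMDiffAt_fst, ?_⟩
    simpa using! contMDiffAt_const
  exact (contMDiff_equivTangentBundleProd_symm (I := 𝓘(ℝ, ℝ)) (M := ℝ) (I' := I) (M' := M)
    (n := ∞)).contMDiffAt.comp p (h1.prodMk (hX.comp p contMDiffAt_snd))

/-- The pullback of a one-form to the cone. -/
def OneForm.toCone (α : OneForm I M) : OneForm (𝓘(ℝ, ℝ).prod I) (ℝ × M) :=
  .ofApply (fun p ↦ (α p.2).comp (dproj p)) fun p V hV ↦ by
    have h : ContMDiffAt (𝓘(ℝ, ℝ).prod I) (I.prod 𝓘(ℝ, ℝ)) ∞ (fun p : ℝ × M ↦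
        TotalSpace.mk' ℝ (E := Bundle.Trivial M ℝ) p.2 (α p.2 (dproj p (V p)))) p := by
      apply ContMDiffAt.clm_bundle_apply (F₁ := E)
      · exact (α.smooth p.2).comp p contMDiffAt_snd
      · exact contMDiffAt_mfderiv_along contMDiff_snd hV
    exact (contMDiffAt_totalSpace.1 h).2

theorem OneForm.toCone_apply (α : OneForm I M) (p : ℝ × M)
    (u : TangentSpace (𝓘(ℝ, ℝ).prod I) p) : α.toCone p u = α p.2 (dproj p u) :=
  rfl

/-- The exterior derivative commutes with the pullback along `ℝ × M → M`: evaluate on extensions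
with constant `q`-component that project to fields on `M`. -/
theorem OneForm.d_toCone [I.Boundaryless] (α : OneForm I M) (p : ℝ × M)
    (u v : TangentSpace (𝓘(ℝ, ℝ).prod I) p) :
    α.toCone.d p u v = α.d p.2 (dproj p u) (dproj p v) := by
  let X (u : TangentSpace (𝓘(ℝ, ℝ).prod I) p) : Π x : M, TangentSpace I x :=
    FiberBundle.extend E (dproj p u)
  have hX (u) : CMDiffAt ∞ (T% (X u)) p.2 := contMDiffAt_extend _
  have hXp (u) : X u p.2 = dproj p u := extend_self _
  let V (u : TangentSpace (𝓘(ℝ, ℝ).prod I) p) (p' : ℝ × M) :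
    TangentSpace (𝓘(ℝ, ℝ).prod I) p' := (dq p u, X u p'.2)
  have hV (u) : CMDiffAt ∞ (T% (V u)) p := contMDiffAt_prod_section (hX u)
  have hVX (u) (p') : dproj p' (V u p') = X u p'.2 := dproj_apply _ _
  have hVp (u) : V u p = u := by
    refine tangent_prod_ext (dq_apply _ _) ?_
    rw [hVX, hXp]
  have hb : dproj p (mlieBracket (𝓘(ℝ, ℝ).prod I) (V u) (V v) p)
      = mlieBracket I (X u) (X v) p.2 :=
    mfderiv_mlieBracket contMDiff_snd (hV u) (hV v) (hX u) (hX v) (.of_forall (hVX u))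
      (.of_forall (hVX v))
  have hder (u v) : mvfderiv (𝓘(ℝ, ℝ).prod I) (fun p' ↦ α.toCone p' (V v p')) p (V u p)
      = mvfderiv I (fun x ↦ α x (X v x)) p.2 (X u p.2) := by
    simp only [toCone_apply, hVX]
    rw [← hVX u p]
    exact mvfderiv_comp_mfderiv (g := fun x ↦ α x (X v x)) p
      (α.mdifferentiableAt_apply ((hX v).mdifferentiableAt (by simp))) mdifferentiableAt_snd _
  have h1 := α.toCone.d_apply ((hV u).mdifferentiableAt (by simp))
    ((hV v).mdifferentiableAt (by simp))
  have h2 := α.d_apply ((hX u).mdifferentiableAt (by simp))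
    ((hX v).mdifferentiableAt (by simp))
  rw [hder, hder, toCone_apply, hb, ← h2, hVp, hVp, hXp, hXp] at h1
  exact h1

theorem mfderiv_comp_snd {pr : M → N} (hpr : ContMDiff I J ∞ pr) (p : ℝ × M)
    (u : TangentSpace (𝓘(ℝ, ℝ).prod I) p) :
    mfderiv (𝓘(ℝ, ℝ).prod I) J (pr ∘ Prod.snd) p u = mfderiv I J pr p.2 (dproj p u) :=
  mfderiv_comp_apply p (hpr.mdifferentiable (by simp) _) mdifferentiableAt_snd u

section Contact

variable {B : ConeBase J N} {α : OneForm I M} (hα : IsContactForm α) {pr : M → N}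
  (hpr : ContMDiff I J ∞ pr)
  (hd : ∀ x u v, α.d x u v = B.ν (pr x) (mfderiv I J pr x u) (mfderiv I J pr x v))

include hα hd in
-- The difference lies in `ker α` and is annihilated by `dα = π^*ν`, so it vanishes by the contact
-- condition.
theorem eq_of_contact {x : M} {u v : TangentSpace I x} (h : α x u = α x v)
    (h' : mfderiv I J pr x u = mfderiv I J pr x v) : u = v := by
  refine sub_eq_zero.1 (hα.nondegenerate x (u - v) (by rw [map_sub, h, sub_self]) fun w _ ↦ ?_)
  rw [hd, map_sub, h', sub_self, map_zero]
  rfl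

/-- The cone over a contact manifold as a fibration over the symplectic base. -/
def contactCone [I.Boundaryless] (hfin : Module.finrank ℝ E = Module.finrank ℝ F + 1) :
    ConeFibration (𝓘(ℝ, ℝ).prod I) (ℝ × M) B where
  q := Prod.fst
  smooth_q _ := contMDiffAt_fst
  b := α.toCone
  pr := pr ∘ Prod.snd
  smooth_pr := hpr.comp contMDiff_snd
  bijective p := by
    let l : TangentSpace (𝓘(ℝ, ℝ).prod I) p →ₗ[ℝ] Triple J (pr p.2) :=
      (dq p).toLinearMap.prod ((α.toCone p).toLinearMap.prod
        (mfderiv (𝓘(ℝ, ℝ).prod I) J (pr ∘ Prod.snd) p).toLinearMap)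
    have hl : Function.Injective l := fun u v h ↦ by
      have h1 : dq p u = dq p v := congrArg Prod.fst h
      have h2 : α.toCone p u = α.toCone p v := congrArg (fun t ↦ t.2.1) h
      have h3 : mfderiv (𝓘(ℝ, ℝ).prod I) J (pr ∘ Prod.snd) p u
        = mfderiv (𝓘(ℝ, ℝ).prod I) J (pr ∘ Prod.snd) p v := congrArg (fun t ↦ t.2.2) h
      rw [mfderiv_comp_snd hpr, mfderiv_comp_snd hpr] at h3
      exact tangent_prod_ext h1 (eq_of_contact hα hd h2 h3)
    -- Both sides have dimension `dim N + 2`, so injectivity gives bijectivity.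
    have hdim : Module.finrank ℝ (ℝ × E) = Module.finrank ℝ (ℝ × ℝ × F) := by
      rw [Module.finrank_prod, Module.finrank_prod, Module.finrank_prod, hfin]
      simp [add_comm]
    exact ⟨hl, (LinearMap.injective_iff_surjective_of_finrank_eq_finrank (f := l) hdim).1 hl⟩
  -- The factor 2 of the structure equation undoes the `½` in the normalization of `dα`.
  structure_eq p V W hV hW := by
    have h := α.toCone.d_apply (hV.mdifferentiableAt (by simp)) (hW.mdifferentiableAt (by simp))
    rw [α.d_toCone, hd, ← mfderiv_comp_snd hpr, ← mfderiv_comp_snd hpr] at h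
    rw [Function.comp_apply, h]
    ring

end Contact

end Cone

/-! ### Cone property and explicit formulas -/

section Cone

variable {E : Type*} [NormedAddCommGroup E] [NormedSpace ℝ E] [FiniteDimensional ℝ E]
  [CompleteSpace E] {H : Type*} [TopologicalSpace H] {I : ModelWithCorners ℝ E H}
  [I.Boundaryless]
  {M : Type*} [TopologicalSpace M] [ChartedSpace H M] [IsManifold I ∞ M]
  {F : Type*} [NormedAddCommGroup F] [NormedSpace ℝ F] [FiniteDimensional ℝ F]
  [CompleteSpace F] {G : Type*} [TopologicalSpace G] {J : ModelWithCorners ℝ F G}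
  {N : Type*} [TopologicalSpace N] [ChartedSpace G N] [IsManifold J ∞ N]

theorem covAlong_comp_snd (D : AffineConnection J N) {pr : M → N} (hpr : ContMDiff I J ∞ pr)
    {Z : Π x : M, TangentSpace J (pr x)} {p : ℝ × M}
    (hZ : MDifferentiableAt I J.tangent (fun x ↦ TotalSpace.mk' F (pr x) (Z x)) p.2)
    (v : TangentSpace (𝓘(ℝ, ℝ).prod I) p) :
    covAlong (𝓘(ℝ, ℝ).prod I) (pr ∘ Prod.snd) D (fun p ↦ Z p.2) p v
      = covAlong I pr D Z p.2 (dproj p v) := by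
  rw [covAlong_apply, covAlong_apply]
  refine Finset.sum_congr rfl fun i _ ↦ ?_
  rw [mfderiv_comp_snd hpr]
  have h := mvfderiv_comp_mfderiv (g := fun x ↦ frameCoeff J (pr p.2) i (pr x) (Z x)) p
    (mdifferentiableAt_frameCoeff_along hZ i) (mdifferentiableAt_snd (I := 𝓘(ℝ, ℝ)) (I' := I)) v
  exact congrArg (fun c : ℝ ↦ c • coordFrame J (pr p.2) i (pr p.2)
    + frameCoeff J (pr p.2) i (pr p.2) (Z p.2) •
      D (coordFrame J (pr p.2) i) (pr p.2) (mfderiv I J pr p.2 (dproj p v))) h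

section Contact

variable {B : ConeBase J N} {α : OneForm I M} (hα : IsContactForm α) {pr : M → N}
  (hpr : ContMDiff I J ∞ pr)
  (hd : ∀ x u v, α.d x u v = B.ν (pr x) (mfderiv I J pr x u) (mfderiv I J pr x v))
  (hfin : Module.finrank ℝ E = Module.finrank ℝ F + 1)

theorem toTriple_contactCone (p : ℝ × M) (u : TangentSpace (𝓘(ℝ, ℝ).prod I) p) :
    (contactCone hα hpr hd hfin).toTriple p u
      = (dq p u, α p.2 (dproj p u), mfderiv I J pr p.2 (dproj p u)) := by
  rw [← mfderiv_comp_snd hpr]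
  rfl

theorem coneForm_eq (p : ℝ × M) (u v : TangentSpace (𝓘(ℝ, ℝ).prod I) p) :
    let S := contactCone hα hpr hd hfin
    coneForm α p u v = Real.exp (2 * S.q p) * (B.ν (S.pr p)
      (mfderiv (𝓘(ℝ, ℝ).prod I) J S.pr p u) (mfderiv (𝓘(ℝ, ℝ).prod I) J S.pr p v)
      + (mvfderiv (𝓘(ℝ, ℝ).prod I) S.q p u * S.b p v
        - S.b p u * mvfderiv (𝓘(ℝ, ℝ).prod I) S.q p v)) := by
  intro S
  rw [coneForm_apply, hd, ← mfderiv_comp_snd hpr, ← mfderiv_comp_snd hpr]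
  rfl

/-- The Reeb vector field. -/
def reebField (x : M) : TangentSpace I x :=
  dproj ((0 : ℝ), x) ((contactCone hα hpr hd hfin).lift reebTriple ((0 : ℝ), x))

theorem apply_reebField (x : M) : α x (reebField hα hpr hd hfin x) = 1 :=
  (contactCone hα hpr hd hfin).b_lift reebTriple ((0 : ℝ), x)

theorem mfderiv_reebField (x : M) : mfderiv I J pr x (reebField hα hpr hd hfin x) = 0 :=
  (mfderiv_comp_snd hpr ((0 : ℝ), x) _).symm.trans
    ((contactCone hα hpr hd hfin).mfderiv_lift reebTriple ((0 : ℝ), x))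

theorem isReebField_reebField : IsReebField α (reebField hα hpr hd hfin) where
  apply_eq_one := apply_reebField hα hpr hd hfin
  d_apply_eq_zero x v := by
    rw [hd, mfderiv_reebField, map_zero]
    rfl

theorem dq_fromBase (Y : Π x : M, TangentSpace I x) (p : ℝ × M) : dq p (fromBase Y p) = 0 :=
  dq_apply _ _

theorem dproj_fromBase (Y : Π x : M, TangentSpace I x) (p : ℝ × M) :
    dproj p (fromBase Y p) = Y p.2 :=
  dproj_apply _ _

theorem toTriple_fromBase (Y : Π x : M, TangentSpace I x) (p : ℝ × M) :
    (contactCone hα hpr hd hfin).toTriple p (fromBase Y p)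
      = (0, α p.2 (Y p.2), mfderiv I J pr p.2 (Y p.2)) := by
  rw [toTriple_contactCone, dq_fromBase, dproj_fromBase]

/-- The slice `q = 0` used to define the Reeb field is immaterial: the components `(0, 1, 0)` are
the same at every height. -/
theorem fromBase_reebField (p : ℝ × M) : fromBase (reebField hα hpr hd hfin) p
    = (contactCone hα hpr hd hfin).lift reebTriple p := by
  refine ((contactCone hα hpr hd hfin).toTriple p).injective ?_
  rw [toTriple_fromBase, apply_reebField, mfderiv_reebField, ConeFibration.toTriple_lift]
  rfl

theorem radial_eq_lift (p : ℝ × M) :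
    radial I M p = (contactCone hα hpr hd hfin).lift radTriple p := by
  refine ((contactCone hα hpr hd hfin).toTriple p).injective ?_
  rw [toTriple_contactCone, ConeFibration.toTriple_lift, dproj_apply, dq_apply]
  refine Prod.ext rfl (Prod.ext ?_ ?_)
  · exact map_zero (α p.2)
  · exact map_zero (mfderiv I J pr p.2)

/-- The three conditions prescribe all components, so a horizontal lift is unique and formulas for
arbitrary ones reduce to `lift`. -/
theorem IsHorizontalLift.eq_lift {X : Π y : N, TangentSpace J y}
    {X' : Π p : ℝ × M, TangentSpace (𝓘(ℝ, ℝ).prod I) p} (h : IsHorizontalLift α pr X X')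
    (p : ℝ × M) : X' p = (contactCone hα hpr hd hfin).lift (horTriple X) p := by
  refine ((contactCone hα hpr hd hfin).toTriple p).injective ?_
  rw [toTriple_contactCone, ConeFibration.toTriple_lift, (h p).1, (h p).2.1, (h p).2.2]
  rfl

/-- For `v` coming from `M` the right-hand side depends on `p` only through its projection to `M`;
this is the translation invariance of the cone connection. -/
theorem toTriple_cone_fromBase {Y : Π x : M, TangentSpace I x}
    (hY : ContMDiff I I.tangent ∞ (T% Y)) (p : ℝ × M) (v : TangentSpace (𝓘(ℝ, ℝ).prod I) p) :
    (contactCone hα hpr hd hfin).toTriple p ((contactCone hα hpr hd hfin).cone (fromBase Y) p v)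
      = (0, mvfderiv I (fun x ↦ α x (Y x)) p.2 (dproj p v),
          covAlong I pr B.nabla (fun x ↦ mfderiv I J pr x (Y x)) p.2 (dproj p v))
        + B.mult (pr p.2) (dq p v, α p.2 (dproj p v), mfderiv I J pr p.2 (dproj p v))
          (0, α p.2 (Y p.2), mfderiv I J pr p.2 (Y p.2)) := by
  have h0 := (contactCone hα hpr hd hfin).toTriple_cone (fromBase Y) p v
  have h1 : (fun p ↦ mvfderiv (𝓘(ℝ, ℝ).prod I) (contactCone hα hpr hd hfin).q p (fromBase Y p))
      = fun _ ↦ 0 := funext (dq_fromBase Y)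
  have h2 : mvfderiv (𝓘(ℝ, ℝ).prod I) (fun p ↦ (contactCone hα hpr hd hfin).b p (fromBase Y p)) p v
      = mvfderiv I (fun x ↦ α x (Y x)) p.2 (dproj p v) := by
    have h : (fun p ↦ (contactCone hα hpr hd hfin).b p (fromBase Y p))
        = (fun x ↦ α x (Y x)) ∘ Prod.snd := by
      ext p
      exact congrArg (α p.2) (dproj_fromBase Y p)
    rw [h]
    exact mvfderiv_comp_mfderiv p
      (α.mdifferentiableAt_apply (hY.mdifferentiable (by simp) _)) mdifferentiableAt_snd v
  have h3 : covAlong (𝓘(ℝ, ℝ).prod I) (contactCone hα hpr hd hfin).pr B.nabla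
      (fun p ↦ mfderiv (𝓘(ℝ, ℝ).prod I) J (contactCone hα hpr hd hfin).pr p (fromBase Y p)) p v
      = covAlong I pr B.nabla (fun x ↦ mfderiv I J pr x (Y x)) p.2 (dproj p v) := by
    have h : (fun p ↦ mfderiv (𝓘(ℝ, ℝ).prod I) J (contactCone hα hpr hd hfin).pr p (fromBase Y p))
        = fun p : ℝ × M ↦ mfderiv I J pr p.2 (Y p.2) := by
      ext p : 1
      exact (mfderiv_comp_snd hpr p _).trans (congrArg (mfderiv I J pr p.2) (dproj_fromBase Y p))
    rw [h]
    exact covAlong_comp_snd B.nabla hpr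
      (mdifferentiableAt_mfderiv_along hpr (hY.mdifferentiable (by simp) _)) v
  rw [h1, h2, h3, mvfderiv_const, toTriple_fromBase] at h0
  rw [← toTriple_contactCone hα hpr hd hfin p v]
  exact h0

theorem isConeConnection_cone : IsConeConnection (contactCone hα hpr hd hfin).cone where
  radial_eq_id p v := by
    have h : radial I M = (contactCone hα hpr hd hfin).lift radTriple :=
      funext (radial_eq_lift hα hpr hd hfin)
    rw [h]
    refine ((contactCone hα hpr hd hfin).toTriple p).injective ?_
    rw [ConeFibration.toTriple_cone_lift _ (smoothTripleAt_radTriple _)]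
    simp only [ConeBase.deriv_apply, ConeBase.mult_apply, radTriple, B.nabla_zero,
      ConeBase.mvfderiv_const_apply, map_zero]
    refine Prod.ext ?_ (Prod.ext ?_ ?_)
    · simp
    · simp
    · simp
  apply_radial Y hY p := by
    refine ((contactCone hα hpr hd hfin).toTriple p).injective ?_
    have h1 : dproj p (radial I M p) = 0 := dproj_apply _ _
    have h2 : dq p (radial I M p) = 1 := dq_apply _ _
    rw [toTriple_cone_fromBase hα hpr hd hfin hY, toTriple_fromBase, h1, h2]
    refine (congrArg₂ (· + ·) ?_ ?_).trans (zero_add _)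
    · simp only [map_zero]
      rfl
    · simp only [ConeBase.mult_apply, map_zero]
      refine Prod.ext ?_ (Prod.ext ?_ ?_)
      · simp
      · simp
      · simp
  invariant X Y hX hY q q' x := by
    have h1 := toTriple_cone_fromBase hα hpr hd hfin hY (q, x) (fromBase X (q, x))
    have h2 := toTriple_cone_fromBase hα hpr hd hfin hY (q', x) (fromBase X (q', x))
    rw [toTriple_contactCone, dproj_fromBase, dq_fromBase] at h1 h2
    have h3 := h1.trans h2.symm
    -- The triples at the two heights agree, and `α` together with `dπ` determines the component
    -- tangent to `M`.
    exact ⟨congrArg Prod.fst h3, eq_of_contact hα hd (congrArg (fun t ↦ t.2.1) h3)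
      (congrArg (fun t ↦ t.2.2) h3)⟩

theorem isBuiltFrom_cone : IsBuiltFrom (contactCone hα hpr hd hfin).cone α
    (reebField hα hpr hd hfin) pr B.ν B.nabla B.σ B.U B.f := by
  set S := contactCone hα hpr hd hfin with hS
  have hR : fromBase (reebField hα hpr hd hfin) = S.lift reebTriple :=
    funext (fromBase_reebField hα hpr hd hfin)
  have hQ : radial I M = S.lift radTriple := funext (radial_eq_lift hα hpr hd hfin)
  have hH {X : Π y : N, TangentSpace J y} {X' : Π p : ℝ × M, TangentSpace (𝓘(ℝ, ℝ).prod I) p}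
    (h : IsHorizontalLift α pr X X') : X' = S.lift (horTriple X) :=
    funext (h.eq_lift hα hpr hd hfin)
  have hX {X : Π y : N, TangentSpace J y} (h : ContMDiff J J.tangent ∞ (T% X)) (y : N) :
    SmoothTripleAt (horTriple X) y := smoothTripleAt_horTriple (h y)
  constructor
  · intro X Y _ hY X' Y' Z' hX' hY' hZ' p
    rw [hR, hQ, hH hX', hH hY', hH hZ', S.cone_lift_lift _ (hX hY _), B.cov_hor_hor]
    refine (S.toTriple p).injective ?_
    simp only [map_sub, map_smul, S.toTriple_lift, horTriple, reebTriple, radTriple]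
    refine Prod.ext ?_ (Prod.ext ?_ ?_)
    · simp; rfl
    · simp; rfl
    · simp
  · intro X hX0 X' Z' hX' hZ' p
    rw [hR, hQ, hH hX', hH hZ', S.cone_lift_lift _ (hX hX0 _), B.cov_reeb_hor]
    refine (S.toTriple p).injective ?_
    simp only [map_add, map_smul, S.toTriple_lift, horTriple, radTriple]
    refine Prod.ext ?_ (Prod.ext ?_ ?_)
    · simp; rfl
    · simp
    · simp
  · intro X hX0 X' Z' hX' hZ' p
    rw [hR, hQ, hH hX', hH hZ', S.cone_lift_lift _ (smoothTripleAt_reebTriple _), B.cov_hor_reeb]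
    refine (S.toTriple p).injective ?_
    simp only [map_add, map_smul, S.toTriple_lift, horTriple, radTriple]
    refine Prod.ext ?_ (Prod.ext ?_ ?_)
    · simp; rfl
    · simp
    · simp
  · intro U' hU' p
    rw [hR, hQ, hH hU', S.cone_lift_lift _ (smoothTripleAt_reebTriple _), B.cov_reeb_reeb]
    refine (S.toTriple p).injective ?_
    simp only [map_sub, map_smul, S.toTriple_lift, horTriple, radTriple]
    refine Prod.ext ?_ (Prod.ext ?_ ?_)
    · simp; rfl
    · simp
    · simp
  · intro X hX0 X' hX' p
    rw [hQ, hH hX', S.cone_lift_lift _ (hX hX0 _), B.cov_rad_left]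
  · intro p
    rw [hR, hQ, S.cone_lift_lift _ (smoothTripleAt_reebTriple _), B.cov_rad_left]
  · exact (isConeConnection_cone hα hpr hd hfin).radial_eq_id

end Contact

end Cone

end SymplecticCone

end

/-! ### The main theorem -/

theorem mainTheorem6 (n : ℕ)
    {M : Type*} [TopologicalSpace M] [T2Space M] [SecondCountableTopology M]
    [ChartedSpace (EuclideanSpace ℝ (Fin (2 * n + 1))) M] [IsManifold (𝓡 (2 * n + 1)) ∞ M]
    {N : Type*} [TopologicalSpace N] [T2Space N] [SecondCountableTopology N]
    [ChartedSpace (EuclideanSpace ℝ (Fin (2 * n))) N] [IsManifold (𝓡 (2 * n)) ∞ N]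
    -- the contact manifold `(M, α)` and the symplectic manifold `(N, ν)`
    (α : SymplecticCone.OneForm (𝓡 (2 * n + 1)) M) (hα : SymplecticCone.IsContactForm α)
    (ν : Π y : N, TangentSpace (𝓡 (2 * n)) y →L[ℝ] TangentSpace (𝓡 (2 * n)) y →L[ℝ] ℝ)
    (hν : SymplecticCone.IsSymplecticForm ν)
    -- the projection `M → N`, with `dα` equal to the pullback of `ν`
    (pr : M → N) (hpr : ContMDiff (𝓡 (2 * n + 1)) (𝓡 (2 * n)) ∞ pr)
    (hd : ∀ (x : M) (u v : TangentSpace (𝓡 (2 * n + 1)) x),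
      α.d x u v = ν (pr x) (mfderiv (𝓡 (2 * n + 1)) (𝓡 (2 * n)) pr x u)
        (mfderiv (𝓡 (2 * n + 1)) (𝓡 (2 * n)) pr x v))
    -- the symplectic connection on `N`
    (nabla : SymplecticCone.AffineConnection (𝓡 (2 * n)) N)
    (hsmooth : CovariantDerivative.ContMDiffCovariantDerivative nabla ∞)
    (htorsion : nabla.torsion = 0) (hnabla : SymplecticCone.Preserves nabla ν) :
    SymplecticCone.IsSymplecticForm (SymplecticCone.coneForm α) ∧
    ∃ D : SymplecticCone.AffineConnection (𝓘(ℝ, ℝ).prod (𝓡 (2 * n + 1))) (ℝ × M),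
      CovariantDerivative.ContMDiffCovariantDerivative D ∞ ∧
      D.torsion = 0 ∧
      (∀ p v w, SymplecticCone.ricci D p v w = 0) ∧
      SymplecticCone.IsConeConnection D ∧
      SymplecticCone.Preserves D (SymplecticCone.coneForm α) ∧
      -- the explicit form of `D`
      ∃ (R : Π x : M, TangentSpace (𝓡 (2 * n + 1)) x)
        (σ : Π y : N, TangentSpace (𝓡 (2 * n)) y →L[ℝ] TangentSpace (𝓡 (2 * n)) y)
        (U : Π y : N, TangentSpace (𝓡 (2 * n)) y) (f : N → ℝ),
        SymplecticCone.IsReebField α R ∧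
        (∀ y v w, ν y v (σ y w) = 1 / (2 * n + 2) * SymplecticCone.ricci nabla y v w) ∧
        (∀ y v, (2 * n + 1) * ν y v (U y)
          = -SymplecticCone.endoTrace (SymplecticCone.covEndo nabla σ y v)) ∧
        (∀ y, 2 * n * f y = SymplecticCone.endoTrace (nabla U y)
          + SymplecticCone.endoTrace ((σ y).comp (σ y))) ∧
        SymplecticCone.IsBuiltFrom D α R pr ν nabla σ U f := by
  have hn : Module.finrank ℝ (EuclideanSpace ℝ (Fin (2 * n))) = 2 * n := by simp
  have hfin : Module.finrank ℝ (EuclideanSpace ℝ (Fin (2 * n + 1)))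
      = Module.finrank ℝ (EuclideanSpace ℝ (Fin (2 * n))) + 1 := by simp
  obtain ⟨σ, U, f, hσ, hU, hf, hskew, hσ', hU', hf'⟩ :=
    SymplecticCone.exists_cone_data hn hν hsmooth htorsion hnabla
  let B : SymplecticCone.ConeBase (𝓡 (2 * n)) N :=
    ⟨ν, hν, nabla, hsmooth, htorsion, hnabla, σ, U, f, hσ, hU, hf, hskew⟩
  let S : SymplecticCone.ConeFibration (𝓘(ℝ, ℝ).prod (𝓡 (2 * n + 1))) (ℝ × M) B :=
    SymplecticCone.contactCone hα hpr hd hfin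
  have hΩ := SymplecticCone.coneForm_eq (B := B) hα hpr hd hfin
  exact ⟨S.isSymplecticForm_form hΩ, S.cone, S.smooth_cone, S.torsion_cone,
    S.ricci_cone hn hσ' hU' hf' hΩ,
    SymplecticCone.isConeConnection_cone hα hpr hd hfin, S.preserves_form hΩ,
    SymplecticCone.reebField (B := B) hα hpr hd hfin, σ, U, f,
    SymplecticCone.isReebField_reebField hα hpr hd hfin, hσ', hU', hf',
    SymplecticCone.isBuiltFrom_cone (B := B) hα hpr hd hfin⟩
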